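/- Let $\Omega\subset\mathbb{R}^2$ be a compact strictly convex region with the origin $O$ in its interior, whose boundary is a simple closed regular $C^2$ curve, oriented counterclockwise. The outer billiard map $B^{\rm out}_\Omega$ sends a point $p\notin\Omega$ to its reflection in the point $q\in\partial\Omega$ at which the oriented line from $p$ to $q$ is tangent to $\partial\Omega$ with the orientation of $\partial\Omega$ (so $q$ is the midpoint of $p$ and $B^{\rm out}_\Omega(p)$). For $\phi_1<\phi_2<\phi_1+\pi$ let $\mathcal S^{\rm out}_\Omega(\phi_1,\phi_2)$ be the area of the triangle bounded by the rays from $O$ with polar angles $\phi_1,\phi_2$ and by the segment with ends on these rays that is tangent to $\partial\Omega$ exactly at its midpoint; this is a generating function of $B^{\rm out}_\Omega$. A configuration $(\phi_i)_{i\in\mathbb{Z}}$ with $0<\phi_{i+1}-\phi_i<\pi$ is action-minimizing if each of its finite segments minimizes $\sum_i\mathcal S^{\rm out}_\Omega(\phi_i,\phi_{i+1})$ among all such segments with the same end-points; its rotation number is $\lim_{i\to\pm\infty}\phi_i/(2\pi i)$. Mather's $\beta$-function is $$\beta^{\rm out}_\Omega(\omega)=\lim_{N\to\infty}\frac1{2N}\sum_{i=-N}^{N-1}\mathcal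 S^{\rm out}_\Omega(\phi_i,\phi_{i+1}),$$ where $(\phi_i)$ is any action-minimizing configuration of rotation number $\omega$. Let $|\Omega|$ be the area of $\Omega$ and $\mathcal D$ the closed unit disk centred at the origin. **Theorem.** (1) Suppose that $B^{\rm out}_\Omega$ admits an invariant curve (a simple closed curve in the exterior of $\Omega$, mapped onto itself) consisting of periodic points of period $3$. Then $\beta^{\rm out}_\Omega(1/3)$ and $\beta^{\rm out}_{\mathcal D}(1/3)$ are well defined (minimizing configurations of rotation number $1/3$ exist, and the limit exists and is the same for all of them), and $$\beta^{\rm out}_\Omega\left(\tfrac13\right)\ \ge\ \frac{|\Omega|}{\pi}\,\beta^{\rm out}_{\mathcal D}\left(\tfrac13\right),$$ with equality if and only if $\Omega$ is an ellipse (together with its interior). (2) There are regions $\Omega$ as in (1) that are not ellipses, and hence satisfy the strict inequality $\beta^{\rm out}_\Omega(1/3)>\frac{|\Omega|}{\pi}\beta^{\rm out}_{\mathcal D}(1/3)$; so the inequality $\beta^{\rm out}_\Omega(1/3)\le\frac{|\Omega|}{\pi}\beta^{\rm out}_{\mathcal D}(1/3)$ does not hold for all $\Omega$. -/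

import Mathlib

open Real Set Filter Topology MeasureTheory

noncomputable section

/-- The Euclidean plane. -/
abbrev Plane : Type := EuclideanSpace ℝ (Fin 2)

/-- The standard area form, i.e. the determinant of the matrix with columns `u`, `v`. -/
def areaForm2 (u v : Plane) : ℝ := u 0 * v 1 - u 1 * v 0

/-- The unit vector with polar angle `φ`. -/
def unitDir (φ : ℝ) : Plane := !₂[Real.cos φ, Real.sin φ]

/-- A billiard table: a compact strictly convex region of the plane with the origin in its
interior, whose boundary is a closed curve of class `C²` (it has a regular simple closed
`C²` parametrization). -/
structure IsBilliardTable (Ω : Set Plane) : Prop where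
  isCompact : IsCompact Ω
  strictConvex : StrictConvex ℝ Ω
  zero_mem : (0 : Plane) ∈ interior Ω
  boundary : ∃ γ : ℝ → Plane, ContDiff ℝ 2 γ ∧ Function.Periodic γ (2 * π) ∧
    (∀ t, deriv γ t ≠ 0) ∧ Set.InjOn γ (Set.Ico 0 (2 * π)) ∧ Set.range γ = frontier Ω

/-- `q` is the point at which the positively oriented tangent line from `p` touches `Ω`: the
oriented line from `p` to `q` meets `Ω` at `q` and has `Ω` on its left-hand side, that is, the
vector from `p` to `q` has the direction of the counterclockwise oriented boundary at `q`. -/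
def IsTangencyPoint (Ω : Set Plane) (p q : Plane) : Prop :=
  q ∈ Ω ∧ ∀ z ∈ Ω, 0 ≤ areaForm2 (q - p) (z - p)

open Classical in
/-- The outer billiard map: a point `p` outside `Ω` is reflected in its tangency point `q`, so
that `q` is the midpoint of `p` and its image. (On `Ω` the map is the identity.) -/
def outerBilliard (Ω : Set Plane) (p : Plane) : Plane :=
  if h : ∃ q, IsTangencyPoint Ω p q then (2 : ℝ) • h.choose - p else p

/-- The outer billiard map of `Ω` has an invariant curve consisting of `n`-periodic points: a
simple closed curve `c` in the exterior of `Ω` that is mapped onto itself, all of whose points are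
periodic of period `n`. (The map has no fixed point outside `Ω`, so that for a prime `n` the
minimal period of these points is `n`.) -/
def HasInvariantCurveOfPeriod (Ω : Set Plane) (n : ℕ) : Prop :=
  ∃ c : Circle → Plane, Continuous c ∧ Function.Injective c ∧ Set.range c ⊆ Ωᶜ ∧
    outerBilliard Ω '' Set.range c = Set.range c ∧
    ∀ p ∈ Set.range c, Function.IsPeriodicPt (outerBilliard Ω) n p

/-- The segment from `r.1 • unitDir φ₁` to `r.2 • unitDir φ₂`, with ends on the rays from the
origin of angles `φ₁`, `φ₂`, is tangent to `Ω` exactly at its midpoint. -/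
def IsMidTangentSegment (Ω : Set Plane) (φ₁ φ₂ : ℝ) (r : ℝ × ℝ) : Prop :=
  0 < r.1 ∧ 0 < r.2 ∧
    IsTangencyPoint Ω (r.1 • unitDir φ₁) (midpoint ℝ (r.1 • unitDir φ₁) (r.2 • unitDir φ₂))

open Classical in
/-- The generating function of the outer billiard in polar coordinates: for
`φ₁ < φ₂ < φ₁ + π`, the area of the triangle bounded by the rays of angles `φ₁`, `φ₂` and the
segment between them that is tangent to `Ω` at its midpoint. -/
def outerGen (Ω : Set Plane) (φ₁ φ₂ : ℝ) : ℝ :=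
  if h : ∃ r : ℝ × ℝ, IsMidTangentSegment Ω φ₁ φ₂ r then
    h.choose.1 * h.choose.2 * Real.sin (φ₂ - φ₁) / 2
  else 0

/-- The action `∑_{m ≤ i < n} S (x i) (x (i + 1))` of a finite segment of a configuration. -/
def segmentAction (S : ℝ → ℝ → ℝ) (x : ℤ → ℝ) (m n : ℤ) : ℝ :=
  ∑ i ∈ Finset.Ico m n, S (x i) (x (i + 1))

/-- The segment of `x` from index `m` to index `n` stays in the domain `0 < x' - x < π` of the
generating function. -/
def IsAdmissibleOn (x : ℤ → ℝ) (m n : ℤ) : Prop :=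
  ∀ i, m ≤ i → i < n → 0 < x (i + 1) - x i ∧ x (i + 1) - x i < π

/-- An action-minimizing configuration: each finite segment minimizes the action among the
segments with the same end-points. -/
def IsActionMinimizing (S : ℝ → ℝ → ℝ) (x : ℤ → ℝ) : Prop :=
  ∀ m n : ℤ, m < n → IsAdmissibleOn x m n ∧
    ∀ y : ℤ → ℝ, IsAdmissibleOn y m n → y m = x m → y n = x n →
      segmentAction S x m n ≤ segmentAction S y m n

/-- The configuration `x` of angles has rotation number `ω`, measured in full turns. -/
def HasRotationNumber (x : ℤ → ℝ) (ω : ℝ) : Prop :=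
  Tendsto (fun i : ℤ => x i / (2 * π * (i : ℝ))) atTop (𝓝 ω) ∧
    Tendsto (fun i : ℤ => x i / (2 * π * (i : ℝ))) atBot (𝓝 ω)

/-- The number `b` is the minimal average action at `ω`: there are action-minimizing
configurations of rotation number `ω`, and the average action of each of them is `b`. -/
def IsMinimalAverageAction (S : ℝ → ℝ → ℝ) (ω b : ℝ) : Prop :=
  (∃ x : ℤ → ℝ, IsActionMinimizing S x ∧ HasRotationNumber x ω) ∧
    ∀ x : ℤ → ℝ, IsActionMinimizing S x → HasRotationNumber x ω →
      Tendsto (fun N : ℕ => (1 / (2 * (N : ℝ))) * segmentAction S x (-(N : ℤ)) (N : ℤ))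
        atTop (𝓝 b)

open Classical in
/-- Mather's `β`-function (minimal average action) of a generating function. -/
def matherBeta (S : ℝ → ℝ → ℝ) (ω : ℝ) : ℝ :=
  if h : ∃ b, IsMinimalAverageAction S ω b then h.choose else 0

/-- Mather's `β`-function of the outer billiard of `Ω`. -/
def betaOut (Ω : Set Plane) (ω : ℝ) : ℝ := matherBeta (outerGen Ω) ω

/-- The closed unit disk. -/
def unitDisk : Set Plane := Metric.closedBall 0 1

/-- A region bounded by an ellipse: an affine image of the unit disk. -/
def IsEllipse (Ω : Set Plane) : Prop :=
  ∃ A : Plane ≃ᵃ[ℝ] Plane, Ω = A '' unitDisk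

end

/-! ### The area form and polar coordinates -/

/-! The three sides of a 3-periodic orbit touch the table at their midpoints, so the touching points
form the medial triangle of the orbit triangle: an inscribed triangle whose vertices have supporting
lines parallel to the opposite sides. Such critical triangles include every inscribed triangle of
maximal area. The theorem follows by expressing the minimal average action at 1/3 through their area
and comparing that area with the area of the table.

A critical triangle is determined by one vertex and the direction of the opposite side
(`IsCriticalTriangle.eq_of_parallel`). Hence along an invariant curve of 3-periodic points the
tangent direction is an injective map from circle to circle, so it is onto, and every critical
triangle comes from the curve. The curve is moreover a graph `r` in polar coordinates, on which the
outer billiard acts by a homeomorphism `F` of the angles with `F ∘ F ∘ F` a full turn.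

The potential `U = ∫ r² / 2` calibrates the action. The derivative of `S` in its second angle is
half the squared second radius, so by the twist property `S φ ψ - U ψ + U φ` is smallest at `ψ = F
φ`, and that smallest value `C` does not depend on `φ`. Thus the orbits on the curve are minimizing.
Comparison with slowly drifting orbits shows that every minimizing configuration of rotation number
1/3 has mean action `C + U (2π) / 3`. Summing over one orbit gives `triArea2 = 3/2 * β` for every
critical triangle, in particular for one of maximal area.

The inequality is then that of Sas for triangles. Parametrize the boundary so that the abscissa is
`m + ρ cos t`; the inscribed triangles with parameters `t`, `t + 2π/3`, `t + 4π/3` have mean doubled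
area `3√3 |Ω| / (2π)`, and the maximum is at least the mean. In case of equality all these triangles
are maximal, for every choice of the axis; by uniqueness the one through a vertex `a` of a fixed
maximal triangle is that triangle itself. Its projections in all directions then determine the
support function of the table, which is that of an ellipse.

For the second part, a trigonometric curve with few Fourier modes satisfies exactly the condition
that chords between parameters a third of a period apart are parallel to the tangent in between. It
has the symmetry of a square but is not a circle, so it is not an ellipse. -/

theorem unitDir_zero_apply (φ : ℝ) : unitDir φ 0 = Real.cos φ := rfl

theorem unitDir_one_apply (φ : ℝ) : unitDir φ 1 = Real.sin φ := rfl

theorem plane_ext {u v : Plane} (h0 : u 0 = v 0) (h1 : u 1 = v 1) : u = v := by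
  ext i; fin_cases i
  · exact h0
  · exact h1

theorem areaForm2_add_right (u v w : Plane) :
    areaForm2 u (v + w) = areaForm2 u v + areaForm2 u w := by
  simp only [areaForm2, PiLp.add_apply]; ring

theorem areaForm2_add_left (u v w : Plane) :
    areaForm2 (u + v) w = areaForm2 u w + areaForm2 v w := by
  simp only [areaForm2, PiLp.add_apply]; ring

theorem areaForm2_sub_right (u v w : Plane) :
    areaForm2 u (v - w) = areaForm2 u v - areaForm2 u w := by
  simp only [areaForm2, PiLp.sub_apply]; ring

theorem areaForm2_sub_left (u v w : Plane) :
    areaForm2 (u - v) w = areaForm2 u w - areaForm2 v w := by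
  simp only [areaForm2, PiLp.sub_apply]; ring

theorem areaForm2_smul_right (c : ℝ) (u v : Plane) :
    areaForm2 u (c • v) = c * areaForm2 u v := by
  simp only [areaForm2, PiLp.smul_apply, smul_eq_mul]; ring

theorem areaForm2_smul_left (c : ℝ) (u v : Plane) :
    areaForm2 (c • u) v = c * areaForm2 u v := by
  simp only [areaForm2, PiLp.smul_apply, smul_eq_mul]; ring

theorem areaForm2_neg_left (u v : Plane) : areaForm2 (-u) v = -areaForm2 u v := by
  simp only [areaForm2, PiLp.neg_apply]; ring

theorem areaForm2_self (u : Plane) : areaForm2 u u = 0 := by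
  simp only [areaForm2]; ring

theorem areaForm2_zero_left (u : Plane) : areaForm2 0 u = 0 := by
  simp [areaForm2]

theorem areaForm2_zero_right (u : Plane) : areaForm2 u 0 = 0 := by
  simp [areaForm2]

theorem areaForm2_swap (u v : Plane) : areaForm2 u v = -areaForm2 v u := by
  simp only [areaForm2]; ring

theorem continuous_areaForm2 : Continuous fun x : Plane × Plane => areaForm2 x.1 x.2 := by
  unfold areaForm2; fun_prop

theorem Continuous.areaForm2 {X : Type*} [TopologicalSpace X] {f g : X → Plane}
    (hf : Continuous f) (hg : Continuous g) : Continuous fun x => areaForm2 (f x) (g x) :=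
  continuous_areaForm2.comp (hf.prodMk hg)

theorem areaForm2_unitDir (φ ψ : ℝ) : areaForm2 (unitDir φ) (unitDir ψ) = Real.sin (ψ - φ) := by
  rw [Real.sin_sub]; simp only [areaForm2, unitDir_zero_apply, unitDir_one_apply]; ring

theorem unitDir_add_two_pi (φ : ℝ) : unitDir (φ + 2 * π) = unitDir φ :=
  plane_ext (Real.cos_add_two_pi φ) (Real.sin_add_two_pi φ)

theorem unitDir_sub_pi (φ : ℝ) : unitDir (φ - π) = -unitDir φ :=
  plane_ext (Real.cos_sub_pi φ) (Real.sin_sub_pi φ)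

theorem plane_norm_sq (v : Plane) : ‖v‖ ^ 2 = v 0 ^ 2 + v 1 ^ 2 := by
  rw [EuclideanSpace.norm_sq_eq]; simp

theorem norm_unitDir (φ : ℝ) : ‖unitDir φ‖ = 1 := by
  have h := plane_norm_sq (unitDir φ)
  rw [unitDir_zero_apply, unitDir_one_apply, Real.cos_sq_add_sin_sq] at h
  nlinarith [norm_nonneg (unitDir φ)]

theorem unitDir_ne_zero (φ : ℝ) : unitDir φ ≠ 0 := by
  intro h
  have := norm_unitDir φ
  rw [h, norm_zero] at this
  exact zero_ne_one this

/-- The angle in `[φ, φ + π]` whose cosine with the ray `φ` is that of `v`. -/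
noncomputable def angleFrom (φ : ℝ) (v : Plane) : ℝ :=
  φ + Real.arccos ((Real.cos φ * v 0 + Real.sin φ * v 1) / ‖v‖)

theorem angleFrom_spec {φ : ℝ} {v : Plane} (h : 0 < areaForm2 (unitDir φ) v) :
    v = ‖v‖ • unitDir (angleFrom φ v) ∧ φ < angleFrom φ v ∧ angleFrom φ v < φ + π := by
  have hv : v ≠ 0 := by
    rintro rfl; rw [areaForm2_zero_right] at h; exact lt_irrefl _ h
  have hn : 0 < ‖v‖ := norm_pos_iff.2 hv
  set s := (Real.cos φ * v 0 + Real.sin φ * v 1) / ‖v‖ with hs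
  set w := areaForm2 (unitDir φ) v / ‖v‖ with hw
  have hwpos : 0 < w := div_pos h hn
  have hw' : w = (Real.cos φ * v 1 - Real.sin φ * v 0) / ‖v‖ := by
    rw [hw]; simp only [areaForm2, unitDir_zero_apply, unitDir_one_apply]
  have hsw : s ^ 2 + w ^ 2 = 1 := by
    rw [hs, hw', div_pow, div_pow, ← add_div, div_eq_one_iff_eq (by positivity), plane_norm_sq]
    linear_combination (v 0 ^ 2 + v 1 ^ 2) * Real.sin_sq_add_cos_sq φ
  have hs1 : -1 < s := by nlinarith
  have hs2 : s < 1 := by nlinarith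
  have hsin : Real.sin (Real.arccos s) = w := by
    rw [Real.sin_arccos, show 1 - s ^ 2 = w ^ 2 by linarith, Real.sqrt_sq hwpos.le]
  have hcos : Real.cos (Real.arccos s) = s := Real.cos_arccos hs1.le hs2.le
  have hang : angleFrom φ v = φ + Real.arccos s := rfl
  have hsn : s * ‖v‖ = Real.cos φ * v 0 + Real.sin φ * v 1 := by
    rw [hs]; field_simp
  have hwn : w * ‖v‖ = Real.cos φ * v 1 - Real.sin φ * v 0 := by
    rw [hw']; field_simp
  refine ⟨plane_ext ?_ ?_, ?_, ?_⟩
  · rw [PiLp.smul_apply, unitDir_zero_apply, hang, Real.cos_add, hsin, hcos, smul_eq_mul]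
    linear_combination (-v 0) * Real.sin_sq_add_cos_sq φ - Real.cos φ * hsn + Real.sin φ * hwn
  · rw [PiLp.smul_apply, unitDir_one_apply, hang, Real.sin_add, hsin, hcos, smul_eq_mul]
    linear_combination (-v 1) * Real.sin_sq_add_cos_sq φ - Real.sin φ * hsn - Real.cos φ * hwn
  · rw [hang]; linarith [Real.arccos_pos.2 hs2]
  · rw [hang]
    have : Real.arccos s < π := by
      rcases (Real.arccos_le_pi s).lt_or_eq with h1 | h1
      · exact h1
      · rw [h1, Real.sin_pi] at hsin; linarith
    linarith

theorem continuous_angleFrom {X : Type*} [TopologicalSpace X] {f : X → ℝ} {g : X → Plane}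
    (hf : Continuous f) (hg : Continuous g) (hne : ∀ x, g x ≠ 0) :
    Continuous fun x => angleFrom (f x) (g x) := by
  unfold angleFrom
  have h0 : Continuous fun x => g x 0 := by fun_prop
  have h1 : Continuous fun x => g x 1 := by fun_prop
  refine hf.add (Real.continuous_arccos.comp ?_)
  exact (((Real.continuous_cos.comp hf).mul h0).add ((Real.continuous_sin.comp hf).mul h1)).div
    hg.norm (fun x => norm_ne_zero_iff.2 (hne x))

/-- Two angles with the same direction differ by a multiple of a full turn. -/
theorem eq_of_unitDir_eq {φ ψ : ℝ} (h : unitDir φ = unitDir ψ) (h1 : ψ - 2 * π < φ)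
    (h2 : φ < ψ + 2 * π) : φ = ψ := by
  have hc : Real.cos φ = Real.cos ψ := congrArg (fun v : Plane => v 0) h
  have hs : Real.sin φ = Real.sin ψ := congrArg (fun v : Plane => v 1) h
  have : Real.cos (φ - ψ) = 1 := by
    rw [Real.cos_sub, hc, hs]; nlinarith [Real.sin_sq_add_cos_sq ψ]
  have := (Real.cos_eq_one_iff_of_lt_of_lt (by linarith) (by linarith)).1 this
  linarith

theorem sin_sub_pos_of {φ ψ : ℝ} (h1 : φ < ψ) (h2 : ψ < φ + π) : 0 < Real.sin (ψ - φ) :=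
  Real.sin_pos_of_pos_of_lt_pi (by linarith) (by linarith)

/-! ### Supporting lines and tangency points -/

/-- The vector `v` turned clockwise by a right angle. -/
noncomputable def cwTurn (v : Plane) : Plane := !₂[v 1, -v 0]

theorem areaForm2_cwTurn (v : Plane) : areaForm2 v (cwTurn v) = -‖v‖ ^ 2 := by
  rw [plane_norm_sq]; simp [areaForm2, cwTurn]; ring

/-- A small move of `z` to the right of `e` stays in `Ω` and lowers the form by a positive multiple
of `‖e‖ ^ 2`. -/
theorem areaForm2_pos_of_mem_interior {Ω : Set Plane} {e q z : Plane} (he : e ≠ 0)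
    (h : ∀ z ∈ Ω, 0 ≤ areaForm2 e (z - q)) (hz : z ∈ interior Ω) : 0 < areaForm2 e (z - q) := by
  have hc : Continuous fun s : ℝ => z + s • cwTurn e := by fun_prop
  have : ∀ᶠ s : ℝ in 𝓝 0, z + s • cwTurn e ∈ Ω :=
    hc.continuousAt.eventually_mem (by simpa using mem_interior_iff_mem_nhds.1 hz)
  obtain ⟨δ, hδ, hs⟩ := Metric.eventually_nhds_iff.1 this
  have h1 := h _ (hs (y := δ / 2) (by rw [Real.dist_eq, sub_zero, abs_of_pos (by positivity)]; linarith))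
  rw [areaForm2_sub_right, areaForm2_add_right, areaForm2_smul_right, areaForm2_cwTurn] at h1
  rw [areaForm2_sub_right]
  have : 0 < ‖e‖ ^ 2 := by have := norm_pos_iff.2 he; positivity
  nlinarith

theorem support_unique {Ω : Set Plane} (hΩ : StrictConvex ℝ Ω) {e q q' : Plane} (he : e ≠ 0)
    (h : ∀ z ∈ Ω, 0 ≤ areaForm2 e (z - q)) (hq : q ∈ Ω) (hq' : q' ∈ Ω)
    (h0 : areaForm2 e (q' - q) = 0) : q' = q := by
  by_contra hne
  have hm : (1 / 2 : ℝ) • q' + (1 / 2 : ℝ) • q ∈ interior Ω :=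
    hΩ hq' hq hne (by norm_num) (by norm_num) (by norm_num)
  have := areaForm2_pos_of_mem_interior he h hm
  rw [areaForm2_sub_right, areaForm2_add_right, areaForm2_smul_right, areaForm2_smul_right] at this
  rw [areaForm2_sub_right] at h0
  linarith

theorem IsTangencyPoint.support {Ω : Set Plane} {p q : Plane} (h : IsTangencyPoint Ω p q) :
    ∀ z ∈ Ω, 0 ≤ areaForm2 (q - p) (z - q) := by
  intro z hz
  have := h.2 z hz
  rw [areaForm2_sub_right] at this ⊢
  have h2 : areaForm2 (q - p) q = areaForm2 (q - p) p := by
    rw [← sub_eq_zero, ← areaForm2_sub_right, areaForm2_self]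
  linarith

theorem isTangencyPoint_of_support {Ω : Set Plane} {p q : Plane} (hq : q ∈ Ω)
    (h : ∀ z ∈ Ω, 0 ≤ areaForm2 (q - p) (z - q)) : IsTangencyPoint Ω p q := by
  refine ⟨hq, fun z hz => ?_⟩
  have := h z hz
  rw [areaForm2_sub_right] at this ⊢
  have h2 : areaForm2 (q - p) q = areaForm2 (q - p) p := by
    rw [← sub_eq_zero, ← areaForm2_sub_right, areaForm2_self]
  linarith

theorem IsTangencyPoint.unique {Ω : Set Plane} (hΩ : StrictConvex ℝ Ω) {p q q' : Plane}
    (hp : p ∉ Ω) (h : IsTangencyPoint Ω p q) (h' : IsTangencyPoint Ω p q') : q' = q := by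
  have hne : q - p ≠ 0 := fun h0 => hp (sub_eq_zero.1 h0 ▸ h.1)
  have h1 := h.2 q' h'.1
  have h2 := h'.2 q h.1
  rw [areaForm2_swap] at h2
  refine support_unique hΩ hne h.support h.1 h'.1 ?_
  rw [← sub_sub_sub_cancel_right q' q p, areaForm2_sub_right, areaForm2_self]
  linarith

theorem exists_isTangencyPoint {Ω : Set Plane} (hc : IsCompact Ω) (hΩ : Convex ℝ Ω)
    (hne : Ω.Nonempty) {p : Plane} (hp : p ∉ Ω) : ∃ q, IsTangencyPoint Ω p q := by
  obtain ⟨f, s, hf1, hf2⟩ := geometric_hahn_banach_point_closed hΩ hc.isClosed hp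
  set a := f (EuclideanSpace.single 0 1) with ha
  set b := f (EuclideanSpace.single 1 1) with hb
  have hfv : ∀ v : Plane, f v = a * v 0 + b * v 1 := by
    intro v
    have : v = v 0 • EuclideanSpace.single 0 (1 : ℝ) + v 1 • EuclideanSpace.single 1 (1 : ℝ) := by
      apply plane_ext <;> simp
    conv_lhs => rw [this]
    rw [map_add, map_smul, map_smul, smul_eq_mul, smul_eq_mul, ← ha, ← hb]; ring
  have hpos : ∀ z ∈ Ω, 0 < f (z - p) := by
    intro z hz
    rw [map_sub]; have := hf2 z hz; linarith
  -- For a functional with gradient `(a, b)` that is positive on `Ω - p`, this quotient is the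
  -- tangent of the angle from `(a, b)` to `z - p`; its minimum is at the clockwise-most point of
  -- `Ω` seen from `p`.
  have hcont : ContinuousOn (fun z : Plane => (a * (z - p) 1 - b * (z - p) 0) / f (z - p)) Ω := by
    apply ContinuousOn.div
    · fun_prop
    · fun_prop
    · intro z hz; exact (hpos z hz).ne'
  obtain ⟨q, hq, hmin⟩ := hc.exists_isMinOn hne hcont
  refine ⟨q, hq, fun z hz => ?_⟩
  have h1 : (a * (q - p) 1 - b * (q - p) 0) / f (q - p) ≤
    (a * (z - p) 1 - b * (z - p) 0) / f (z - p) := hmin hz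
  have hq0 := hpos q hq
  have hz0 := hpos z hz
  rw [div_le_div_iff₀ hq0 hz0, hfv, hfv] at h1
  rw [hfv] at hq0
  have hab : 0 < a ^ 2 + b ^ 2 := by
    by_contra hcon
    have h3 : a = 0 := by nlinarith [sq_nonneg a, sq_nonneg b]
    have h4 : b = 0 := by nlinarith [sq_nonneg a, sq_nonneg b]
    rw [h3, h4] at hq0; linarith
  unfold areaForm2
  by_contra hcon
  push Not at hcon
  nlinarith [mul_pos hab (neg_pos.2 hcon)]

theorem outerBilliard_eq {Ω : Set Plane} (hΩ : StrictConvex ℝ Ω) {p q : Plane}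
    (hp : p ∉ Ω) (h : IsTangencyPoint Ω p q) : outerBilliard Ω p = (2 : ℝ) • q - p := by
  have hex : ∃ q, IsTangencyPoint Ω p q := ⟨q, h⟩
  unfold outerBilliard
  rw [dif_pos hex, IsTangencyPoint.unique hΩ hp h hex.choose_spec]

/-- The tangency point depends continuously on the point from which the tangent is drawn. -/
theorem continuous_tangency {Ω : Set Plane} (hc : IsCompact Ω) (hΩ : StrictConvex ℝ Ω)
    {X : Type*} [TopologicalSpace X] {p q : X → Plane} (hp : Continuous p) (hpΩ : ∀ x, p x ∉ Ω)
    (h : ∀ x, IsTangencyPoint Ω (p x) (q x)) : Continuous q := by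
  rw [continuous_iff_isClosed]
  intro C hC
  -- The graph of the tangency point is closed, and projection along the compact set `Ω` is a closed
  -- map.
  have : q ⁻¹' C = Prod.fst '' ({y : X × Ω | IsTangencyPoint Ω (p y.1) y.2 ∧ (y.2 : Plane) ∈ C}) := by
    ext x
    constructor
    · intro hx
      exact ⟨(x, ⟨q x, (h x).1⟩), ⟨h x, hx⟩, rfl⟩
    · rintro ⟨⟨y, z⟩, ⟨h1, h2⟩, rfl⟩
      change q y ∈ C
      rw [← IsTangencyPoint.unique hΩ (hpΩ y) (h y) h1]; exact h2
  rw [this]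
  have : CompactSpace Ω := isCompact_iff_compactSpace.1 hc
  apply isClosedMap_fst_of_compactSpace
  apply IsClosed.inter
  · have : {y : X × Ω | IsTangencyPoint Ω (p y.1) y.2} =
      ⋂ z ∈ Ω, {y : X × Ω | 0 ≤ areaForm2 ((y.2 : Plane) - p y.1) (z - p y.1)} := by
      ext y; simp [IsTangencyPoint]
    change IsClosed {y : X × Ω | IsTangencyPoint Ω (p y.1) y.2}
    rw [this]
    refine isClosed_biInter fun z _ => isClosed_le continuous_const ?_
    apply Continuous.areaForm2 <;> fun_prop
  · exact hC.preimage (by fun_prop)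

/-! ### Critical inscribed triangles -/

/-- Twice the signed area of a triangle. -/
def triArea2 (a b c : Plane) : ℝ := areaForm2 (b - a) (c - a)

theorem triArea2_swap (a b c : Plane) : triArea2 a c b = -triArea2 a b c := by
  simp only [triArea2, areaForm2, PiLp.sub_apply]; ring

/-- A triangle inscribed in `Ω` whose vertices have supporting lines parallel to the opposite
sides. -/
structure IsCriticalTriangle (Ω : Set Plane) (a b c : Plane) : Prop where
  mem₁ : a ∈ Ω
  mem₂ : b ∈ Ω
  mem₃ : c ∈ Ω
  support₁ : ∀ z ∈ Ω, 0 ≤ areaForm2 (b - c) (z - a)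
  support₂ : ∀ z ∈ Ω, 0 ≤ areaForm2 (c - a) (z - b)
  support₃ : ∀ z ∈ Ω, 0 ≤ areaForm2 (a - b) (z - c)

theorem IsCriticalTriangle.area_pos {Ω : Set Plane} (hΩ : StrictConvex ℝ Ω) {a b c : Plane}
    (h : IsCriticalTriangle Ω a b c) (hbc : b ≠ c) : 0 < triArea2 a b c := by
  have h1 := h.support₁ c h.mem₃
  have e1 : areaForm2 (b - c) (c - a) = triArea2 a b c := by
    simp only [triArea2, areaForm2, PiLp.sub_apply]; ring
  have e2 : areaForm2 (b - c) (b - a) = triArea2 a b c := by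
    simp only [triArea2, areaForm2, PiLp.sub_apply]; ring
  rw [e1] at h1
  rcases h1.lt_or_eq with h1 | h1
  · exact h1
  · exfalso
    have hc : c = a := support_unique hΩ (sub_ne_zero.2 hbc) h.support₁ h.mem₁ h.mem₃ (by rw [e1, h1])
    have hb : b = a := support_unique hΩ (sub_ne_zero.2 hbc) h.support₁ h.mem₁ h.mem₂ (by rw [e2, h1])
    exact hbc (hb.trans hc.symm)

/-- The supporting lines at the vertices bound the triangle of which `a`, `b`, `c` are the midpoints
of the sides. Measured against `b - c` and the height of `a b c`, a chord parallel to `b - c` at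
height `k` from `a` has width at most `2 - k` in it; equality needs both ends on the two slanted
sides. -/
theorem IsCriticalTriangle.width_add_height_le {Ω : Set Plane} {a b c b' c' : Plane} {l : ℝ}
    (h : IsCriticalTriangle Ω a b c) (hb' : b' ∈ Ω) (hc' : c' ∈ Ω)
    (hd : b' - c' = l • (b - c)) :
    l * triArea2 a b c + areaForm2 (b - c) (c' - a) ≤ 2 * triArea2 a b c ∧
      (l * triArea2 a b c + areaForm2 (b - c) (c' - a) = 2 * triArea2 a b c →
        areaForm2 (a - b) (c' - c) = 0) := by
  have h2 := h.support₂ b' hb'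
  have h3 := h.support₃ c' hc'
  have key : 2 * triArea2 a b c - (l * triArea2 a b c + areaForm2 (b - c) (c' - a)) =
      areaForm2 (c - a) (b' - b) + areaForm2 (a - b) (c' - c) := by
    have hb0 : b' = c' + l • (b - c) := by rw [← hd]; abel
    rw [hb0]
    simp only [triArea2, areaForm2, PiLp.sub_apply, PiLp.add_apply, PiLp.smul_apply, smul_eq_mul]
    ring
  exact ⟨by linarith, fun h0 => by linarith⟩

/-- A critical triangle is determined by a vertex and the direction of the opposite side. -/
theorem IsCriticalTriangle.eq_of_parallel {Ω : Set Plane} (hΩ : StrictConvex ℝ Ω)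
    {a b c b' c' : Plane} {l : ℝ} (h : IsCriticalTriangle Ω a b c)
    (h' : IsCriticalTriangle Ω a b' c') (hbc : b ≠ c) (hl : 0 < l)
    (hd : b' - c' = l • (b - c)) : b' = b ∧ c' = c := by
  have hpos := h.area_pos hΩ hbc
  have hne' : b' ≠ c' := by
    intro h0
    rw [h0, sub_self] at hd
    exact (smul_ne_zero hl.ne' (sub_ne_zero.2 hbc)) hd.symm
  have hpos' := h'.area_pos hΩ hne'
  -- With `l` and `k = Y / T` the ratios of base and height of the two triangles, the bound reads `l
  -- + k ≤ 2`, and with the roles exchanged `l + k ≤ 2 l k`. Together they leave only `l = k = 1`.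
  obtain ⟨h1, h1e⟩ := h.width_add_height_le h'.mem₂ h'.mem₃ hd
  obtain ⟨h2, -⟩ := h'.width_add_height_le (l := l⁻¹) h.mem₂ h.mem₃
    (by rw [hd, smul_smul, inv_mul_cancel₀ hl.ne', one_smul])
  have e1 : triArea2 a b' c' = l * areaForm2 (b - c) (c' - a) := by
    rw [← areaForm2_smul_left, ← hd]
    simp only [triArea2, areaForm2, PiLp.sub_apply]; ring
  have e2 : areaForm2 (b' - c') (c - a) = l * triArea2 a b c := by
    rw [hd, areaForm2_smul_left]
    simp only [triArea2, areaForm2, PiLp.sub_apply]; ring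
  rw [e1, e2, inv_mul_cancel_left₀ hl.ne'] at h2
  set T := triArea2 a b c with hT
  set Y := areaForm2 (b - c) (c' - a) with hY
  rw [e1] at hpos'
  have hYpos : 0 < Y := pos_of_mul_pos_right hpos' hl.le
  have q1 : Y + l * T = l * T + Y := add_comm _ _
  have hYl : Y = l * T := by
    have : (Y - l * T) ^ 2 ≤ 0 := by nlinarith [mul_pos hl hpos, mul_pos hl hYpos]
    nlinarith [sq_nonneg (Y - l * T)]
  have hl1 : l = 1 := by
    have h3 : l ≤ 1 := by nlinarith
    have h4 : 1 ≤ l := by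
      rw [hYl] at h2
      nlinarith [mul_pos hl hpos]
    linarith
  subst hl1
  rw [one_mul] at hYl h1 h1e
  have h5 := h1e (by linarith)
  have h6 : areaForm2 (b - c) (c' - c) = 0 := by
    have : areaForm2 (b - c) (c' - c) = Y - T := by
      rw [hY, hT]; simp only [triArea2, areaForm2, PiLp.sub_apply]; ring
    rw [this]; linarith
  -- `c' - c` has zero area form with the independent vectors `a - b` and `b - c`.
  have hcc : c' = c := by
    simp only [areaForm2, PiLp.sub_apply] at h5 h6
    simp only [hT, triArea2, areaForm2, PiLp.sub_apply] at hpos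
    apply plane_ext
    · have : ((b 0 - a 0) * (c 1 - a 1) - (b 1 - a 1) * (c 0 - a 0)) * (c' 0 - c 0) = 0 := by
        linear_combination (b 0 - c 0) * h5 - (a 0 - b 0) * h6
      rcases mul_eq_zero.1 this with h7 | h7
      · exact absurd h7 hpos.ne'
      · linarith
    · have : ((b 0 - a 0) * (c 1 - a 1) - (b 1 - a 1) * (c 0 - a 0)) * (c' 1 - c 1) = 0 := by
        linear_combination (b 1 - c 1) * h5 - (a 1 - b 1) * h6
      rcases mul_eq_zero.1 this with h7 | h7
      · exact absurd h7 hpos.ne'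
      · linarith
  refine ⟨?_, hcc⟩
  rw [one_smul, hcc] at hd
  exact sub_left_injective hd

/-! ### The generating function -/

theorem areaForm2_smul_unitDir_add (φ ψ α β : ℝ) :
    areaForm2 (unitDir φ) (α • unitDir φ + β • unitDir ψ) = β * Real.sin (ψ - φ) := by
  rw [areaForm2_add_right, areaForm2_smul_right, areaForm2_smul_right, areaForm2_self,
    areaForm2_unitDir]; ring

theorem areaForm2_smul_unitDir_add' (φ ψ α β : ℝ) :
    areaForm2 (α • unitDir φ + β • unitDir ψ) (unitDir ψ) = α * Real.sin (ψ - φ) := by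
  rw [areaForm2_add_left, areaForm2_smul_left, areaForm2_smul_left, areaForm2_self,
    areaForm2_unitDir]; ring

theorem decompose_unitDir {φ ψ : ℝ} (h : Real.sin (ψ - φ) ≠ 0) (z : Plane) :
    z = (areaForm2 z (unitDir ψ) / Real.sin (ψ - φ)) • unitDir φ +
      (areaForm2 (unitDir φ) z / Real.sin (ψ - φ)) • unitDir ψ := by
  have hs : Real.sin (ψ - φ) = Real.sin ψ * Real.cos φ - Real.cos ψ * Real.sin φ := Real.sin_sub _ _
  apply plane_ext
  · simp only [PiLp.add_apply, PiLp.smul_apply, smul_eq_mul, areaForm2, unitDir_zero_apply,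
      unitDir_one_apply]
    field_simp
    rw [hs]; ring
  · simp only [PiLp.add_apply, PiLp.smul_apply, smul_eq_mul, areaForm2, unitDir_zero_apply,
      unitDir_one_apply]
    field_simp
    rw [hs]; ring

/-- The line through `r₁ • unitDir φ` and `r₂ • unitDir ψ` has `Ω` on its left. -/
def IsBoundingLine (Ω : Set Plane) (φ ψ r₁ r₂ : ℝ) : Prop :=
  0 < r₁ ∧ 0 < r₂ ∧ ∀ z ∈ Ω, r₂ * areaForm2 z (unitDir ψ) + r₁ * areaForm2 (unitDir φ) z ≤
    r₁ * r₂ * Real.sin (ψ - φ)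

theorem areaForm2_chord (φ ψ r₁ r₂ : ℝ) (z : Plane) :
    areaForm2 (r₂ • unitDir ψ - r₁ • unitDir φ) (z - r₁ • unitDir φ) =
      r₁ * r₂ * Real.sin (ψ - φ) - (r₂ * areaForm2 z (unitDir ψ) + r₁ * areaForm2 (unitDir φ) z) := by
  rw [areaForm2_sub_left, areaForm2_sub_right, areaForm2_sub_right, areaForm2_smul_left,
    areaForm2_smul_left, areaForm2_smul_left, areaForm2_smul_left, areaForm2_smul_right,
    areaForm2_smul_right, areaForm2_self, areaForm2_swap (unitDir ψ) z,
    areaForm2_swap (unitDir ψ) (unitDir φ), areaForm2_unitDir]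
  ring

theorem isMidTangentSegment_iff {Ω : Set Plane} {φ ψ : ℝ} {r : ℝ × ℝ} :
    IsMidTangentSegment Ω φ ψ r ↔ IsBoundingLine Ω φ ψ r.1 r.2 ∧
      (r.1 / 2) • unitDir φ + (r.2 / 2) • unitDir ψ ∈ Ω := by
  have hm : midpoint ℝ (r.1 • unitDir φ) (r.2 • unitDir ψ) =
      (r.1 / 2) • unitDir φ + (r.2 / 2) • unitDir ψ := by
    rw [midpoint_eq_smul_add, smul_add, smul_smul, smul_smul]
    congr 2 <;> simp <;> ring
  have hd : (r.1 / 2) • unitDir φ + (r.2 / 2) • unitDir ψ - r.1 • unitDir φ =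
      (1 / 2 : ℝ) • (r.2 • unitDir ψ - r.1 • unitDir φ) := by module
  unfold IsMidTangentSegment IsTangencyPoint IsBoundingLine
  rw [hm, hd]
  simp only [areaForm2_smul_left, areaForm2_chord]
  constructor
  · rintro ⟨h1, h2, h3, h4⟩
    exact ⟨⟨h1, h2, fun z hz => by linarith [h4 z hz]⟩, h3⟩
  · rintro ⟨⟨h1, h2, h4⟩, h3⟩
    exact ⟨h1, h2, h3, fun z hz => by linarith [h4 z hz]⟩

theorem IsMidTangentSegment.bounding {Ω : Set Plane} {φ ψ : ℝ} {r : ℝ × ℝ}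
    (h : IsMidTangentSegment Ω φ ψ r) : IsBoundingLine Ω φ ψ r.1 r.2 :=
  (isMidTangentSegment_iff.1 h).1

theorem IsMidTangentSegment.mid_mem {Ω : Set Plane} {φ ψ : ℝ} {r : ℝ × ℝ}
    (h : IsMidTangentSegment Ω φ ψ r) : (r.1 / 2) • unitDir φ + (r.2 / 2) • unitDir ψ ∈ Ω :=
  (isMidTangentSegment_iff.1 h).2

/-- The coordinates of a point of `Ω` in the basis of the two rays satisfy the inequality of the
bounding line. -/
theorem IsBoundingLine.coord_le {Ω : Set Plane} {φ ψ r₁ r₂ : ℝ} (h : IsBoundingLine Ω φ ψ r₁ r₂)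
    (hs : 0 < Real.sin (ψ - φ)) {α β : ℝ} (hz : α • unitDir φ + β • unitDir ψ ∈ Ω) :
    r₂ * α + r₁ * β ≤ r₁ * r₂ := by
  have := h.2.2 _ hz
  rw [areaForm2_smul_unitDir_add, areaForm2_smul_unitDir_add'] at this
  have h2 : (r₂ * α + r₁ * β) * Real.sin (ψ - φ) ≤ (r₁ * r₂) * Real.sin (ψ - φ) := by linarith
  exact le_of_mul_le_mul_right h2 hs

/-- The inequality of arithmetic and geometric means for `r₂ α` and `r₁ β`. It says that the
triangle cut off by a bounding line is at least as large as the one whose hypothetical midpoint is a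
point of `Ω`; both extremal characterizations of `outerGen` rest on it. -/
theorem IsBoundingLine.four_mul_le {Ω : Set Plane} {φ ψ r₁ r₂ : ℝ} (h : IsBoundingLine Ω φ ψ r₁ r₂)
    (hs : 0 < Real.sin (ψ - φ)) {α β : ℝ} (hα : 0 < α) (hβ : 0 < β)
    (hz : α • unitDir φ + β • unitDir ψ ∈ Ω) : 4 * (α * β) ≤ r₁ * r₂ := by
  have h1 := h.coord_le hs hz
  have h2 := h.1
  have h3 := h.2.1
  have h4 := mul_pos h2 h3
  have h5 : (r₂ * α + r₁ * β) ^ 2 ≤ (r₁ * r₂) ^ 2 := by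
    have : 0 < r₂ * α + r₁ * β := by positivity
    nlinarith
  have h6 : r₁ * r₂ * (4 * (α * β)) ≤ (r₁ * r₂) * (r₁ * r₂) := by
    nlinarith [sq_nonneg (r₂ * α - r₁ * β)]
  exact le_of_mul_le_mul_left h6 h4

/-- Each midpoint satisfies the inequality of the other line. Multiplying the two gives `(d a + c
b)² ≤ 4 (d a) (c b)`, so the two products are equal and the inequalities then order `a` and `c` both
ways. -/
theorem IsMidTangentSegment.unique {Ω : Set Plane} {φ ψ : ℝ} (hs : 0 < Real.sin (ψ - φ))
    {r r' : ℝ × ℝ} (h : IsMidTangentSegment Ω φ ψ r) (h' : IsMidTangentSegment Ω φ ψ r') :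
    r' = r := by
  obtain ⟨a, b⟩ := r
  obtain ⟨c, d⟩ := r'
  have ha : 0 < a := h.1
  have hb : 0 < b := h.2.1
  have hc : 0 < c := h'.1
  have hd : 0 < d := h'.2.1
  have h1 : d * (a / 2) + c * (b / 2) ≤ c * d := h'.bounding.coord_le hs h.mid_mem
  have h2 : b * (c / 2) + a * (d / 2) ≤ a * b := h.bounding.coord_le hs h'.mid_mem
  have h3 : (d * a - c * b) ^ 2 ≤ 0 := by
    nlinarith [mul_le_mul h1 h2 (by positivity) (by positivity)]
  have h4 : d * a = c * b := by nlinarith [sq_nonneg (d * a - c * b)]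
  have h5 : a ≤ c := by nlinarith
  have h6 : c ≤ a := by nlinarith
  have h7 : c = a := le_antisymm h6 h5
  subst h7
  have : d = b := by nlinarith
  rw [this]

theorem outerGen_eq {Ω : Set Plane} {φ ψ : ℝ} (hs : 0 < Real.sin (ψ - φ))
    {r : ℝ × ℝ} (h : IsMidTangentSegment Ω φ ψ r) :
    outerGen Ω φ ψ = r.1 * r.2 * Real.sin (ψ - φ) / 2 := by
  have hex : ∃ r : ℝ × ℝ, IsMidTangentSegment Ω φ ψ r := ⟨r, h⟩
  unfold outerGen
  rw [dif_pos hex, IsMidTangentSegment.unique hs h hex.choose_spec]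

theorem smul_mem_of_zero_mem_interior {Ω : Set Plane} (h0 : (0 : Plane) ∈ interior Ω) (v : Plane) :
    ∃ δ : ℝ, 0 < δ ∧ δ • v ∈ Ω := by
  have hc : Continuous fun s : ℝ => s • v := by fun_prop
  have : ∀ᶠ s : ℝ in 𝓝 0, s • v ∈ Ω :=
    hc.continuousAt.eventually_mem (by simpa using mem_interior_iff_mem_nhds.1 h0)
  obtain ⟨δ, hδ, hs⟩ := Metric.eventually_nhds_iff.1 this
  exact ⟨δ / 2, by positivity,
    hs (by rw [Real.dist_eq, sub_zero, abs_of_pos (by positivity)]; linarith)⟩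

/-- The midpoint is found as the point of `Ω` in the closed cone of the two rays that maximizes the
product of the coordinates along them; `A` and `B` are these coordinates multiplied by `sin (ψ -
φ)`. -/
theorem exists_isMidTangentSegment {Ω : Set Plane} (hc : IsCompact Ω) (hΩ : Convex ℝ Ω)
    (h0 : (0 : Plane) ∈ interior Ω) {φ ψ : ℝ} (hs : 0 < Real.sin (ψ - φ)) :
    ∃ r : ℝ × ℝ, IsMidTangentSegment Ω φ ψ r := by
  set A : Plane → ℝ := fun z => areaForm2 z (unitDir ψ) with hA
  set B : Plane → ℝ := fun z => areaForm2 (unitDir φ) z with hB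
  have hAc : Continuous A := continuous_id.areaForm2 continuous_const
  have hBc : Continuous B := continuous_const.areaForm2 continuous_id
  obtain ⟨δ, hδ, hz0⟩ := smul_mem_of_zero_mem_interior h0 ((1 : ℝ) • unitDir φ + (1 : ℝ) • unitDir ψ)
  set z0 := δ • ((1 : ℝ) • unitDir φ + (1 : ℝ) • unitDir ψ) with hz0def
  have hA0 : A z0 = δ * Real.sin (ψ - φ) := by
    rw [hA]; simp only [hz0def]; rw [areaForm2_smul_left, areaForm2_smul_unitDir_add', one_mul]
  have hB0 : B z0 = δ * Real.sin (ψ - φ) := by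
    rw [hB]; simp only [hz0def]; rw [areaForm2_smul_right, areaForm2_smul_unitDir_add, one_mul]
  have hp0 : 0 < δ * Real.sin (ψ - φ) := mul_pos hδ hs
  have hK : IsCompact (Ω ∩ {z | 0 ≤ A z ∧ 0 ≤ B z}) :=
    hc.inter_right ((isClosed_le continuous_const hAc).inter (isClosed_le continuous_const hBc))
  obtain ⟨q, ⟨hq, hqA, hqB⟩, hmax⟩ := hK.exists_isMaxOn
    ⟨z0, hz0, by rw [hA0]; exact hp0.le, by rw [hB0]; exact hp0.le⟩ (hAc.mul hBc).continuousOn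
  have hprod : 0 < A q * B q := by
    have : A z0 * B z0 ≤ A q * B q := hmax ⟨hz0, by rw [hA0]; exact hp0.le, by rw [hB0]; exact hp0.le⟩
    rw [hA0, hB0] at this
    exact lt_of_lt_of_le (mul_pos hp0 hp0) this
  have hqA' : 0 < A q := lt_of_le_of_ne hqA fun h => by rw [← h, zero_mul] at hprod; exact hprod.false
  have hqB' : 0 < B q := lt_of_le_of_ne hqB fun h => by rw [← h, mul_zero] at hprod; exact hprod.false
  -- The first-order condition at the maximum: otherwise a small step from `q` towards `z` would
  -- increase `A * B`.
  have key : ∀ z ∈ Ω, B q * A z + A q * B z ≤ 2 * (A q * B q) := by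
    intro z hz
    by_contra hcon
    push Not at hcon
    set d := B q * (A z - A q) + A q * (B z - B q) with hd
    have hdpos : 0 < d := by rw [hd]; linarith
    set m := (A z - A q) * (B z - B q) with hm
    have hlin : ∀ s : ℝ, A (q + s • (z - q)) = A q + s * (A z - A q) ∧
        B (q + s • (z - q)) = B q + s * (B z - B q) := by
      intro s
      simp only [hA, hB]
      rw [areaForm2_add_left, areaForm2_smul_left, areaForm2_sub_left, areaForm2_add_right,
        areaForm2_smul_right, areaForm2_sub_right]
      exact ⟨rfl, rfl⟩
    have e1 : ∀ᶠ s : ℝ in 𝓝[>] 0, 0 < A q + s * (A z - A q) := by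
      apply (ContinuousAt.eventually_lt (by fun_prop) (by fun_prop) (by simpa)).filter_mono
        nhdsWithin_le_nhds
    have e2 : ∀ᶠ s : ℝ in 𝓝[>] 0, 0 < B q + s * (B z - B q) := by
      apply (ContinuousAt.eventually_lt (by fun_prop) (by fun_prop) (by simpa)).filter_mono
        nhdsWithin_le_nhds
    have e3 : ∀ᶠ s : ℝ in 𝓝[>] 0, 0 < d + s * m := by
      apply (ContinuousAt.eventually_lt (by fun_prop) (by fun_prop) (by simpa)).filter_mono
        nhdsWithin_le_nhds
    have e4 : ∀ᶠ s : ℝ in 𝓝[>] 0, s < 1 :=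
      (Iio_mem_nhds one_pos : Set.Iio (1 : ℝ) ∈ 𝓝 0) |> mem_nhdsWithin_of_mem_nhds
    obtain ⟨s, h1, h2, h3, h4, h5⟩ := (e1.and (e2.and (e3.and (e4.and self_mem_nhdsWithin)))).exists
    have hmem : q + s • (z - q) ∈ Ω := hΩ.add_smul_sub_mem hq hz ⟨le_of_lt h5, h4.le⟩
    have := hmax ⟨hmem, by rw [(hlin s).1]; exact h1.le, by rw [(hlin s).2]; exact h2.le⟩
    have h6 : A (q + s • (z - q)) * B (q + s • (z - q)) ≤ A q * B q := this
    rw [(hlin s).1, (hlin s).2] at h6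
    have h7 : 0 < s * (d + s * m) := mul_pos h5 h3
    rw [hd, hm] at h7
    nlinarith
  -- The ends have twice the coordinates of `q`, which makes `q` the midpoint.
  refine ⟨(2 * (A q / Real.sin (ψ - φ)), 2 * (B q / Real.sin (ψ - φ))),
    isMidTangentSegment_iff.2 ⟨⟨by positivity, by positivity, fun z hz => ?_⟩, ?_⟩⟩
  · have := key z hz
    change 2 * (B q / Real.sin (ψ - φ)) * A z + 2 * (A q / Real.sin (ψ - φ)) * B z ≤ _
    have h2 : 2 * (B q / Real.sin (ψ - φ)) * A z + 2 * (A q / Real.sin (ψ - φ)) * B z =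
      2 / Real.sin (ψ - φ) * (B q * A z + A q * B z) := by ring
    have h3 : 2 * (A q / Real.sin (ψ - φ)) * (2 * (B q / Real.sin (ψ - φ))) * Real.sin (ψ - φ) =
      2 / Real.sin (ψ - φ) * (2 * (A q * B q)) := by field_simp
    rw [h2, h3]
    exact mul_le_mul_of_nonneg_left this (by positivity)
  · have := decompose_unitDir hs.ne' q
    have h2 : 2 * (A q / Real.sin (ψ - φ)) / 2 = A q / Real.sin (ψ - φ) := by ring
    have h3 : 2 * (B q / Real.sin (ψ - φ)) / 2 = B q / Real.sin (ψ - φ) := by ring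
    simp only [h2, h3]
    rw [← this]; exact hq

/-- `outerGen` is the least area cut off by a bounding line, and by `le_outerGen` also the greatest
value of `2 α β sin (ψ - φ)` over points of `Ω` with positive coordinates. The first gives upper
bounds and the second lower bounds without following how the tangent segment moves. -/
theorem outerGen_le {Ω : Set Plane} {φ ψ : ℝ} (hs : 0 < Real.sin (ψ - φ))
    (hex : ∃ r : ℝ × ℝ, IsMidTangentSegment Ω φ ψ r) {s₁ s₂ : ℝ} (h : IsBoundingLine Ω φ ψ s₁ s₂) :
    outerGen Ω φ ψ ≤ s₁ * s₂ * Real.sin (ψ - φ) / 2 := by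
  obtain ⟨r, hr⟩ := hex
  rw [outerGen_eq hs hr]
  have h1 := h.four_mul_le hs (half_pos hr.1) (half_pos hr.2.1) hr.mid_mem
  have h2 : r.1 * r.2 ≤ s₁ * s₂ := by linarith
  have := mul_le_mul_of_nonneg_right h2 hs.le
  linarith

theorem le_outerGen {Ω : Set Plane} {φ ψ : ℝ} (hs : 0 < Real.sin (ψ - φ))
    (hex : ∃ r : ℝ × ℝ, IsMidTangentSegment Ω φ ψ r) {α β : ℝ} (hα : 0 < α) (hβ : 0 < β)
    (hz : α • unitDir φ + β • unitDir ψ ∈ Ω) :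
    2 * (α * β) * Real.sin (ψ - φ) ≤ outerGen Ω φ ψ := by
  obtain ⟨r, hr⟩ := hex
  rw [outerGen_eq hs hr]
  have := mul_le_mul_of_nonneg_right (hr.bounding.four_mul_le hs hα hβ hz) hs.le
  linarith

/-- Sweeping one end: the bounding line seen from other rays. -/
theorem IsBoundingLine.change {Ω : Set Plane} {φ ψ r₁ r₂ : ℝ} (h : IsBoundingLine Ω φ ψ r₁ r₂)
    (hs : 0 < Real.sin (ψ - φ)) {φ' ψ' : ℝ}
    (h1 : 0 < r₁ * Real.sin (φ' - φ) + r₂ * Real.sin (ψ - φ'))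
    (h2 : 0 < r₁ * Real.sin (ψ' - φ) + r₂ * Real.sin (ψ - ψ')) (hs' : 0 < Real.sin (ψ' - φ')) :
    IsBoundingLine Ω φ' ψ'
      (r₁ * r₂ * Real.sin (ψ - φ) / (r₁ * Real.sin (φ' - φ) + r₂ * Real.sin (ψ - φ')))
      (r₁ * r₂ * Real.sin (ψ - φ) / (r₁ * Real.sin (ψ' - φ) + r₂ * Real.sin (ψ - ψ'))) := by
  obtain ⟨p1, p2, p3⟩ := h
  have hp : 0 < r₁ * r₂ * Real.sin (ψ - φ) := by positivity
  refine ⟨div_pos hp h1, div_pos hp h2, fun z hz => ?_⟩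
  have h3 := p3 z hz
  set D1 := r₁ * Real.sin (φ' - φ) + r₂ * Real.sin (ψ - φ') with hD1
  set D2 := r₁ * Real.sin (ψ' - φ) + r₂ * Real.sin (ψ - ψ') with hD2
  set M := r₁ * r₂ * Real.sin (ψ - φ) with hM
  have key : D1 * areaForm2 z (unitDir ψ') + D2 * areaForm2 (unitDir φ') z =
      Real.sin (ψ' - φ') * (r₂ * areaForm2 z (unitDir ψ) + r₁ * areaForm2 (unitDir φ) z) := by
    rw [hD1, hD2]
    -- The two sides are the same linear form in `z`, written in the frames of the two pairs of
    -- rays.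
    simp only [areaForm2, unitDir_zero_apply, unitDir_one_apply, Real.sin_sub]
    have c1 := Real.sin_sq_add_cos_sq φ'
    ring
  have h4 : M / D2 * areaForm2 z (unitDir ψ') + M / D1 * areaForm2 (unitDir φ') z =
      M / (D1 * D2) * (Real.sin (ψ' - φ') *
        (r₂ * areaForm2 z (unitDir ψ) + r₁ * areaForm2 (unitDir φ) z)) := by
    rw [← key]; field_simp
  have h5 : M / D1 * (M / D2) * Real.sin (ψ' - φ') = M / (D1 * D2) * (Real.sin (ψ' - φ') * M) := by
    field_simp
  rw [h4, h5]
  exact mul_le_mul_of_nonneg_left (mul_le_mul_of_nonneg_left h3 hs'.le) (by positivity)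

/-- The upper bound for the generating function given by the line of a mid-tangent segment. -/
theorem outerGen_le_of_line {Ω : Set Plane} {φ ψ : ℝ} (hs : 0 < Real.sin (ψ - φ))
    {r : ℝ × ℝ} (h : IsMidTangentSegment Ω φ ψ r) {φ' ψ' : ℝ}
    (hex : ∃ r : ℝ × ℝ, IsMidTangentSegment Ω φ' ψ' r)
    (h1 : 0 < r.1 * Real.sin (φ' - φ) + r.2 * Real.sin (ψ - φ'))
    (h2 : 0 < r.1 * Real.sin (ψ' - φ) + r.2 * Real.sin (ψ - ψ')) (hs' : 0 < Real.sin (ψ' - φ')) :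
    outerGen Ω φ' ψ' ≤
      (r.1 * r.2 * Real.sin (ψ - φ) / (r.1 * Real.sin (φ' - φ) + r.2 * Real.sin (ψ - φ'))) *
      (r.1 * r.2 * Real.sin (ψ - φ) / (r.1 * Real.sin (ψ' - φ) + r.2 * Real.sin (ψ - ψ'))) *
      Real.sin (ψ' - φ') / 2 :=
  outerGen_le hs' hex (h.bounding.change hs h1 h2 hs')

theorem hasDerivAt_of_squeeze {f l u : ℝ → ℝ} {x d : ℝ} (hl : HasDerivAt l d x)
    (hu : HasDerivAt u d x) (h1 : ∀ᶠ y in 𝓝 x, l y ≤ f y) (h2 : ∀ᶠ y in 𝓝 x, f y ≤ u y)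
    (hlx : l x = f x) (hux : u x = f x) : HasDerivAt f d x := by
  rw [hasDerivAt_iff_isLittleO] at *
  rw [Asymptotics.isLittleO_iff] at *
  intro c hc
  filter_upwards [hl hc, hu hc, h1, h2] with y a1 a2 a3 a4
  rw [Real.norm_eq_abs] at *
  rw [hlx] at a1
  rw [hux] at a2
  rw [abs_le] at *
  constructor <;> linarith [a1.1, a1.2, a2.1, a2.2]

/-- Near `ψ` the function lies between two explicit ones that agree with it at `ψ`: keeping the
midpoint fixed as a point of `Ω` gives a lower bound, keeping the tangent line fixed an upper bound.
Both have derivative `r.2 ^ 2 / 2`, so no smoothness of the tangent segment is needed. -/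
theorem hasDerivAt_outerGen_right {Ω : Set Plane} {φ ψ : ℝ} (h1 : φ < ψ) (h2 : ψ < φ + π)
    {r : ℝ × ℝ} (h : IsMidTangentSegment Ω φ ψ r)
    (hex : ∀ ψ', φ < ψ' → ψ' < φ + π → ∃ r : ℝ × ℝ, IsMidTangentSegment Ω φ ψ' r) :
    HasDerivAt (fun ψ' => outerGen Ω φ ψ') (r.2 ^ 2 / 2) ψ := by
  have hs := sin_sub_pos_of h1 h2
  have ha : 0 < r.1 := h.1
  have hb : 0 < r.2 := h.2.1
  have hnear : ∀ᶠ y in 𝓝 ψ, φ < y ∧ y < φ + π := (isOpen_Ioo.mem_nhds ⟨h1, h2⟩ : Ioo φ (φ + π) ∈ 𝓝 ψ)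
  have dsin : ∀ c : ℝ, HasDerivAt (fun y => Real.sin (y - c)) (Real.cos (ψ - c)) ψ := fun c => by
    simpa using ((hasDerivAt_id ψ).sub_const c).sin
  have dsin' : HasDerivAt (fun y => Real.sin (ψ - y)) (-1) ψ := by
    simpa using ((hasDerivAt_id ψ).const_sub ψ).sin
  set s := Real.sin (ψ - φ) with hsdef
  refine hasDerivAt_of_squeeze
    (l := fun y => 2 * ((r.1 * Real.sin (y - φ) / 2 + r.2 * Real.sin (y - ψ) / 2) * (r.2 * s / 2)) /
      Real.sin (y - φ))
    (u := fun y => r.1 * (r.1 * r.2 * s / (r.1 * Real.sin (y - φ) + r.2 * Real.sin (ψ - y))) *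
      Real.sin (y - φ) / 2) ?_ ?_ ?_ ?_ ?_ ?_
  · have d1 := (((((dsin φ).const_mul r.1).div_const 2).add
      (((dsin ψ).const_mul r.2).div_const 2)).mul_const (r.2 * s / 2)).const_mul 2
    have d2 := d1.div (dsin φ) hs.ne'
    refine d2.congr_deriv ?_
    simp only [sub_self, Real.sin_zero, Real.cos_zero, Pi.add_apply]
    rw [← hsdef]
    field_simp
    ring
  · have d1 := (((dsin φ).const_mul r.1).add (dsin'.const_mul r.2))
    have d2 := ((((hasDerivAt_const ψ (r.1 * r.2 * s)).div d1 (by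
      simp only [sub_self, Real.sin_zero, Pi.add_apply]; rw [← hsdef]; positivity)).const_mul r.1).mul
        (dsin φ)).div_const 2
    refine d2.congr_deriv ?_
    simp only [sub_self, Real.sin_zero, Pi.add_apply, Pi.div_apply]
    rw [← hsdef]
    field_simp
    ring
  · have hpos : ∀ᶠ y in 𝓝 ψ, 0 < r.1 * Real.sin (y - φ) / 2 + r.2 * Real.sin (y - ψ) / 2 := by
      apply ContinuousAt.eventually_lt (by fun_prop) (by fun_prop)
      simp only [sub_self, Real.sin_zero]; rw [← hsdef]; positivity
    filter_upwards [hnear, hpos] with y hy hpy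
    have hsy := sin_sub_pos_of hy.1 hy.2
    have hmem := h.mid_mem
    rw [decompose_unitDir hsy.ne' ((r.1 / 2) • unitDir φ + (r.2 / 2) • unitDir ψ),
      areaForm2_smul_unitDir_add] at hmem
    have e1 : areaForm2 ((r.1 / 2) • unitDir φ + (r.2 / 2) • unitDir ψ) (unitDir y) =
        r.1 * Real.sin (y - φ) / 2 + r.2 * Real.sin (y - ψ) / 2 := by
      rw [areaForm2_add_left, areaForm2_smul_left, areaForm2_smul_left, areaForm2_unitDir,
        areaForm2_unitDir]; ring
    rw [e1] at hmem
    refine le_trans (le_of_eq ?_) (le_outerGen hsy (hex y hy.1 hy.2) (by positivity) ?_ hmem)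
    · field_simp; rw [← hsdef]
    · rw [← hsdef]; positivity
  · have hpos : ∀ᶠ y in 𝓝 ψ, 0 < r.1 * Real.sin (y - φ) + r.2 * Real.sin (ψ - y) := by
      apply ContinuousAt.eventually_lt (by fun_prop) (by fun_prop)
      simp only [sub_self, Real.sin_zero]; rw [← hsdef]; positivity
    filter_upwards [hnear, hpos] with y hy hpy
    have hsy := sin_sub_pos_of hy.1 hy.2
    refine le_trans (outerGen_le_of_line hs h (hex y hy.1 hy.2) ?_ hpy hsy) (le_of_eq ?_)
    · simp only [sub_self, Real.sin_zero]; rw [← hsdef]; positivity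
    · simp only [sub_self, Real.sin_zero]; rw [← hsdef]; field_simp; ring
  · simp only [sub_self, Real.sin_zero]
    rw [outerGen_eq hs h, ← hsdef]; field_simp; ring
  · simp only [sub_self, Real.sin_zero]
    rw [outerGen_eq hs h, ← hsdef]; field_simp; ring

/-- An upper bound of the generating function, as a function of the first angle. -/
theorem exists_upper_touching_left {Ω : Set Plane} {φ ψ : ℝ} (h1 : φ < ψ) (h2 : ψ < φ + π)
    {r : ℝ × ℝ} (h : IsMidTangentSegment Ω φ ψ r)
    (hex : ∀ φ', φ' < ψ → ψ < φ' + π → ∃ r : ℝ × ℝ, IsMidTangentSegment Ω φ' ψ r) :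
    ∃ u : ℝ → ℝ, HasDerivAt u (-(r.1 ^ 2 / 2)) φ ∧ u φ = outerGen Ω φ ψ ∧
      ∀ᶠ y in 𝓝 φ, outerGen Ω y ψ ≤ u y := by
  have hs := sin_sub_pos_of h1 h2
  have ha : 0 < r.1 := h.1
  have hb : 0 < r.2 := h.2.1
  have hnear : ∀ᶠ y in 𝓝 φ, ψ - π < y ∧ y < ψ :=
    (isOpen_Ioo.mem_nhds ⟨by linarith, h1⟩ : Ioo (ψ - π) ψ ∈ 𝓝 φ)
  have dsin : HasDerivAt (fun y => Real.sin (y - φ)) 1 φ := by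
    simpa using ((hasDerivAt_id φ).sub_const φ).sin
  have dsin' : HasDerivAt (fun y => Real.sin (ψ - y)) (-Real.cos (ψ - φ)) φ := by
    simpa using ((hasDerivAt_id φ).const_sub ψ).sin
  set s := Real.sin (ψ - φ) with hsdef
  refine ⟨fun y => (r.1 * r.2 * s / (r.1 * Real.sin (y - φ) + r.2 * Real.sin (ψ - y))) * r.2 *
      Real.sin (ψ - y) / 2, ?_, ?_, ?_⟩
  · have d1 := ((dsin.const_mul r.1).add (dsin'.const_mul r.2))
    have d2 := ((((hasDerivAt_const φ (r.1 * r.2 * s)).div d1 (by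
      simp only [sub_self, Real.sin_zero, Pi.add_apply]; rw [← hsdef]; positivity)).mul_const r.2).mul
        dsin').div_const 2
    refine d2.congr_deriv ?_
    simp only [sub_self, Real.sin_zero, Pi.add_apply, Pi.div_apply]
    rw [← hsdef]
    field_simp
    ring
  · simp only [sub_self, Real.sin_zero]
    rw [outerGen_eq hs h, ← hsdef]; field_simp; ring
  · have hpos : ∀ᶠ y in 𝓝 φ, 0 < r.1 * Real.sin (y - φ) + r.2 * Real.sin (ψ - y) := by
      apply ContinuousAt.eventually_lt (by fun_prop) (by fun_prop)
      simp only [sub_self, Real.sin_zero]; rw [← hsdef]; positivity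
    filter_upwards [hnear, hpos] with y hy hpy
    have hsy := sin_sub_pos_of hy.2 (by linarith : ψ < y + π)
    refine le_trans (outerGen_le_of_line hs h (hex y hy.2 (by linarith)) hpy ?_ hsy) (le_of_eq ?_)
    · simp only [sub_self, Real.sin_zero]; rw [← hsdef]; positivity
    · simp only [sub_self, Real.sin_zero]; rw [← hsdef]; field_simp; ring

/-- Twist: moving the first ray forward decreases the second radius. -/
theorem IsMidTangentSegment.second_le {Ω : Set Plane} {φ φ' ψ : ℝ} (h1 : φ ≤ φ') (h2 : φ' < ψ)
    (h3 : ψ < φ + π) {r r' : ℝ × ℝ} (h : IsMidTangentSegment Ω φ ψ r)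
    (h' : IsMidTangentSegment Ω φ' ψ r') : r'.2 ≤ r.2 := by
  rcases h1.eq_or_lt with rfl | h1
  · rw [IsMidTangentSegment.unique (sin_sub_pos_of h2 h3) h h']
  have s1 : 0 < Real.sin (ψ - φ) := sin_sub_pos_of (by linarith) h3
  have s2 : 0 < Real.sin (ψ - φ') := sin_sub_pos_of h2 (by linarith)
  have s3 : 0 < Real.sin (φ' - φ) := sin_sub_pos_of h1 (by linarith)
  have ha : 0 < r.1 := h.1
  have hb : 0 < r.2 := h.2.1
  have ha' : 0 < r'.1 := h'.1
  have hb' : 0 < r'.2 := h'.2.1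
  -- Each midpoint lies on the inner side of the other line; the rest is algebra from these two
  -- inequalities.
  have i1 := h.bounding.2.2 _ h'.mid_mem
  have i2 := h'.bounding.2.2 _ h.mid_mem
  rw [areaForm2_add_left, areaForm2_add_right, areaForm2_smul_left, areaForm2_smul_left,
    areaForm2_smul_right, areaForm2_smul_right, areaForm2_unitDir, areaForm2_unitDir,
    areaForm2_unitDir, areaForm2_unitDir, sub_self, Real.sin_zero] at i1 i2
  rw [show φ - φ' = -(φ' - φ) by ring, Real.sin_neg] at i2
  generalize r.1 = t at *
  generalize r.2 = t' at *
  generalize r'.1 = p at *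
  generalize r'.2 = p' at *
  generalize Real.sin (ψ - φ) = A at *
  generalize Real.sin (ψ - φ') = B at *
  generalize Real.sin (φ' - φ) = C at *
  by_contra hcon
  push Not at hcon
  have j1 : t' * p * B + t * p * C + t * p' * A ≤ 2 * (t * t' * A) := by linarith
  have j2 : p' * t * A - p * t * C + p * t' * B ≤ 2 * (p * p' * B) := by linarith
  have j3 : t' * p * B + t * p * C < t * t' * A := by nlinarith [mul_pos (mul_pos ha s1) (sub_pos.2 hcon)]
  have j4 : t * (p' * A - p * C) ≤ p * B * (2 * p' - t') := by linarith
  have j5 : p * B * t' ≤ t * (2 * t' * A - p * C - p' * A) := by linarith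
  have j6 : t' * (t * (p' * A - p * C)) ≤ t * (2 * t' * A - p * C - p' * A) * (2 * p' - t') := by
    have k1 := mul_le_mul_of_nonneg_left j4 hb.le
    have k2 := mul_le_mul_of_nonneg_right j5 (by linarith : 0 ≤ 2 * p' - t')
    linarith
  have j7 : t' * (p' * A - p * C) ≤ (2 * t' * A - p * C - p' * A) * (2 * p' - t') := by
    have : t * (t' * (p' * A - p * C)) ≤ t * ((2 * t' * A - p * C - p' * A) * (2 * p' - t')) := by
      linarith
    exact le_of_mul_le_mul_left this ha
  -- The product `p * B` has been eliminated, and the right side of `j7` minus the left is `-2 A (p'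
  -- - t')² - 2 p C (p' - t')`, negative for `p' > t'`.
  nlinarith [mul_pos s1 (pow_pos (sub_pos.2 hcon) 2), mul_pos (mul_pos ha' s3) (sub_pos.2 hcon)]

/-! ### Actions of finite segments -/

theorem segmentAction_self (S : ℝ → ℝ → ℝ) (x : ℤ → ℝ) (m : ℤ) : segmentAction S x m m = 0 := by
  simp [segmentAction]

theorem segmentAction_succ (S : ℝ → ℝ → ℝ) (x : ℤ → ℝ) {m n : ℤ} (h : m ≤ n) :
    segmentAction S x m (n + 1) = segmentAction S x m n + S (x n) (x (n + 1)) := by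
  unfold segmentAction
  rw [← Finset.insert_Ico_right_eq_Ico_add_one h, Finset.sum_insert (by simp), add_comm]

theorem le_segmentAction {S : ℝ → ℝ → ℝ} {x : ℤ → ℝ} {m n : ℤ} (h : m ≤ n) (U : ℝ → ℝ) (c : ℝ)
    (hS : ∀ i, m ≤ i → i < n → U (x (i + 1)) - U (x i) + c ≤ S (x i) (x (i + 1))) :
    U (x n) - U (x m) + (n - m : ℝ) * c ≤ segmentAction S x m n := by
  induction n, h using Int.leInduction with
  | base => rw [segmentAction_self]; simp
  | succ n hn ih =>
    rw [segmentAction_succ S x hn]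
    have h1 := ih fun i hi hi' => hS i hi (by omega)
    have h2 := hS n hn (by omega)
    push_cast
    linarith

theorem segmentAction_le {S : ℝ → ℝ → ℝ} {x : ℤ → ℝ} {m n : ℤ} (h : m ≤ n) (U : ℝ → ℝ) (c : ℝ)
    (hS : ∀ i, m ≤ i → i < n → S (x i) (x (i + 1)) ≤ U (x (i + 1)) - U (x i) + c) :
    segmentAction S x m n ≤ U (x n) - U (x m) + (n - m : ℝ) * c := by
  induction n, h using Int.leInduction with
  | base => rw [segmentAction_self]; simp
  | succ n hn ih =>
    rw [segmentAction_succ S x hn]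
    have h1 := ih fun i hi hi' => hS i hi (by omega)
    have h2 := hS n hn (by omega)
    push_cast
    linarith

/-! ### Functions with a critical upper touching function at each point -/

/-- The touching functions show that the upper right Dini derivative of `D` is at most zero
everywhere. Differentiability of `D` itself is not assumed; reflecting the line gives the opposite
inequality in `eq_of_upper_touching`. -/
theorem le_of_upper_touching {D : ℝ → ℝ} (hD : Continuous D)
    (h : ∀ x, ∃ u : ℝ → ℝ, HasDerivAt u 0 x ∧ u x = D x ∧ ∀ᶠ y in 𝓝 x, D y ≤ u y)
    {a b : ℝ} (hab : a ≤ b) : D b ≤ D a := by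
  refine image_le_of_liminf_slope_right_le_deriv_boundary (f := D) (B := fun _ => D a)
    (B' := fun _ => 0) hD.continuousOn le_rfl continuousOn_const
    (fun x _ => hasDerivWithinAt_const _ _ _) ?_ (right_mem_Icc.2 hab)
  intro x _ r hr
  obtain ⟨u, hu, hux, hle⟩ := h x
  have h1 : ∀ᶠ z in 𝓝[>] x, slope u x z < r :=
    ((hasDerivAt_iff_tendsto_slope.1 hu).mono_left
      (nhdsWithin_mono x fun y hy => (ne_of_gt hy : y ≠ x))).eventually (gt_mem_nhds hr)
  have h2 : ∀ᶠ z in 𝓝[>] x, D z ≤ u z := hle.filter_mono nhdsWithin_le_nhds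
  refine (Eventually.frequently ?_)
  filter_upwards [h1, h2, self_mem_nhdsWithin] with z hz1 hz2 hz3
  refine lt_of_le_of_lt ?_ hz1
  rw [slope_def_field, slope_def_field, hux]
  exact div_le_div_of_nonneg_right (by linarith) (sub_nonneg.2 (le_of_lt hz3))

theorem eq_of_upper_touching {D : ℝ → ℝ} (hD : Continuous D)
    (h : ∀ x, ∃ u : ℝ → ℝ, HasDerivAt u 0 x ∧ u x = D x ∧ ∀ᶠ y in 𝓝 x, D y ≤ u y)
    (a b : ℝ) : D a = D b := by
  have hneg : ∀ {a b : ℝ}, a ≤ b → D a ≤ D b := by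
    intro a b hab
    have := le_of_upper_touching (D := fun x => D (-x)) (hD.comp continuous_neg) (fun x => by
      obtain ⟨u, hu, hux, hle⟩ := h (-x)
      refine ⟨fun y => u (-y), ?_, hux, ?_⟩
      · exact (HasDerivAt.comp x hu (hasDerivAt_neg x)).congr_deriv (by simp)
      · exact continuous_neg.continuousAt.eventually hle) (neg_le_neg hab)
    simpa using this
  rcases le_total a b with hab | hab
  · exact le_antisymm (hneg hab) (le_of_upper_touching hD h hab)
  · exact le_antisymm (le_of_upper_touching hD h hab) (hneg hab)

/-! ### Rotational families of three-periodic orbits -/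

/-- A family of three-periodic orbits of the outer billiard of `Ω`, one through each ray: `F` maps
the angle of a point to the angle of its image, and `r` is the distance of the point from the
origin. -/
structure IsRotationalFamily (Ω : Set Plane) (F : ℝ ≃o ℝ) (r : ℝ → ℝ) : Prop where
  continuous : Continuous r
  periodic : ∀ φ, r (φ + 2 * π) = r φ
  map_add : ∀ φ, F (φ + 2 * π) = F φ + 2 * π
  cube : ∀ φ, F (F (F φ)) = φ + 2 * π
  lt_map : ∀ φ, φ < F φ
  map_lt : ∀ φ, F φ < φ + π
  mid : ∀ φ, IsMidTangentSegment Ω φ (F φ) (r φ, r (F φ))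

/-- Each pair of rays has a mid-tangent segment. -/
def HasMidTangentSegments (Ω : Set Plane) : Prop :=
  ∀ φ ψ, φ < ψ → ψ < φ + π → ∃ r : ℝ × ℝ, IsMidTangentSegment Ω φ ψ r

/-- The area of the sector of angles from `0` to `φ` below the graph of `r` in polar coordinates. -/
noncomputable def sectorArea (r : ℝ → ℝ) (φ : ℝ) : ℝ := ∫ t in (0 : ℝ)..φ, r t ^ 2 / 2

namespace IsRotationalFamily

variable {Ω : Set Plane} {F : ℝ ≃o ℝ} {r : ℝ → ℝ}

theorem pos (h : IsRotationalFamily Ω F r) (φ : ℝ) : 0 < r φ := (h.mid φ).1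

theorem hasDerivAt_sectorArea (h : IsRotationalFamily Ω F r) (φ : ℝ) :
    HasDerivAt (sectorArea r) (r φ ^ 2 / 2) φ := by
  have hc : Continuous fun t => r t ^ 2 / 2 := by have := h.continuous; fun_prop
  exact intervalIntegral.integral_hasDerivAt_right (hc.intervalIntegrable _ _)
    (hc.stronglyMeasurableAtFilter _ _) hc.continuousAt

theorem continuous_sectorArea (h : IsRotationalFamily Ω F r) : Continuous (sectorArea r) :=
  continuous_iff_continuousAt.2 fun φ => (h.hasDerivAt_sectorArea φ).continuousAt

theorem sectorArea_add (h : IsRotationalFamily Ω F r) (φ : ℝ) :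
    sectorArea r (φ + 2 * π) = sectorArea r φ + sectorArea r (2 * π) := by
  have hc : Continuous fun t => r t ^ 2 / 2 := by have := h.continuous; fun_prop
  unfold sectorArea
  rw [← intervalIntegral.integral_add_adjacent_intervals (hc.intervalIntegrable 0 (2 * π))
    (hc.intervalIntegrable (2 * π) (φ + 2 * π)), add_comm]
  congr 1
  have := intervalIntegral.integral_comp_add_right (fun t => r t ^ 2 / 2) (2 * π) (a := 0) (b := φ)
  rw [zero_add] at this
  rw [← this]
  simp only [h.periodic]

theorem sin_pos (h : IsRotationalFamily Ω F r) (φ : ℝ) : 0 < Real.sin (F φ - φ) :=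
  sin_sub_pos_of (h.lt_map φ) (h.map_lt φ)

theorem outerGen_map (h : IsRotationalFamily Ω F r) (φ : ℝ) :
    outerGen Ω φ (F φ) = r φ * r (F φ) * Real.sin (F φ - φ) / 2 :=
  outerGen_eq (h.sin_pos φ) (h.mid φ)

/-- The calibration inequality with the value along the family. -/
theorem calibration_aux (h : IsRotationalFamily Ω F r) (hex : HasMidTangentSegments Ω)
    {φ ψ : ℝ} (h1 : φ < ψ) (h2 : ψ < φ + π) :
    outerGen Ω φ (F φ) - sectorArea r (F φ) ≤ outerGen Ω φ ψ - sectorArea r ψ := by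
  have hder : ∀ y, φ < y → y < φ + π → ∃ s : ℝ × ℝ, IsMidTangentSegment Ω φ y s ∧
      HasDerivAt (fun y => outerGen Ω φ y - sectorArea r y) (s.2 ^ 2 / 2 - r y ^ 2 / 2) y := by
    intro y hy1 hy2
    obtain ⟨s, hs⟩ := hex φ y hy1 hy2
    exact ⟨s, hs, (hasDerivAt_outerGen_right hy1 hy2 hs (hex φ)).sub (h.hasDerivAt_sectorArea y)⟩
  have hmid : ∀ y, IsMidTangentSegment Ω (F.symm y) y (r (F.symm y), r y) := by
    intro y
    have := h.mid (F.symm y)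
    rwa [OrderIso.apply_symm_apply] at this
  have hcont : ∀ y, φ < y → y < φ + π →
      ContinuousAt (fun y => outerGen Ω φ y - sectorArea r y) y := fun y hy1 hy2 => by
    obtain ⟨s, -, hs⟩ := hder y hy1 hy2
    exact hs.continuousAt
  have hdiff : ∀ y, φ < y → y < φ + π →
      DifferentiableAt ℝ (fun y => outerGen Ω φ y - sectorArea r y) y := fun y hy1 hy2 => by
    obtain ⟨s, -, hs⟩ := hder y hy1 hy2
    exact hs.differentiableAt
  -- The derivative is `s.2 ^ 2 / 2 - r y ^ 2 / 2`, where `r y` is the second radius of the segment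
  -- from `F.symm y` to `y`. For `y` beyond `F φ` one has `φ ≤ F.symm y`, so the twist gives `r y ≤
  -- s.2`; before `F φ` the order is reversed. Hence `F φ` is the minimum.
  rcases le_total (F φ) ψ with hle | hle
  · have hmono : MonotoneOn (fun y => outerGen Ω φ y - sectorArea r y) (Icc (F φ) ψ) := by
      refine monotoneOn_of_deriv_nonneg (convex_Icc _ _)
        (fun y hy => (hcont y (lt_of_lt_of_le (h.lt_map φ) hy.1)
          (lt_of_le_of_lt hy.2 h2)).continuousWithinAt) ?_ ?_
      · intro y hy
        have hy := interior_subset hy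
        exact (hdiff y (lt_of_lt_of_le (h.lt_map φ) hy.1)
          (lt_of_le_of_lt hy.2 h2)).differentiableWithinAt
      · intro y hy
        have hy := interior_subset hy
        have hy1 := lt_of_lt_of_le (h.lt_map φ) hy.1
        have hy2 := lt_of_le_of_lt hy.2 h2
        obtain ⟨s, hs, hd⟩ := hder y hy1 hy2
        rw [hd.deriv]
        have h3 : φ ≤ F.symm y := (OrderIso.le_symm_apply F).2 hy.1
        have h4 : F.symm y < y := by
          have := h.lt_map (F.symm y)
          rwa [OrderIso.apply_symm_apply] at this
        have h5 : r y ≤ s.2 := IsMidTangentSegment.second_le h3 h4 hy2 hs (hmid y)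
        have := pow_le_pow_left₀ (h.pos y).le h5 2
        linarith
    exact hmono (left_mem_Icc.2 hle) (right_mem_Icc.2 hle) hle
  · have hanti : AntitoneOn (fun y => outerGen Ω φ y - sectorArea r y) (Icc ψ (F φ)) := by
      refine antitoneOn_of_deriv_nonpos (convex_Icc _ _)
        (fun y hy => (hcont y (lt_of_lt_of_le h1 hy.1)
          (lt_of_le_of_lt hy.2 (h.map_lt φ))).continuousWithinAt) ?_ ?_
      · intro y hy
        have hy := interior_subset hy
        exact (hdiff y (lt_of_lt_of_le h1 hy.1)
          (lt_of_le_of_lt hy.2 (h.map_lt φ))).differentiableWithinAt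
      · intro y hy
        have hy := interior_subset hy
        have hy1 := lt_of_lt_of_le h1 hy.1
        have hy2 := lt_of_le_of_lt hy.2 (h.map_lt φ)
        obtain ⟨s, hs, hd⟩ := hder y hy1 hy2
        rw [hd.deriv]
        have h3 : F.symm y ≤ φ := (OrderIso.symm_apply_le F).2 hy.2
        have h4 : y < F.symm y + π := by
          have := h.map_lt (F.symm y)
          rwa [OrderIso.apply_symm_apply] at this
        have h5 : s.2 ≤ r y := IsMidTangentSegment.second_le h3 hy1 h4 (hmid y) hs
        have := pow_le_pow_left₀ hs.2.1.le h5 2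
        linarith
    exact hanti (left_mem_Icc.2 hle) (right_mem_Icc.2 hle) hle

/-- The value of the calibrated generating function along the family. -/
theorem calibration_const (h : IsRotationalFamily Ω F r) (hex : HasMidTangentSegments Ω) (a b : ℝ) :
    outerGen Ω a (F a) - sectorArea r (F a) + sectorArea r a =
      outerGen Ω b (F b) - sectorArea r (F b) + sectorArea r b := by
  have hU := h.continuous_sectorArea
  have hF := F.continuous
  have hr := h.continuous
  -- `F` is only a homeomorphism, so `D` cannot be differentiated through it. By `calibration_aux`,
  -- freezing the second angle at `F φ` gives an upper bound touching `D` at `φ`, and its derivative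
  -- `-r²/2 + r²/2` vanishes.
  refine eq_of_upper_touching
    (D := fun φ => outerGen Ω φ (F φ) - sectorArea r (F φ) + sectorArea r φ) ?_ ?_ a b
  · simp only [h.outerGen_map]
    have hUF := hU.comp hF
    have hrF := hr.comp hF
    exact (((((hr.mul hrF).mul (Real.continuous_sin.comp (hF.sub continuous_id)))).div_const 2).sub
      hUF).add hU
  · intro φ
    obtain ⟨u, hu, huφ, hle⟩ := exists_upper_touching_left (h.lt_map φ) (h.map_lt φ) (h.mid φ)
      (fun φ' h1 h2 => hex φ' (F φ) h1 h2)
    refine ⟨fun y => u y - sectorArea r (F φ) + sectorArea r y, ?_, ?_, ?_⟩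
    · exact ((hu.sub_const _).add (h.hasDerivAt_sectorArea φ)).congr_deriv (by ring)
    · simp only [huφ]
    · have hnear : ∀ᶠ y in 𝓝 φ, y < F φ ∧ F φ < y + π :=
        Filter.mem_of_superset (isOpen_Ioo.mem_nhds ⟨by linarith [h.map_lt φ], h.lt_map φ⟩ :
          Ioo (F φ - π) (F φ) ∈ 𝓝 φ) fun y hy => ⟨hy.2, by linarith [hy.1]⟩
      filter_upwards [hle, hnear] with y hy hy'
      have := h.calibration_aux hex hy'.1 hy'.2
      linarith

theorem calibration (h : IsRotationalFamily Ω F r) (hex : HasMidTangentSegments Ω)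
    {φ ψ : ℝ} (h1 : φ < ψ) (h2 : ψ < φ + π) :
    sectorArea r ψ - sectorArea r φ + (outerGen Ω 0 (F 0) - sectorArea r (F 0) + sectorArea r 0) ≤
      outerGen Ω φ ψ := by
  have := h.calibration_aux hex h1 h2
  have := h.calibration_const hex 0 φ
  linarith

theorem calibration_eq (h : IsRotationalFamily Ω F r) (hex : HasMidTangentSegments Ω) (φ : ℝ) :
    outerGen Ω φ (F φ) = sectorArea r (F φ) - sectorArea r φ +
      (outerGen Ω 0 (F 0) - sectorArea r (F 0) + sectorArea r 0) := by
  have := h.calibration_const hex 0 φ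
  linarith

theorem zpow_succ_apply (F : ℝ ≃o ℝ) (i : ℤ) (φ : ℝ) : (F ^ (i + 1)) φ = F ((F ^ i) φ) := by
  rw [add_comm, zpow_one_add, RelIso.mul_apply]

theorem zpow_three_mul (h : IsRotationalFamily Ω F r) (k : ℤ) (φ : ℝ) :
    (F ^ (3 * k)) φ = φ + 2 * π * k := by
  induction k using Int.induction_on with
  | zero => simp
  | succ k ih =>
    rw [show 3 * ((k : ℤ) + 1) = 3 * k + 1 + 1 + 1 by ring, zpow_succ_apply, zpow_succ_apply,
      zpow_succ_apply, h.cube, ih]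
    push_cast; ring
  | pred k ih =>
    rw [show 3 * (-(k : ℤ)) = 3 * (-(k : ℤ) - 1) + 1 + 1 + 1 by ring, zpow_succ_apply,
      zpow_succ_apply, zpow_succ_apply, h.cube] at ih
    push_cast at ih ⊢
    linarith

theorem zpow_apply (h : IsRotationalFamily Ω F r) (i : ℤ) (φ : ℝ) :
    (F ^ i) φ = (F ^ (i % 3)) (φ + 2 * π * (i / 3 : ℤ)) := by
  rw [← h.zpow_three_mul, ← RelIso.mul_apply, ← zpow_add, Int.emod_add_mul_ediv]

theorem mod_cases (i : ℤ) : i % 3 = 0 ∨ i % 3 = 1 ∨ i % 3 = 2 := by omega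

theorem zpow_bound (h : IsRotationalFamily Ω F r) (i : ℤ) (φ : ℝ) :
    |(F ^ i) φ - φ - 2 * π * i / 3| ≤ 2 * π := by
  have hpi := Real.pi_pos
  rw [h.zpow_apply]
  set x := φ + 2 * π * (i / 3 : ℤ) with hx
  have hi : (i : ℝ) = ((i % 3 : ℤ) : ℝ) + 3 * ((i / 3 : ℤ) : ℝ) := by
    exact_mod_cast (Int.emod_add_mul_ediv i 3).symm
  have h1 := h.lt_map x
  have h2 := h.lt_map (F x)
  have h3 := h.lt_map (F (F x))
  rw [h.cube] at h3
  have key : ∀ y, x ≤ y → y ≤ x + 2 * π → ∀ c : ℝ, 0 ≤ c → c ≤ 2 → (i : ℝ) = c + 3 * ((i / 3 : ℤ) : ℝ) →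
      |y - φ - 2 * π * i / 3| ≤ 2 * π := by
    intro y hy1 hy2 c hc1 hc2 hic
    rw [hic, abs_le]
    constructor <;> nlinarith
  rcases mod_cases i with h0 | h0 | h0 <;> rw [h0] at hi ⊢
  · exact key _ (by simp) (by simp; linarith) _ (by norm_num) (by norm_num) hi
  · exact key _ (by simp; linarith) (by simp; linarith) _ (by norm_num) (by norm_num) hi
  · have : (F ^ (2 : ℤ)) x = F (F x) := by
      rw [show (2 : ℤ) = 1 + 1 by norm_num, zpow_succ_apply, zpow_one]
    rw [this]
    exact key _ (by linarith) (by linarith) _ (by norm_num) (by norm_num) hi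

/-- The points `φ` and `ψ` of consecutive rays are such that the action is within `η` of the
calibrated one. -/
def IsNearlyCalibrated (Ω : Set Plane) (U : ℝ → ℝ) (c : ℝ) (φ ψ : ℝ) : Prop :=
  φ < ψ ∧ ψ < φ + π ∧ outerGen Ω φ ψ ≤ U ψ - U φ + c

/-- For `δ = 0` the pair is a step of the family, with calibrated action below the bound `c`.
Replacing the generating function by the area cut off by the fixed family line makes the condition
explicitly open in `(t, δ)`, and compactness of a period gives one `δ₀` for all `t`. -/
theorem nearlyCalibrated_aux (h : IsRotationalFamily Ω F r) (hex : HasMidTangentSegments Ω)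
    {c : ℝ} (hc : outerGen Ω 0 (F 0) - sectorArea r (F 0) + sectorArea r 0 < c)
    (G : ℝ ≃o ℝ) (hG : ∀ φ, G (φ + 2 * π) = G φ + 2 * π) :
    ∃ δ₀ > 0, ∀ t δ, |δ| < δ₀ → IsNearlyCalibrated Ω (sectorArea r) c (G t) (F (G (t + δ))) := by
  have hU := h.continuous_sectorArea
  have hF := F.continuous
  have hr := h.continuous
  set Y : ℝ × ℝ → ℝ := fun p => G p.1 with hY
  set Y' : ℝ × ℝ → ℝ := fun p => F (G (p.1 + p.2)) with hY'
  have cY : Continuous Y := G.continuous.comp continuous_fst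
  have cY' : Continuous Y' := hF.comp (G.continuous.comp (continuous_fst.add continuous_snd))
  set den : ℝ × ℝ → ℝ := fun p => r (Y p) * Real.sin (Y' p - Y p) +
    r (F (Y p)) * Real.sin (F (Y p) - Y' p) with hden
  have cden : Continuous den :=
    ((hr.comp cY).mul (Real.continuous_sin.comp (cY'.sub cY))).add
      ((hr.comp (hF.comp cY)).mul (Real.continuous_sin.comp ((hF.comp cY).sub cY')))
  set V : ℝ × ℝ → ℝ := fun p => sectorArea r (Y' p) - sectorArea r (Y p) + c with hV
  have cV : Continuous V := ((hU.comp cY').sub (hU.comp cY)).add continuous_const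
  set N : ℝ × ℝ → ℝ := fun p => r (Y p) ^ 2 * r (F (Y p)) * Real.sin (F (Y p) - Y p) *
    Real.sin (Y' p - Y p) with hN
  have cN : Continuous N :=
    ((((hr.comp cY).pow 2).mul (hr.comp (hF.comp cY))).mul
      (Real.continuous_sin.comp ((hF.comp cY).sub cY))).mul (Real.continuous_sin.comp (cY'.sub cY))
  -- `N / (2 den)` is the area cut off by the family line from `Y`; the last condition is the strict
  -- bound by `V` cleared of its denominator.
  set W : Set (ℝ × ℝ) := {p | Y p < Y' p ∧ Y' p < Y p + π ∧ 0 < den p ∧ N p < 2 * V p * den p} with hW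
  have hWo : IsOpen W := by
    refine (isOpen_lt cY cY').inter ((isOpen_lt cY' (cY.add continuous_const)).inter
      ((isOpen_lt continuous_const cden).inter (isOpen_lt cN ?_)))
    exact (continuous_const.mul cV).mul cden
  have hgood : ∀ p ∈ W, IsNearlyCalibrated Ω (sectorArea r) c (Y p) (Y' p) := by
    rintro p ⟨p1, p2, p3, p4⟩
    refine ⟨p1, p2, ?_⟩
    have hs := h.sin_pos (Y p)
    refine (outerGen_le_of_line hs (h.mid (Y p)) (hex _ _ p1 p2) ?_ p3
      (sin_sub_pos_of p1 p2)).trans ?_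
    · have := mul_pos (h.pos (F (Y p))) hs
      simp only [sub_self, Real.sin_zero]; linarith
    · have hrp := h.pos (Y p)
      have hrF := h.pos (F (Y p))
      simp only [sub_self, Real.sin_zero, mul_zero, zero_add]
      have e1 : r (Y p) * r (F (Y p)) * Real.sin (F (Y p) - Y p) /
          (r (F (Y p)) * Real.sin (F (Y p) - Y p)) = r (Y p) := by field_simp
      rw [e1]
      have e2 : r (Y p) * (r (Y p) * r (F (Y p)) * Real.sin (F (Y p) - Y p) / den p) *
          Real.sin (Y' p - Y p) / 2 = N p / (2 * den p) := by
        rw [hN]; field_simp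
      change r (Y p) * (r (Y p) * r (F (Y p)) * Real.sin (F (Y p) - Y p) / den p) *
          Real.sin (Y' p - Y p) / 2 ≤ V p
      rw [e2, div_le_iff₀ (by positivity)]
      linarith
  have hzero : Icc 0 (2 * π) ×ˢ {(0 : ℝ)} ⊆ W := by
    rintro ⟨t, δ⟩ ⟨-, hδ⟩
    rw [mem_singleton_iff] at hδ
    change δ = 0 at hδ
    subst hδ
    have e : Y' (t, 0) = F (Y (t, 0)) := by simp [hY, hY']
    have hs := h.sin_pos (Y (t, 0))
    have hrp := h.pos (Y (t, 0))
    have hrF := h.pos (F (Y (t, 0)))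
    have hden0 : den (t, 0) = r (Y (t, 0)) * Real.sin (F (Y (t, 0)) - Y (t, 0)) := by
      simp only [hden]; rw [e]; simp
    refine ⟨by rw [e]; exact h.lt_map _, by rw [e]; exact h.map_lt _, by rw [hden0]; positivity, ?_⟩
    rw [hden0]
    have h3 := h.calibration_eq hex (Y (t, 0))
    rw [h.outerGen_map] at h3
    have hVlt : r (Y (t, 0)) * r (F (Y (t, 0))) * Real.sin (F (Y (t, 0)) - Y (t, 0)) / 2 < V (t, 0) := by
      rw [h3]; simp only [hV]; rw [e]; linarith
    have := mul_lt_mul_of_pos_right hVlt (mul_pos hrp hs)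
    simp only [hN]; rw [e]
    nlinarith
  obtain ⟨u, v, -, hv, hu1, hv1, huv⟩ := generalized_tube_lemma isCompact_Icc isCompact_singleton hWo hzero
  obtain ⟨δ₀, hδ₀, hball⟩ := Metric.isOpen_iff.1 hv 0 (hv1 rfl)
  refine ⟨δ₀, hδ₀, fun t δ hδ => ?_⟩
  have hper : Function.Periodic (fun t => (t, δ) ∈ W) (2 * π) := by
    intro t
    have eY : Y (t + 2 * π, δ) = Y (t, δ) + 2 * π := hG t
    have eY' : Y' (t + 2 * π, δ) = Y' (t, δ) + 2 * π := by
      simp only [hY']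
      rw [show t + 2 * π + δ = t + δ + 2 * π by ring, hG, h.map_add]
    simp only [hW, mem_ofPred_eq, hden, hN, hV]
    rw [eY, eY', h.map_add, h.periodic, h.periodic, h.sectorArea_add, h.sectorArea_add]
    simp only [add_sub_add_right_eq_sub]
    rw [add_lt_add_iff_right, show Y (t, δ) + 2 * π + π = Y (t, δ) + π + 2 * π by ring,
      add_lt_add_iff_right]
  obtain ⟨t', ht', heq⟩ := hper.exists_mem_Ico₀ Real.two_pi_pos t
  have : (t', δ) ∈ W := huv ⟨hu1 ⟨ht'.1, ht'.2.le⟩, hball (by simpa using hδ)⟩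
  exact hgood _ (heq.symm ▸ this : (t, δ) ∈ W)

/-- Modulo full turns there are only three powers of `F`, so `δ₀` can be chosen independently of
`i`. -/
theorem nearlyCalibrated (h : IsRotationalFamily Ω F r) (hex : HasMidTangentSegments Ω)
    {c : ℝ} (hc : outerGen Ω 0 (F 0) - sectorArea r (F 0) + sectorArea r 0 < c) :
    ∃ δ₀ > 0, ∀ (i : ℤ) (t δ : ℝ), |δ| < δ₀ →
      IsNearlyCalibrated Ω (sectorArea r) c ((F ^ i) t) ((F ^ (i + 1)) (t + δ)) := by
  obtain ⟨d0, hd0, h0⟩ := h.nearlyCalibrated_aux hex hc (F ^ (0 : ℤ)) (by simp)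
  obtain ⟨d1, hd1, h1⟩ := h.nearlyCalibrated_aux hex hc (F ^ (1 : ℤ)) (by simpa using h.map_add)
  obtain ⟨d2, hd2, h2⟩ := h.nearlyCalibrated_aux hex hc (F ^ (2 : ℤ)) (by
    intro φ
    rw [show (2 : ℤ) = 1 + 1 by norm_num, zpow_succ_apply, zpow_succ_apply, zpow_one, h.map_add,
      h.map_add])
  refine ⟨min d0 (min d1 d2), by positivity, fun i t δ hδ => ?_⟩
  rw [lt_min_iff, lt_min_iff] at hδ
  rw [zpow_succ_apply, h.zpow_apply i, h.zpow_apply i (t + δ), add_right_comm t δ]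
  rcases mod_cases i with hi | hi | hi <;> rw [hi]
  · exact h0 _ _ hδ.1
  · exact h1 _ _ hδ.2.1
  · exact h2 _ _ hδ.2.2

end IsRotationalFamily

/-! ### Rotation numbers and averages of bounded quantities. -/

theorem tendsto_div_of_bounded {b : ℕ → ℝ} {B : ℝ} (hb : ∀ N, |b N| ≤ B) :
    Tendsto (fun N : ℕ => b N / (2 * (N : ℝ))) atTop (𝓝 0) := by
  refine squeeze_zero_norm (a := fun N : ℕ => B / 2 * (N : ℝ)⁻¹) (fun N => ?_) ?_
  · rw [Real.norm_eq_abs, abs_div, abs_mul, abs_two, Nat.abs_cast, div_eq_mul_inv, mul_inv]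
    have : (0 : ℝ) ≤ 2⁻¹ * (N : ℝ)⁻¹ := by positivity
    have := mul_le_mul_of_nonneg_right (hb N) this
    linarith
  · simpa using (tendsto_inv_atTop_zero.comp tendsto_natCast_atTop_atTop).const_mul (B / 2)

theorem hasRotationNumber_of_bounded {x : ℤ → ℝ} {ω B : ℝ}
    (h : ∀ i : ℤ, |x i - 2 * π * i * ω| ≤ B) : HasRotationNumber x ω := by
  have key : ∀ l : Filter ℤ, Tendsto (fun i : ℤ => |(i : ℝ)|) l atTop →
      Tendsto (fun i : ℤ => x i / (2 * π * (i : ℝ))) l (𝓝 ω) := by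
    intro l hl
    rw [tendsto_iff_norm_sub_tendsto_zero]
    refine squeeze_zero' (g := fun i : ℤ => B / (2 * π) * |(i : ℝ)|⁻¹)
      (Eventually.of_forall fun i => norm_nonneg _) ?_ ?_
    · filter_upwards [hl.eventually_gt_atTop 0] with i hi
      have hi0 : (i : ℝ) ≠ 0 := abs_pos.1 hi
      have e : x i / (2 * π * (i : ℝ)) - ω = (x i - 2 * π * i * ω) / (2 * π * i) := by
        field_simp
      rw [e, Real.norm_eq_abs, abs_div, abs_mul, abs_of_pos Real.two_pi_pos, div_mul_eq_mul_div,
        ← div_eq_mul_inv, div_div, mul_comm |(i : ℝ)|]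
      gcongr
      exact h i
    · simpa using (tendsto_inv_atTop_zero.comp hl).const_mul (B / (2 * π))
  exact ⟨key _ (tendsto_abs_atTop_atTop.comp tendsto_intCast_atTop_atTop),
    key _ (tendsto_abs_atBot_atTop.comp (tendsto_intCast_atBot_iff.2 tendsto_id))⟩

theorem HasRotationNumber.tendsto_nat {x : ℤ → ℝ} {ω : ℝ} (h : HasRotationNumber x ω) :
    Tendsto (fun N : ℕ => x (N : ℤ) / (2 * (N : ℝ))) atTop (𝓝 (π * ω)) ∧
      Tendsto (fun N : ℕ => x (-(N : ℤ)) / (2 * (N : ℝ))) atTop (𝓝 (-(π * ω))) := by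
  have hpi := Real.pi_pos
  constructor
  · refine ((h.1.comp tendsto_natCast_atTop_atTop).const_mul π).congr fun N => ?_
    simp only [Function.comp, Int.cast_natCast]
    rw [mul_comm 2 π, mul_assoc, ← mul_div_assoc, mul_div_mul_left _ _ hpi.ne']
  · refine ((h.2.comp (tendsto_neg_atTop_atBot.comp
      tendsto_natCast_atTop_atTop)).const_mul (-π)).congr' ?_ |>.trans (by rw [neg_mul])
    refine Eventually.of_forall fun N => ?_
    simp only [Function.comp, Int.cast_neg, Int.cast_natCast]
    rw [mul_comm 2 π, mul_assoc, mul_neg, mul_neg, ← mul_div_assoc, div_neg, neg_mul, neg_div,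
      neg_neg, mul_div_mul_left _ _ hpi.ne']

/-! ### The minimal average action of a rotational family. -/

namespace IsRotationalFamily

variable {Ω : Set Plane} {F : ℝ ≃o ℝ} {r : ℝ → ℝ}

theorem sectorArea_sub_bounded (h : IsRotationalFamily Ω F r) :
    ∃ B, ∀ φ, |sectorArea r φ - sectorArea r (2 * π) / (2 * π) * φ| ≤ B := by
  have hc : Continuous fun φ => sectorArea r φ - sectorArea r (2 * π) / (2 * π) * φ := by
    have := h.continuous_sectorArea
    fun_prop
  have hper : Function.Periodic
      (fun φ => sectorArea r φ - sectorArea r (2 * π) / (2 * π) * φ) (2 * π) := by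
    intro φ
    simp only [h.sectorArea_add]
    have := Real.two_pi_pos.ne'
    field_simp
    ring
  obtain ⟨B, hB⟩ := (isCompact_Icc (a := (0 : ℝ)) (b := 2 * π)).exists_bound_of_continuousOn
    hc.continuousOn
  refine ⟨B, fun φ => ?_⟩
  obtain ⟨y, hy, he⟩ := hper.exists_mem_Ico₀ Real.two_pi_pos φ
  rw [show sectorArea r φ - sectorArea r (2 * π) / (2 * π) * φ = _ from he]
  exact hB y ⟨hy.1, hy.2.le⟩

/-- Along an orbit each step attains the calibration bound, and the potential telescopes to a
quantity depending only on the end-points. -/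
theorem orbit_minimizing (h : IsRotationalFamily Ω F r) (hex : HasMidTangentSegments Ω) (φ : ℝ) :
    IsActionMinimizing (outerGen Ω) (fun i => (F ^ i) φ) := by
  intro m n hmn
  refine ⟨fun i _ _ => ?_, fun y hy hm hn => ?_⟩
  · simp only [zpow_succ_apply]
    have h1 := h.lt_map ((F ^ i) φ)
    have h2 := h.map_lt ((F ^ i) φ)
    constructor <;> linarith
  · simp only at hm hn
    refine (segmentAction_le hmn.le (sectorArea r)
      (outerGen Ω 0 (F 0) - sectorArea r (F 0) + sectorArea r 0) fun i _ _ => ?_).trans ?_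
    · simp only [zpow_succ_apply]
      exact (h.calibration_eq hex _).le
    · rw [← hm, ← hn]
      refine le_segmentAction hmn.le _ _ fun i hi hi' => ?_
      have := hy i hi hi'
      exact h.calibration hex (by linarith [this.1]) (by linarith [this.2])

/-- The average action of a minimizing configuration of rotation number `1 / 3`. -/
theorem isMinimalAverageAction (h : IsRotationalFamily Ω F r) (hex : HasMidTangentSegments Ω) :
    IsMinimalAverageAction (outerGen Ω) (1 / 3)
      (outerGen Ω 0 (F 0) - sectorArea r (F 0) + sectorArea r 0 + sectorArea r (2 * π) / 3) := by
  have hpi := Real.pi_pos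
  set C := outerGen Ω 0 (F 0) - sectorArea r (F 0) + sectorArea r 0 with hC
  set U := sectorArea r with hU
  refine ⟨⟨fun i => (F ^ i) 0, h.orbit_minimizing hex 0, hasRotationNumber_of_bounded
    (B := 2 * π) fun i => ?_⟩, fun x hx hrot => ?_⟩
  · have := h.zpow_bound i 0
    rwa [sub_zero, show 2 * π * (i : ℝ) / 3 = 2 * π * i * (1 / 3) by ring] at this
  obtain ⟨hr1, hr2⟩ := hrot.tendsto_nat
  set V : ℕ → ℝ := fun N => (U (x N) - U (x (-N))) / (2 * (N : ℝ)) with hV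
  have hVlim : Tendsto V atTop (𝓝 (U (2 * π) / 3)) := by
    obtain ⟨B, hB⟩ := h.sectorArea_sub_bounded
    set k := U (2 * π) / (2 * π) with hk
    have h1 := tendsto_div_of_bounded (fun N : ℕ => hB (x N))
    have h2 := tendsto_div_of_bounded (fun N : ℕ => hB (x (-N)))
    have h3 := ((h1.sub h2).add ((hr1.sub hr2).const_mul k))
    refine (h3.congr fun N => ?_).trans (le_of_eq ?_)
    · simp only [hV]; ring
    · congr 1; rw [hk]; field_simp; ring
  set T : ℕ → ℝ := fun N => (1 / (2 * (N : ℝ))) * segmentAction (outerGen Ω) x (-(N : ℤ)) N with hT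
  -- The lower bound needs only admissibility; minimality enters in the upper bound `hup`.
  have hlow : ∀ N : ℕ, 1 ≤ N → V N + C ≤ T N := by
    intro N hN
    have hN0 : (0 : ℝ) < N := by exact_mod_cast hN
    have hadm := (hx (-(N : ℤ)) N (by omega)).1
    have h1 := le_segmentAction (S := outerGen Ω) (x := x) (m := -(N : ℤ)) (n := N) (by omega) U C
      fun i hi hi' => by
        have := hadm i hi hi'
        exact h.calibration hex (by linarith [this.1]) (by linarith [this.2])
    push_cast at h1
    have h2 : V N + C = (1 / (2 * (N : ℝ))) * (U (x N) - U (x (-N)) + (N - -N) * C) := by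
      simp only [hV]; field_simp; ring
    rw [h2]
    exact mul_le_mul_of_nonneg_left h1 (by positivity)
  have hup : ∀ η > 0, ∀ᶠ N in atTop, T N ≤ V N + C + η := by
    intro η hη
    obtain ⟨δ₀, hδ₀, hnear⟩ := h.nearlyCalibrated hex (c := C + η) (by linarith)
    -- `t0` and `t1` are the points at index 0 of the family orbits through `x (-N)` and `x N`.
    -- Rotation number 1/3 makes their distance `o(N)`, so the drift per step `δ` tends to zero.
    set t1 : ℕ → ℝ := fun N => (F ^ (-(N : ℤ))) (x N) with ht1
    set t0 : ℕ → ℝ := fun N => (F ^ (N : ℤ)) (x (-N)) with ht0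
    have hδ : Tendsto (fun N : ℕ => (t1 N - t0 N) / (2 * (N : ℝ))) atTop (𝓝 0) := by
      have h1 := tendsto_div_of_bounded (fun N : ℕ => h.zpow_bound (-(N : ℤ)) (x N))
      have h2 := tendsto_div_of_bounded (fun N : ℕ => h.zpow_bound (N : ℤ) (x (-N)))
      have h3 := ((h1.sub h2).add ((hr1.sub hr2).sub_const (2 * π / 3)))
      refine (h3.congr' ?_).trans (le_of_eq ?_)
      · filter_upwards [eventually_ge_atTop 1] with N hN
        have hN0 : (0 : ℝ) < N := by exact_mod_cast hN
        simp only [ht1, ht0]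
        push_cast
        field_simp
        ring
      · congr 1; ring
    have hδ' : ∀ᶠ N : ℕ in atTop, |(t1 N - t0 N) / (2 * (N : ℝ))| < δ₀ := by
      have := hδ.abs
      rw [abs_zero] at this
      exact this.eventually (gt_mem_nhds hδ₀)
    filter_upwards [hδ', eventually_ge_atTop 1] with N hN hN1
    have hN0 : (0 : ℝ) < N := by exact_mod_cast hN1
    set δ := (t1 N - t0 N) / (2 * (N : ℝ)) with hδdef
    -- The comparison segment drifts linearly from the orbit of `x (-N)` to the orbit of `x N`, so
    -- it has the end-points of `x` and each of its steps is nearly calibrated.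
    set y : ℤ → ℝ := fun i => (F ^ i) (t0 N + ((i : ℝ) + N) * δ) with hy
    have hym : y (-(N : ℤ)) = x (-(N : ℤ)) := by
      simp only [hy, ht0]
      push_cast
      rw [neg_add_cancel, zero_mul, add_zero, ← RelIso.mul_apply, ← zpow_add, neg_add_cancel,
        zpow_zero, RelIso.coe_one, id]
    have hyn : y N = x N := by
      simp only [hy]
      have : t0 N + (((N : ℤ) : ℝ) + N) * δ = t1 N := by
        rw [hδdef]; push_cast; field_simp; ring
      rw [this, ht1]
      simp only
      rw [← RelIso.mul_apply, ← zpow_add, add_neg_cancel, zpow_zero, RelIso.coe_one, id]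
    have hstep : ∀ i : ℤ, IsNearlyCalibrated Ω U (C + η) (y i) (y (i + 1)) := by
      intro i
      have := hnear i (t0 N + ((i : ℝ) + N) * δ) δ hN
      simp only [hy]
      push_cast
      rwa [show t0 N + ((i : ℝ) + 1 + N) * δ = t0 N + ((i : ℝ) + N) * δ + δ by ring]
    have h1 := (hx (-(N : ℤ)) N (by omega)).2 y (fun i _ _ => by
      obtain ⟨p1, p2, -⟩ := hstep i
      constructor <;> linarith) hym hyn
    have h2 := segmentAction_le (S := outerGen Ω) (x := y) (m := -(N : ℤ)) (n := N) (by omega) U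
      (C + η) fun i _ _ => (hstep i).2.2
    rw [hym, hyn] at h2
    push_cast at h2
    have h3 : V N + C + η = (1 / (2 * (N : ℝ))) * (U (x N) - U (x (-N)) + (N - -N) * (C + η)) := by
      simp only [hV]; field_simp; ring
    rw [h3]
    exact mul_le_mul_of_nonneg_left (h1.trans h2) (by positivity)
  have hdiff : Tendsto (fun N => T N - V N - C) atTop (𝓝 0) := by
    rw [Metric.tendsto_atTop']
    intro ε hε
    obtain ⟨N0, hN0⟩ := eventually_atTop.1 (hup (ε / 2) (by positivity))
    refine ⟨max N0 1, fun N hN => ?_⟩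
    have h1 := hN0 N (le_trans (le_max_left _ _) hN.le)
    have h2 := hlow N (le_trans (le_max_right _ _) hN.le)
    rw [Real.dist_eq, sub_zero, abs_lt]
    constructor <;> linarith
  have := (hdiff.add hVlim).add_const C
  refine (this.congr fun N => ?_).trans (le_of_eq ?_)
  · simp only [hT]; ring
  · congr 1; ring

/-- The sum of the generating function along an orbit of the family. -/
theorem orbit_sum (h : IsRotationalFamily Ω F r) (hex : HasMidTangentSegments Ω) (φ : ℝ) :
    outerGen Ω φ (F φ) + outerGen Ω (F φ) (F (F φ)) + outerGen Ω (F (F φ)) (φ + 2 * π) =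
      3 * (outerGen Ω 0 (F 0) - sectorArea r (F 0) + sectorArea r 0 + sectorArea r (2 * π) / 3) := by
  have h1 := h.calibration_eq hex φ
  have h2 := h.calibration_eq hex (F φ)
  have h3 := h.calibration_eq hex (F (F φ))
  rw [h.cube, h.sectorArea_add] at h3
  linarith

end IsRotationalFamily

/-! ### Injective self-maps of the circle -/

/-- The mean of the values at two opposite points is attained on each of the two arcs between them.
-/
theorem not_injective_of_continuous_circle {g : Circle → ℝ} (hg : Continuous g) :
    ¬ Function.Injective g := by
  intro hinj
  have hpi := Real.pi_pos
  set h : ℝ → ℝ := fun t => g (Circle.exp t) with hh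
  have hc : Continuous h := hg.comp Circle.exp.continuous
  have h2 : h (2 * π) = h 0 := by
    simp only [hh, Circle.exp_two_pi, Circle.exp_zero]
  have hne : ∀ s t : ℝ, s < t → t < s + 2 * π → h s ≠ h t := by
    intro s t h1 h2 heq
    obtain ⟨m, hm⟩ := Circle.exp_eq_exp.1 (hinj heq)
    have hm1 : (m : ℝ) < 0 := by by_contra hcon; push Not at hcon; nlinarith
    have hm2 : (-1 : ℝ) < m := by by_contra hcon; push Not at hcon; nlinarith
    have hm1' : m < 0 := by exact_mod_cast hm1
    have hm2' : -1 < m := by exact_mod_cast hm2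
    omega
  have hab := hne 0 π hpi (by linarith)
  obtain ⟨s, hs, hsv⟩ := intermediate_value_uIcc (a := 0) (b := π) hc.continuousOn
    (show (h 0 + h π) / 2 ∈ uIcc (h 0) (h π) by
      rcases le_total (h 0) (h π) with hle | hle
      · rw [uIcc_of_le hle]; constructor <;> linarith
      · rw [uIcc_of_ge hle]; constructor <;> linarith)
  obtain ⟨t, ht, htv⟩ := intermediate_value_uIcc (a := π) (b := 2 * π) hc.continuousOn
    (show (h 0 + h π) / 2 ∈ uIcc (h π) (h (2 * π)) by
      rw [h2]
      rcases le_total (h 0) (h π) with hle | hle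
      · rw [uIcc_of_ge hle]; constructor <;> linarith
      · rw [uIcc_of_le hle]; constructor <;> linarith)
  rw [uIcc_of_le hpi.le] at hs
  rw [uIcc_of_le (by linarith)] at ht
  have hs0 : s ≠ 0 := by
    rintro rfl
    exact hab (by linarith)
  have hsp : s ≠ π := by
    rintro rfl
    exact hab (by linarith)
  have hs0' : 0 < s := lt_of_le_of_ne hs.1 hs0.symm
  have hsp' : s < π := lt_of_le_of_ne hs.2 hsp
  exact hne s t (by linarith [ht.1]) (by linarith [ht.2]) (hsv.trans htv.symm)

/-- If `w` were omitted, `-f / w` would avoid the cut of the argument, which would then give an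
injective continuous real function on the circle. -/
theorem surjective_of_injective_circle {f : Circle → Circle} (hf : Continuous f)
    (hinj : Function.Injective f) : Function.Surjective f := by
  intro w
  by_contra hw
  push Not at hw
  have hne : ∀ z, (-(f z / w : Circle) : ℂ) ∈ Complex.slitPlane := by
    intro z
    rw [Complex.mem_slitPlane_iff_arg]
    refine ⟨fun harg => ?_, by simp⟩
    rw [Complex.arg_eq_pi_iff] at harg
    have hnorm : ‖(-(f z / w : Circle) : ℂ)‖ = 1 := by rw [norm_neg, Circle.norm_coe]
    have h1 : (-(f z / w : Circle) : ℂ) = -1 := by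
      apply Complex.ext
      · rw [Complex.norm_eq_sqrt_sq_add_sq, harg.2, Real.sqrt_eq_one] at hnorm
        simp only [Complex.neg_re, Complex.one_re]
        rw [Complex.neg_re] at hnorm harg
        nlinarith [harg.1]
      · simpa using harg.2
    have h2 : (f z / w : Circle) = 1 := by
      apply Circle.ext
      simpa using h1
    exact hw z (div_eq_one.1 h2)
  have hgc : Continuous fun z : Circle => Complex.arg (-(f z / w : Circle) : ℂ) := by
    rw [continuous_iff_continuousAt]
    intro z
    refine ContinuousAt.comp (f := fun z : Circle => (-(f z / w : Circle) : ℂ))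
      (Complex.continuousAt_arg (hne z)) (Continuous.continuousAt ?_)
    exact (continuous_subtype_val.comp (hf.div_const w)).neg
  refine not_injective_of_continuous_circle hgc fun z z' h => hinj ?_
  have h1 : (-(f z / w : Circle) : ℂ) = -(f z' / w : Circle) :=
    Complex.ext_norm_arg (by rw [norm_neg, norm_neg, Circle.norm_coe, Circle.norm_coe]) h
  have h2 : (f z / w : Circle) = f z' / w := Circle.ext (neg_injective h1)
  exact div_left_injective h2

/-! ### Directions as points of the circle -/

/-- The direction of a vector of the plane, as a complex number. -/
noncomputable def planeDir (v : Plane) : ℂ := ((v 0 / ‖v‖ : ℝ) : ℂ) + ((v 1 / ‖v‖ : ℝ) : ℂ) * Complex.I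

theorem norm_planeDir {v : Plane} (hv : v ≠ 0) : ‖planeDir v‖ = 1 := by
  have hn : 0 < ‖v‖ := norm_pos_iff.2 hv
  rw [planeDir, Complex.norm_add_mul_I, Real.sqrt_eq_one, div_pow, div_pow, ← add_div,
    ← plane_norm_sq, div_self (by positivity)]

theorem planeDir_smul_unitDir {l : ℝ} (hl : 0 < l) (ψ : ℝ) :
    planeDir (l • unitDir ψ) = Circle.exp ψ := by
  rw [planeDir, norm_smul, norm_unitDir, mul_one, Real.norm_of_nonneg hl.le, PiLp.smul_apply,
    PiLp.smul_apply, smul_eq_mul, smul_eq_mul, mul_div_cancel_left₀ _ hl.ne',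
    mul_div_cancel_left₀ _ hl.ne', unitDir_zero_apply, unitDir_one_apply, Circle.coe_exp,
    Complex.exp_mul_I, Complex.ofReal_cos, Complex.ofReal_sin]

theorem eq_norm_smul_unitDir {v : Plane} {ψ : ℝ} (hv : v ≠ 0) (h : planeDir v = Circle.exp ψ) :
    v = ‖v‖ • unitDir ψ := by
  have hn : ‖v‖ ≠ 0 := norm_ne_zero_iff.2 hv
  rw [Circle.coe_exp, Complex.exp_mul_I, ← Complex.ofReal_cos, ← Complex.ofReal_sin, planeDir] at h
  have h0 := congrArg Complex.re h
  have h1 := congrArg Complex.im h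
  simp only [Complex.add_re, Complex.ofReal_re, Complex.mul_re, Complex.I_re, mul_zero,
    Complex.ofReal_im, Complex.I_im, mul_one, sub_self, add_zero, Complex.add_im, Complex.mul_im,
    zero_add] at h0 h1
  rw [div_eq_iff hn] at h0 h1
  apply plane_ext
  · rw [PiLp.smul_apply, unitDir_zero_apply, smul_eq_mul, h0, mul_comm]
  · rw [PiLp.smul_apply, unitDir_one_apply, smul_eq_mul, h1, mul_comm]

theorem exists_eq_smul_unitDir {v : Plane} (hv : v ≠ 0) : ∃ l ψ : ℝ, 0 < l ∧ v = l • unitDir ψ := by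
  obtain ⟨ψ, hψ⟩ := Circle.exp_surjective ⟨planeDir v, mem_sphere_zero_iff_norm.2 (norm_planeDir hv)⟩
  refine ⟨‖v‖, ψ, norm_pos_iff.2 hv, eq_norm_smul_unitDir hv ?_⟩
  rw [hψ]

/-! ### Families of critical triangles parametrized by the direction of a tangent line -/

/-- A continuous family of three-periodic orbits, in which `P ψ` is the point whose tangent segment
`P ψ`, `Q ψ` has direction `ψ`, and `Ψ ψ` is the direction at its image. -/
structure IsTangentFamily (Ω : Set Plane) (P Q : ℝ → Plane) (l : ℝ → ℝ) (Ψ : ℝ ≃o ℝ) : Prop where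
  continuous : Continuous P
  periodic : ∀ ψ, P (ψ + 2 * π) = P ψ
  map_add : ∀ ψ, Ψ (ψ + 2 * π) = Ψ ψ + 2 * π
  cube : ∀ ψ, Ψ (Ψ (Ψ ψ)) = ψ + 2 * π
  lt_map : ∀ ψ, ψ < Ψ ψ
  map_lt : ∀ ψ, Ψ ψ < ψ + π
  pos : ∀ ψ, 0 < l ψ
  eq_add : ∀ ψ, Q ψ = P ψ + l ψ • unitDir ψ
  image_eq : ∀ ψ, P (Ψ ψ) = Q ψ + l ψ • unitDir ψ
  mem : ∀ ψ, Q ψ ∈ Ω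
  support : ∀ ψ, ∀ z ∈ Ω, 0 ≤ areaForm2 (unitDir ψ) (z - Q ψ)

theorem angleFrom_add_two_pi (ψ : ℝ) (v : Plane) :
    angleFrom (ψ + 2 * π) v = angleFrom ψ v + 2 * π := by
  unfold angleFrom
  rw [Real.cos_add_two_pi, Real.sin_add_two_pi]; ring

/-- The invariant curve is reparametrized by the direction of the tangent segment leaving a point.
This is possible because that direction is an injective, hence bijective, continuous function on the
circle; the map on the curve then lifts to the real line of directions. -/
theorem exists_isTangentFamily {Ω : Set Plane} (hΩ : IsBilliardTable Ω)
    (hcurve : HasInvariantCurveOfPeriod Ω 3) : ∃ P Q l Ψ, IsTangentFamily Ω P Q l Ψ := by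
  obtain ⟨c, hc, hcinj, hcΩ, hcB, hcper⟩ := hcurve
  have hsc := hΩ.strictConvex
  have hpi := Real.pi_pos
  have hout : ∀ z, c z ∉ Ω := fun z => hcΩ (mem_range_self z)
  have hex : ∀ z, ∃ q, IsTangencyPoint Ω (c z) q := fun z =>
    exists_isTangencyPoint hΩ.isCompact hsc.convex ⟨0, interior_subset hΩ.zero_mem⟩ (hout z)
  choose q hq using hex
  have hB : ∀ z, outerBilliard Ω (c z) = (2 : ℝ) • q z - c z := fun z =>
    outerBilliard_eq hsc (hout z) (hq z)
  have hσ : ∀ z, ∃ z', c z' = (2 : ℝ) • q z - c z := fun z => by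
    rw [← hB z]
    have : outerBilliard Ω (c z) ∈ range c := hcB ▸ mem_image_of_mem _ (mem_range_self z)
    exact this
  choose σ hσ using hσ
  have hσ3 : ∀ z, σ (σ (σ z)) = z := fun z => by
    apply hcinj
    have h1 := hcper (c z) (mem_range_self z)
    have h2 : outerBilliard Ω (outerBilliard Ω (outerBilliard Ω (c z))) = c z := h1
    rwa [hB, ← hσ, hB, ← hσ, hB, ← hσ] at h2
  have hqc : Continuous q := continuous_tangency hΩ.isCompact hsc hc hout hq
  have hcσ : Continuous fun z => c (σ z) := by
    simp only [hσ]; fun_prop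
  have hqσ : Continuous fun z => q (σ z) :=
    continuous_tangency hΩ.isCompact hsc hcσ (fun z => hout _) (fun z => hq _)
  set d : Circle → Plane := fun z => q z - c z with hd
  have hd0 : ∀ z, d z ≠ 0 := fun z h0 => hout z (sub_eq_zero.1 h0 ▸ (hq z).1)
  -- The tangency points are the midpoints of the sides of the orbit triangle, so each side of their
  -- triangle is half of a side of the orbit triangle.
  have hdσ : ∀ z, d z = q (σ z) - q (σ (σ z)) := fun z => by
    have h0 := hσ z
    have h1 := hσ (σ z)
    have h2 := hσ (σ (σ z))
    rw [hσ3] at h2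
    simp only [hd]
    have h3 : (2 : ℝ) • (q z - c z) = (2 : ℝ) • (q (σ z) - q (σ (σ z))) := by
      rw [h1, h0] at h2
      rw [smul_sub, smul_sub]
      nth_rewrite 1 [two_smul ℝ (c z)]
      nth_rewrite 1 [h2]
      abel
    exact smul_right_injective Plane (two_ne_zero' ℝ) h3
  have hcrit : ∀ z, IsCriticalTriangle Ω (q z) (q (σ z)) (q (σ (σ z))) := fun z => by
    refine ⟨(hq _).1, (hq _).1, (hq _).1, ?_, ?_, ?_⟩
    · rw [← hdσ]; exact (hq z).support
    · have := hdσ (σ z); rw [hσ3] at this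
      rw [← this]; exact (hq (σ z)).support
    · have := hdσ (σ (σ z)); rw [hσ3] at this
      rw [← this]; exact (hq _).support
  have hdc : Continuous d := hqc.sub hc
  have hDc : Continuous fun z => planeDir (d z) := by
    have h0 : Continuous fun z => d z 0 := by fun_prop
    have h1 : Continuous fun z => d z 1 := by fun_prop
    have hn : ∀ z, ‖d z‖ ≠ 0 := fun z => norm_ne_zero_iff.2 (hd0 z)
    exact (Complex.continuous_ofReal.comp (h0.div hdc.norm hn)).add
      ((Complex.continuous_ofReal.comp (h1.div hdc.norm hn)).mul continuous_const)
  set D : Circle → Circle := fun z =>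
    ⟨planeDir (d z), mem_sphere_zero_iff_norm.2 (norm_planeDir (hd0 z))⟩ with hD
  have hDc' : Continuous D := hDc.subtype_mk _
  have hDiff : ∀ z ψ, D z = Circle.exp ψ ↔ d z = ‖d z‖ • unitDir ψ := by
    intro z ψ
    constructor
    · intro h
      exact eq_norm_smul_unitDir (hd0 z) (congrArg (fun w : Circle => (w : ℂ)) h)
    · intro h
      apply Circle.ext
      change planeDir (d z) = _
      rw [h, planeDir_smul_unitDir (norm_pos_iff.2 (hd0 z))]
  -- Equally directed tangent lines touch `Ω` at the same point, and that vertex with the direction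
  -- of the opposite side determines the critical triangle, hence the point of the curve.
  have hDinj : Function.Injective D := by
    intro z z' hzz
    obtain ⟨ψ, hψ⟩ := Circle.exp_surjective (D z)
    have h1 := (hDiff z ψ).1 hψ.symm
    have h2 := (hDiff z' ψ).1 (hψ.trans hzz).symm
    have n1 : 0 < ‖d z‖ := norm_pos_iff.2 (hd0 z)
    have n2 : 0 < ‖d z'‖ := norm_pos_iff.2 (hd0 z')
    have hpar : d z' = (‖d z'‖ / ‖d z‖) • d z := by
      conv_rhs => rw [h1]
      rw [norm_smul, norm_unitDir, mul_one, norm_norm, smul_smul, div_mul_cancel₀ _ n1.ne']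
      exact h2
    have hqq : q z' = q z := by
      refine support_unique hsc (hd0 z) (hq z).support (hq z).1 (hq z').1 (le_antisymm ?_ ?_)
      · have := (hq z').support (q z) (hq z).1
        change 0 ≤ areaForm2 (d z') _ at this
        rw [hpar, areaForm2_smul_left, ← neg_sub, ← neg_one_smul ℝ, areaForm2_smul_right] at this
        have h3 : 0 < ‖d z'‖ / ‖d z‖ := div_pos n2 n1
        nlinarith
      · exact (hq z).support (q z') (hq z').1
    have hcr' := hcrit z'
    rw [hqq] at hcr'
    have hpar2 := hpar
    rw [hdσ z, hdσ z', ← hdσ z, ← hdσ z'] at hpar2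
    have hne : q (σ z) ≠ q (σ (σ z)) := by
      rw [← sub_ne_zero, ← hdσ]; exact hd0 z
    have hfin := (hcrit z).eq_of_parallel hsc hcr' hne (div_pos n2 n1)
      (by rw [← hdσ, ← hdσ]; exact hpar)
    have hdd : d z' = d z := by rw [hdσ, hdσ z, hfin.1, hfin.2]
    apply hcinj
    simp only [hd] at hdd
    rw [hqq] at hdd
    exact (sub_right_injective hdd).symm
  have hDbij : Function.Bijective D := ⟨hDinj, surjective_of_injective_circle hDc' hDinj⟩
  set E : Circle ≃ₜ Circle := Continuous.homeoOfEquivCompactToT2 (f := Equiv.ofBijective D hDbij) hDc'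
    with hE
  set Z : ℝ → Circle := fun ψ => E.symm (Circle.exp ψ) with hZ
  have hZc : Continuous Z := E.symm.continuous.comp Circle.exp.continuous
  have hDZ : ∀ ψ, D (Z ψ) = Circle.exp ψ := fun ψ => E.apply_symm_apply (Circle.exp ψ)
  have hZu : ∀ z ψ, D z = Circle.exp ψ → z = Z ψ := fun z ψ h => hDinj (h.trans (hDZ ψ).symm)
  have hdZ : ∀ ψ, d (Z ψ) = ‖d (Z ψ)‖ • unitDir ψ := fun ψ => (hDiff _ _).1 (hDZ ψ)
  have hlpos : ∀ z, 0 < ‖d z‖ := fun z => norm_pos_iff.2 (hd0 z)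
  set Ψ : ℝ → ℝ := fun ψ => angleFrom ψ (d (σ (Z ψ))) with hΨ
  have hspec : ∀ ψ, d (σ (Z ψ)) = ‖d (σ (Z ψ))‖ • unitDir (Ψ ψ) ∧ ψ < Ψ ψ ∧ Ψ ψ < ψ + π := by
    intro ψ
    apply angleFrom_spec
    have hne : q (σ (Z ψ)) ≠ q (σ (σ (Z ψ))) := by
      rw [← sub_ne_zero, ← hdσ]; exact hd0 _
    have hpos := (hcrit (Z ψ)).area_pos hsc hne
    have h1 : areaForm2 (d (Z ψ)) (d (σ (Z ψ))) = triArea2 (q (Z ψ)) (q (σ (Z ψ))) (q (σ (σ (Z ψ)))) := by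
      rw [hdσ, hdσ (σ (Z ψ)), hσ3]
      simp only [triArea2, areaForm2, PiLp.sub_apply]; ring
    rw [← h1, hdZ, areaForm2_smul_left] at hpos
    exact pos_of_mul_pos_right hpos (norm_nonneg _)
  have hZΨ : ∀ ψ, Z (Ψ ψ) = σ (Z ψ) := fun ψ => (hZu _ _ ((hDiff _ _).2 (hspec ψ).1)).symm
  have hZper : ∀ ψ, Z (ψ + 2 * π) = Z ψ := fun ψ => by simp only [hZ, Circle.exp_add, Circle.exp_two_pi, mul_one]
  have hΨadd : ∀ ψ, Ψ (ψ + 2 * π) = Ψ ψ + 2 * π := fun ψ => by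
    simp only [hΨ]; rw [hZper, angleFrom_add_two_pi]
  have hΨ3 : ∀ ψ, Ψ (Ψ (Ψ ψ)) = ψ + 2 * π := fun ψ => by
    have h1 := hspec ψ
    have h2 := hspec (Ψ ψ)
    have h3 := hspec (Ψ (Ψ ψ))
    -- The three turns lie in `(0, π)` and add up to a multiple of `2π`, which can only be `2π`.
    apply eq_of_unitDir_eq
    · rw [unitDir_add_two_pi]
      have h4 : Z (Ψ (Ψ (Ψ ψ))) = Z ψ := by rw [hZΨ, hZΨ, hZΨ, hσ3]
      have h5 := hdZ (Ψ (Ψ (Ψ ψ)))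
      rw [h4, hdZ ψ, norm_smul, norm_unitDir, mul_one, norm_norm] at h5
      exact (smul_right_injective Plane (hlpos (Z ψ)).ne' h5).symm
    · linarith [h1.2.1, h2.2.1, h3.2.1]
    · linarith [h1.2.2, h2.2.2, h3.2.2]
  have hΨc : Continuous Ψ := by
    refine continuous_angleFrom continuous_id ?_ (fun ψ => hd0 _)
    have : Continuous fun z => d (σ z) := hqσ.sub hcσ
    exact this.comp hZc
  have hΨinj : Function.Injective Ψ := fun a b hab => by
    have := hΨ3 a
    rw [hab, hΨ3 b] at this
    linarith
  have hΨmono : StrictMono Ψ := by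
    rcases hΨc.strictMono_of_inj hΨinj with h | h
    · exact h
    · have h1 := h (show (0 : ℝ) < 0 + 2 * π by linarith)
      rw [hΨadd] at h1
      linarith
  have hΨsurj : Function.Surjective Ψ := fun y => ⟨Ψ (Ψ (y - 2 * π)), by rw [hΨ3]; ring⟩
  refine ⟨fun ψ => c (Z ψ), fun ψ => q (Z ψ), fun ψ => ‖d (Z ψ)‖,
    hΨmono.orderIsoOfSurjective Ψ hΨsurj, hc.comp hZc, fun ψ => by simp only [hZper], hΨadd, hΨ3,
    fun ψ => (hspec ψ).2.1, fun ψ => (hspec ψ).2.2, fun ψ => hlpos _, fun ψ => ?_, fun ψ => ?_,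
    fun ψ => (hq _).1, fun ψ z hz => ?_⟩
  · rw [← hdZ]; simp only [hd]; abel
  · change c (Z (Ψ ψ)) = _
    rw [← hdZ, hZΨ, hσ]; simp only [hd, two_smul]; abel
  · have := (hq (Z ψ)).support z hz
    change 0 ≤ areaForm2 (d (Z ψ)) _ at this
    rw [hdZ, areaForm2_smul_left] at this
    exact nonneg_of_mul_nonneg_right this (hlpos _)

namespace IsTangentFamily

variable {Ω : Set Plane} {P Q : ℝ → Plane} {l : ℝ → ℝ} {Ψ : ℝ ≃o ℝ}

/-- The origin lies strictly to the left of the tangent line, and `P ψ`, `Q ψ`, `P (Ψ ψ)` all lie on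
it. -/
theorem areaForm2_pos (h : IsTangentFamily Ω P Q l Ψ) (h0 : (0 : Plane) ∈ interior Ω) (ψ : ℝ) :
    0 < areaForm2 (P ψ) (unitDir ψ) ∧ 0 < areaForm2 (P (Ψ ψ)) (unitDir ψ) := by
  have h1 := areaForm2_pos_of_mem_interior (unitDir_ne_zero ψ) (h.support ψ) h0
  rw [areaForm2_sub_right, areaForm2_zero_right, zero_sub, ← areaForm2_swap] at h1
  have h2 := h1
  rw [h.eq_add, areaForm2_add_left, areaForm2_smul_left, areaForm2_self] at h2
  rw [h.image_eq, areaForm2_add_left, areaForm2_smul_left, areaForm2_self]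
  constructor <;> linarith

/-- The polar angle of `P ψ`. -/
noncomputable def polarAngle (P : ℝ → Plane) (ψ : ℝ) : ℝ := angleFrom (ψ - π) (P ψ)

theorem polarAngle_spec (h : IsTangentFamily Ω P Q l Ψ) (h0 : (0 : Plane) ∈ interior Ω) (ψ : ℝ) :
    P ψ = ‖P ψ‖ • unitDir (polarAngle P ψ) ∧ ψ - π < polarAngle P ψ ∧ polarAngle P ψ < ψ := by
  have h1 : 0 < areaForm2 (unitDir (ψ - π)) (P ψ) := by
    rw [unitDir_sub_pi, areaForm2_neg_left, ← areaForm2_swap]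
    exact (h.areaForm2_pos h0 ψ).1
  obtain ⟨h2, h3, h4⟩ := angleFrom_spec h1
  exact ⟨h2, h3, by unfold polarAngle; linarith⟩

theorem ne_zero (h : IsTangentFamily Ω P Q l Ψ) (h0 : (0 : Plane) ∈ interior Ω) (ψ : ℝ) :
    P ψ ≠ 0 := by
  intro h1
  have := (h.areaForm2_pos h0 ψ).1
  rw [h1, areaForm2_zero_left] at this
  exact lt_irrefl _ this

theorem continuous_polarAngle (h : IsTangentFamily Ω P Q l Ψ) (h0 : (0 : Plane) ∈ interior Ω) :
    Continuous (polarAngle P) :=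
  continuous_angleFrom (by fun_prop) h.continuous (h.ne_zero h0)

theorem polarAngle_add (h : IsTangentFamily Ω P Q l Ψ) (ψ : ℝ) :
    polarAngle P (ψ + 2 * π) = polarAngle P ψ + 2 * π := by
  unfold polarAngle
  rw [h.periodic, ← angleFrom_add_two_pi]
  congr 1; ring

/-- No two members of the family lie on the same ray: along a ray, the direction of the tangent
segment leaving a point increases, and that of the one arriving decreases, with the distance. -/
theorem polarAngle_injective_aux (h : IsTangentFamily Ω P Q l Ψ) (h0 : (0 : Plane) ∈ interior Ω)
    {ψ ψ' : ℝ} (hlt : ψ < ψ') : polarAngle P ψ ≠ polarAngle P ψ' := by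
  intro heq
  obtain ⟨p1, p2, p3⟩ := h.polarAngle_spec h0 ψ
  obtain ⟨q1, q2, q3⟩ := h.polarAngle_spec h0 ψ'
  rw [← heq] at q1 q2 q3
  set φ := polarAngle P ψ
  have x1 : 0 < ‖P ψ‖ := norm_pos_iff.2 (h.ne_zero h0 ψ)
  have x2 : 0 < ‖P ψ'‖ := norm_pos_iff.2 (h.ne_zero h0 ψ')
  have far : ‖P ψ‖ < ‖P ψ'‖ := by
    have h1 := h.support ψ' (Q ψ) (h.mem ψ)
    rw [h.eq_add ψ, h.eq_add ψ', p1, q1, areaForm2_sub_right, areaForm2_add_right,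
      areaForm2_add_right, areaForm2_smul_right, areaForm2_smul_right, areaForm2_smul_right,
      areaForm2_smul_right, areaForm2_self, areaForm2_unitDir, areaForm2_unitDir,
      ← neg_sub ψ' φ, ← neg_sub ψ' ψ, Real.sin_neg, Real.sin_neg] at h1
    have s1 : 0 < Real.sin (ψ' - φ) := sin_sub_pos_of q3 (by linarith)
    have s2 : 0 < Real.sin (ψ' - ψ) := sin_sub_pos_of hlt (by linarith)
    have := mul_pos (h.pos ψ) s2
    by_contra hcon
    push Not at hcon
    nlinarith [mul_le_mul_of_nonneg_right hcon s1.le]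
  set χ := Ψ.symm ψ with hχ
  set χ' := Ψ.symm ψ' with hχ'
  have eχ : Ψ χ = ψ := Ψ.apply_symm_apply ψ
  have eχ' : Ψ χ' = ψ' := Ψ.apply_symm_apply ψ'
  have hχlt : χ < χ' := Ψ.symm.strictMono hlt
  -- The segment arriving at `P ψ` has direction `Ψ.symm ψ`; with the origin on its left, this
  -- direction lies in `(φ, φ + π)`.
  have arrive : ∀ χ ψ, Ψ χ = ψ → φ < ψ → ψ - π < φ → P ψ = ‖P ψ‖ • unitDir φ → 0 < ‖P ψ‖ →
      0 < Real.sin (χ - φ) ∧ φ < χ ∧ χ < φ + π := by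
    intro χ ψ e k1 k2 k3 k4
    have h1 := (h.areaForm2_pos h0 χ).2
    rw [e, k3, areaForm2_smul_left, areaForm2_unitDir] at h1
    have h2 : 0 < Real.sin (χ - φ) := pos_of_mul_pos_right h1 k4.le
    have h3 := h.lt_map χ
    have h4 := h.map_lt χ
    rw [e] at h3 h4
    refine ⟨h2, ?_, by linarith⟩
    by_contra hcon
    push Not at hcon
    have := Real.sin_nonpos_of_nonpos_of_neg_pi_le (x := χ - φ) (by linarith) (by linarith)
    linarith
  obtain ⟨a1, a2, a3⟩ := arrive χ ψ eχ p3 p2 p1 x1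
  obtain ⟨b1, b2, b3⟩ := arrive χ' ψ' eχ' q3 q2 q1 x2
  -- That `Q χ'` lies to the left of the tangent line of direction `χ` would force the farther point
  -- to have the smaller arriving direction, against `χ < χ'`.
  have h1 := h.support χ (Q χ') (h.mem χ')
  have c1 : Q χ = ‖P ψ‖ • unitDir φ - l χ • unitDir χ := by
    rw [← p1, ← eχ, h.image_eq]; abel
  have c2 : Q χ' = ‖P ψ'‖ • unitDir φ - l χ' • unitDir χ' := by
    rw [← q1, ← eχ', h.image_eq]; abel
  rw [c1, c2, areaForm2_sub_right, areaForm2_sub_right, areaForm2_sub_right, areaForm2_smul_right,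
    areaForm2_smul_right, areaForm2_smul_right, areaForm2_smul_right, areaForm2_self,
    areaForm2_unitDir, areaForm2_unitDir, ← neg_sub χ φ, Real.sin_neg] at h1
  have s2 : 0 < Real.sin (χ' - χ) := sin_sub_pos_of hχlt (by linarith)
  nlinarith [mul_pos (h.pos χ') s2, mul_pos (sub_pos.2 far) a1]

theorem strictMono_polarAngle (h : IsTangentFamily Ω P Q l Ψ) (h0 : (0 : Plane) ∈ interior Ω) :
    StrictMono (polarAngle P) := by
  have hinj : Function.Injective (polarAngle P) := by
    intro a b hab
    rcases lt_trichotomy a b with h1 | h1 | h1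
    · exact absurd hab (h.polarAngle_injective_aux h0 h1)
    · exact h1
    · exact absurd hab.symm (h.polarAngle_injective_aux h0 h1)
  rcases (h.continuous_polarAngle h0).strictMono_of_inj hinj with h1 | h1
  · exact h1
  · have h2 := h1 (show (0 : ℝ) < 0 + 2 * π by linarith [Real.pi_pos])
    rw [h.polarAngle_add] at h2
    linarith [Real.pi_pos]

theorem surjective_polarAngle (h : IsTangentFamily Ω P Q l Ψ) (h0 : (0 : Plane) ∈ interior Ω) :
    Function.Surjective (polarAngle P) := by
  refine (h.continuous_polarAngle h0).surjective ?_ ?_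
  · exact tendsto_atTop_mono (fun ψ => (h.polarAngle_spec h0 ψ).2.1.le)
      (tendsto_atTop_add_const_right atTop (-π) tendsto_id)
  · exact tendsto_atBot_mono (fun ψ => (h.polarAngle_spec h0 ψ).2.2.le) tendsto_id

/-- `F` is `Ψ` conjugated by the polar angle, a bijection between tangent directions and rays. The
bound `F φ < φ + π` holds because the origin is to the left of the tangent line, so both ends of the
segment of direction `ψ` have polar angle between `ψ - π` and `ψ`. -/
theorem exists_isRotationalFamily (h : IsTangentFamily Ω P Q l Ψ)
    (h0 : (0 : Plane) ∈ interior Ω) :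
    ∃ (F : ℝ ≃o ℝ) (r : ℝ → ℝ), IsRotationalFamily Ω F r ∧
      ∀ ψ, F (polarAngle P ψ) = polarAngle P (Ψ ψ) ∧ r (polarAngle P ψ) = ‖P ψ‖ := by
  set Φ := (h.strictMono_polarAngle h0).orderIsoOfSurjective _ (h.surjective_polarAngle h0) with hΦ
  have eΦ : ∀ ψ, Φ ψ = polarAngle P ψ := fun ψ => rfl
  have hspec := h.polarAngle_spec h0
  simp only [← eΦ] at hspec ⊢
  set F : ℝ ≃o ℝ := (Φ.symm.trans Ψ).trans Φ with hF
  have eF : ∀ ψ, F (Φ ψ) = Φ (Ψ ψ) := fun ψ => by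
    simp only [hF, OrderIso.trans_apply, OrderIso.symm_apply_apply]
  have hadd : ∀ ψ, Φ (ψ + 2 * π) = Φ ψ + 2 * π := h.polarAngle_add
  have hr : ∀ ψ, ‖P (Φ.symm (Φ ψ))‖ = ‖P ψ‖ := fun ψ => by rw [OrderIso.symm_apply_apply]
  refine ⟨F, fun φ => ‖P (Φ.symm φ)‖, ⟨(h.continuous.comp Φ.symm.continuous).norm,
    ?_, ?_, ?_, ?_, ?_, ?_⟩, fun ψ => ⟨eF ψ, hr ψ⟩⟩ <;> intro φ <;>
    obtain ⟨ψ, rfl⟩ := Φ.surjective φ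
  · rw [← hadd, hr, hr, h.periodic]
  · rw [← hadd, eF, eF, h.map_add, hadd]
  · rw [eF, eF, eF, h.cube, hadd]
  · rw [eF]; exact Φ.strictMono (h.lt_map ψ)
  · rw [eF]
    have h1 := (hspec (Ψ ψ)).2.2
    have h2 := (hspec ψ).2.1
    have hmono : Φ (Ψ ψ) < Φ (ψ + π) := Φ.strictMono (h.map_lt ψ)
    have h3 : Φ (Ψ ψ) < ψ := by
      by_contra hcon
      push Not at hcon
      have h4 := (h.areaForm2_pos h0 ψ).2
      rw [(hspec (Ψ ψ)).1, areaForm2_smul_left, areaForm2_unitDir] at h4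
      have h5 : 0 < Real.sin (ψ - Φ (Ψ ψ)) := pos_of_mul_pos_right h4 (norm_nonneg _)
      have h6 := Real.sin_nonpos_of_nonpos_of_neg_pi_le (x := ψ - Φ (Ψ ψ)) (by linarith)
        (by linarith [h.map_lt ψ])
      linarith
    linarith
  · rw [eF, hr, hr]
    have e1 : ‖P ψ‖ • unitDir (Φ ψ) = P ψ := (hspec ψ).1.symm
    have e2 : ‖P (Ψ ψ)‖ • unitDir (Φ (Ψ ψ)) = P (Ψ ψ) := (hspec (Ψ ψ)).1.symm
    refine ⟨norm_pos_iff.2 (h.ne_zero h0 _), norm_pos_iff.2 (h.ne_zero h0 _), ?_⟩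
    simp only
    rw [e1, e2]
    have hm : midpoint ℝ (P ψ) (P (Ψ ψ)) = Q ψ := by
      rw [h.image_eq, h.eq_add, midpoint_eq_smul_add, invOf_eq_inv]
      module
    rw [hm]
    refine isTangencyPoint_of_support (h.mem ψ) fun z hz => ?_
    have : Q ψ - P ψ = l ψ • unitDir ψ := by rw [h.eq_add]; abel
    rw [this, areaForm2_smul_left]
    exact mul_nonneg (h.pos ψ).le (h.support ψ z hz)

/-- The points `Q` are the midpoints of the sides of the orbit triangle, whose side of direction `ψ`
has length `2 * l ψ`; the parallel side of the medial triangle is half of it. -/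
theorem sub_eq (h : IsTangentFamily Ω P Q l Ψ) (ψ : ℝ) :
    Q (Ψ ψ) - Q (Ψ (Ψ ψ)) = l ψ • unitDir ψ := by
  have h0 := h.image_eq ψ
  have h1 := h.image_eq (Ψ ψ)
  have h2 := h.image_eq (Ψ (Ψ ψ))
  have e0 := h.eq_add ψ
  have e1 := h.eq_add (Ψ ψ)
  have e2 := h.eq_add (Ψ (Ψ ψ))
  rw [h.cube, h.periodic] at h2
  have key : (2 : ℝ) • (Q (Ψ ψ) - Q (Ψ (Ψ ψ))) = (2 : ℝ) • (l ψ • unitDir ψ) := by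
    have a0 : (2 : ℝ) • Q ψ = P ψ + P (Ψ ψ) := by rw [h0, two_smul]; nth_rewrite 1 [e0]; abel
    have a1 : (2 : ℝ) • Q (Ψ ψ) = P (Ψ ψ) + P (Ψ (Ψ ψ)) := by
      rw [h1, two_smul]; nth_rewrite 1 [e1]; abel
    have a2 : (2 : ℝ) • Q (Ψ (Ψ ψ)) = P (Ψ (Ψ ψ)) + P ψ := by
      rw [h2, two_smul]; nth_rewrite 1 [e2]; abel
    have a3 : (2 : ℝ) • (l ψ • unitDir ψ) = (2 : ℝ) • Q ψ - (2 : ℝ) • P ψ := by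
      rw [e0]; module
    rw [smul_sub, a1, a2, a3, a0, two_smul]; abel
  exact smul_right_injective Plane (two_ne_zero' ℝ) key

theorem periodic_Q (h : IsTangentFamily Ω P Q l Ψ) (ψ : ℝ) : Q (ψ + 2 * π) = Q ψ := by
  have k3 := h.image_eq (ψ + 2 * π)
  rw [h.map_add, h.periodic, h.eq_add, h.periodic, unitDir_add_two_pi, h.image_eq, h.eq_add] at k3
  have k5 : (2 * l ψ) • unitDir ψ = (2 * l (ψ + 2 * π)) • unitDir ψ := by
    have k6 : P ψ + (2 * l ψ) • unitDir ψ = P ψ + (2 * l (ψ + 2 * π)) • unitDir ψ := by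
      rw [two_mul, two_mul, add_smul, add_smul, ← add_assoc, ← add_assoc]; exact k3
    exact add_left_cancel k6
  have k7 := smul_left_injective ℝ (unitDir_ne_zero ψ) k5
  rw [h.eq_add, h.periodic, unitDir_add_two_pi, h.eq_add,
    show l (ψ + 2 * π) = l ψ by linarith]

theorem isCriticalTriangle (h : IsTangentFamily Ω P Q l Ψ) (ψ : ℝ) :
    IsCriticalTriangle Ω (Q ψ) (Q (Ψ ψ)) (Q (Ψ (Ψ ψ))) := by
  have supp : ∀ ψ z, z ∈ Ω → 0 ≤ areaForm2 (l ψ • unitDir ψ) (z - Q ψ) := fun ψ z hz => by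
    rw [areaForm2_smul_left]; exact mul_nonneg (h.pos ψ).le (h.support ψ z hz)
  refine ⟨h.mem _, h.mem _, h.mem _, ?_, ?_, ?_⟩
  · rw [h.sub_eq]; exact supp ψ
  · have := h.sub_eq (Ψ ψ)
    rw [h.cube, h.periodic_Q] at this
    rw [this]; exact supp _
  · have := h.sub_eq (Ψ (Ψ ψ))
    rw [h.cube, h.map_add, h.periodic_Q, h.periodic_Q] at this
    rw [this]; exact supp _

end IsTangentFamily

/-! ### The minimal average action as the area of critical triangles. -/

theorem IsBilliardTable.hasMidTangentSegments {Ω : Set Plane} (hΩ : IsBilliardTable Ω) :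
    HasMidTangentSegments Ω := fun _ _ h1 h2 =>
  exists_isMidTangentSegment hΩ.isCompact hΩ.strictConvex.convex hΩ.zero_mem
    (sin_sub_pos_of h1 h2)

/-- The minimal average action of rotation number `1 / 3` is `2 / 3` of twice the area of each
critical inscribed triangle. -/
theorem exists_minimalAverageAction {Ω : Set Plane} (hΩ : IsBilliardTable Ω)
    (hcurve : HasInvariantCurveOfPeriod Ω 3) :
    ∃ β, IsMinimalAverageAction (outerGen Ω) (1 / 3) β ∧
      ∀ a b c, IsCriticalTriangle Ω a b c → b ≠ c → triArea2 a b c = 3 / 2 * β := by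
  obtain ⟨P, Q, l, Ψ, h⟩ := exists_isTangentFamily hΩ hcurve
  have h0 := hΩ.zero_mem
  obtain ⟨F, r, hF, hFr⟩ := h.exists_isRotationalFamily h0
  have hex := hΩ.hasMidTangentSegments
  refine ⟨_, hF.isMinimalAverageAction hex, fun a b c habc hbc => ?_⟩
  -- An arbitrary critical triangle is a member of the family: if `b - c` has direction `ψ`, then
  -- `a` is the contact point `Q ψ`, and `eq_of_parallel` identifies the other two vertices.
  obtain ⟨m, ψ, hm, hψ⟩ := exists_eq_smul_unitDir (sub_ne_zero.2 hbc)
  have hs : ∀ z ∈ Ω, 0 ≤ areaForm2 (unitDir ψ) (z - a) := fun z hz => by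
    have := habc.support₁ z hz
    rw [hψ, areaForm2_smul_left] at this
    exact nonneg_of_mul_nonneg_right this hm
  have ha : a = Q ψ := by
    refine support_unique hΩ.strictConvex (unitDir_ne_zero ψ) (h.support ψ) (h.mem ψ) habc.mem₁
      (le_antisymm ?_ (h.support ψ a habc.mem₁))
    have := hs (Q ψ) (h.mem ψ)
    rw [areaForm2_sub_right] at this ⊢
    linarith
  subst ha
  have hpar : b - c = (m / l ψ) • (Q (Ψ ψ) - Q (Ψ (Ψ ψ))) := by
    rw [h.sub_eq, smul_smul, div_mul_cancel₀ _ (h.pos ψ).ne', hψ]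
  have hne : Q (Ψ ψ) ≠ Q (Ψ (Ψ ψ)) := by
    rw [← sub_ne_zero, h.sub_eq]
    exact smul_ne_zero (h.pos ψ).ne' (unitDir_ne_zero ψ)
  obtain ⟨rfl, rfl⟩ := (h.isCriticalTriangle ψ).eq_of_parallel hΩ.strictConvex habc hne
    (div_pos hm (h.pos ψ)) hpar
  have hsum := hF.orbit_sum hex (IsTangentFamily.polarAngle P ψ)
  rw [show IsTangentFamily.polarAngle P ψ + 2 * π = F (F (F (IsTangentFamily.polarAngle P ψ))) from (hF.cube _).symm,
    hF.outerGen_map, hF.outerGen_map, hF.outerGen_map] at hsum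
  simp only [(hFr _).1, (hFr _).2] at hsum
  have hprod : ∀ x y, ‖P x‖ * ‖P y‖ * Real.sin (IsTangentFamily.polarAngle P y - IsTangentFamily.polarAngle P x) =
      areaForm2 (P x) (P y) := fun x y => by
    conv_rhs => rw [(h.polarAngle_spec h0 x).1, (h.polarAngle_spec h0 y).1]
    rw [areaForm2_smul_left, areaForm2_smul_right, areaForm2_unitDir]; ring
  rw [hprod, hprod, hprod, h.cube, h.periodic] at hsum
  have e1 : P ψ = Q ψ + Q (Ψ (Ψ ψ)) - Q (Ψ ψ) := by
    have := h.sub_eq ψ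
    rw [h.eq_add ψ, ← this]; abel
  have e2 : P (Ψ ψ) = Q ψ + Q (Ψ ψ) - Q (Ψ (Ψ ψ)) := by
    rw [h.image_eq, ← h.sub_eq]; abel
  have e3 : P (Ψ (Ψ ψ)) = Q (Ψ ψ) + Q (Ψ (Ψ ψ)) - Q ψ := by
    have := h.sub_eq (Ψ ψ)
    rw [h.cube, h.periodic_Q] at this
    rw [h.image_eq (Ψ ψ), ← this]; abel
  -- The sum is the doubled area of the orbit triangle, four times that of its medial triangle.
  have key : areaForm2 (P ψ) (P (Ψ ψ)) + areaForm2 (P (Ψ ψ)) (P (Ψ (Ψ ψ))) +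
      areaForm2 (P (Ψ (Ψ ψ))) (P ψ) = 4 * triArea2 (Q ψ) (Q (Ψ ψ)) (Q (Ψ (Ψ ψ))) := by
    rw [e1, e2, e3]
    simp only [triArea2, areaForm2, PiLp.sub_apply, PiLp.add_apply]; ring
  linarith

/-! ### Inscribed triangles of maximal area -/

/-- The triangle `a`, `b`, `c` in `Ω` has the largest area among the triangles in `Ω`. -/
structure IsMaximalTriangle (Ω : Set Plane) (a b c : Plane) : Prop where
  mem₁ : a ∈ Ω
  mem₂ : b ∈ Ω
  mem₃ : c ∈ Ω
  le : ∀ x ∈ Ω, ∀ y ∈ Ω, ∀ z ∈ Ω, triArea2 x y z ≤ triArea2 a b c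

/-- With two vertices fixed the area is affine in the third, so maximality in each vertex is a
support condition. -/
theorem IsMaximalTriangle.isCriticalTriangle {Ω : Set Plane} {a b c : Plane}
    (h : IsMaximalTriangle Ω a b c) : IsCriticalTriangle Ω a b c := by
  refine ⟨h.mem₁, h.mem₂, h.mem₃, fun z hz => ?_, fun z hz => ?_, fun z hz => ?_⟩
  · have := h.le z hz b h.mem₂ c h.mem₃
    simp only [triArea2, areaForm2, PiLp.sub_apply] at this ⊢
    linarith
  · have := h.le a h.mem₁ z hz c h.mem₃
    simp only [triArea2, areaForm2, PiLp.sub_apply] at this ⊢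
    linarith
  · have := h.le a h.mem₁ b h.mem₂ z hz
    simp only [triArea2, areaForm2, PiLp.sub_apply] at this ⊢
    linarith

theorem exists_isMaximalTriangle {Ω : Set Plane} (hc : IsCompact Ω) (hne : Ω.Nonempty) :
    ∃ a b c, IsMaximalTriangle Ω a b c := by
  have hcont : Continuous fun t : Plane × Plane × Plane => triArea2 t.1 t.2.1 t.2.2 := by
    unfold triArea2
    exact Continuous.areaForm2 (by fun_prop) (by fun_prop)
  obtain ⟨x, hx⟩ := hne
  obtain ⟨⟨a, b, c⟩, ⟨ha, hb, hcc⟩, hmax⟩ := (hc.prod (hc.prod hc)).exists_isMaxOn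
    ⟨(x, x, x), hx, hx, hx⟩ hcont.continuousOn
  exact ⟨a, b, c, ha, hb, hcc, fun x hx y hy z hz => hmax (a := (x, y, z)) ⟨hx, hy, hz⟩⟩

theorem IsMaximalTriangle.area_pos {Ω : Set Plane} {a b c : Plane} (h : IsMaximalTriangle Ω a b c)
    (h0 : (0 : Plane) ∈ interior Ω) : 0 < triArea2 a b c := by
  obtain ⟨δ, hδ, h1⟩ := smul_mem_of_zero_mem_interior h0 (unitDir 0)
  obtain ⟨δ', hδ', h2⟩ := smul_mem_of_zero_mem_interior h0 (unitDir (π / 2))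
  have := h.le 0 (interior_subset h0) _ h1 _ h2
  rw [triArea2, sub_zero, sub_zero, areaForm2_smul_left, areaForm2_smul_right, areaForm2_unitDir,
    sub_zero, Real.sin_pi_div_two] at this
  refine lt_of_lt_of_le ?_ this
  positivity

theorem ne_of_triArea2_pos {a b c : Plane} (h : 0 < triArea2 a b c) : b ≠ c := by
  rintro rfl
  rw [triArea2, areaForm2_self] at h
  exact lt_irrefl _ h

/-- At a point of the boundary of a table, there is only one supporting line. -/
theorem IsBilliardTable.support_parallel {Ω : Set Plane} (hΩ : IsBilliardTable Ω)
    {a e e' : Plane} (ha : a ∈ Ω) (he : e ≠ 0) (he' : e' ≠ 0)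
    (h : ∀ z ∈ Ω, 0 ≤ areaForm2 e (z - a)) (h' : ∀ z ∈ Ω, 0 ≤ areaForm2 e' (z - a)) :
    ∃ l : ℝ, 0 < l ∧ e' = l • e := by
  obtain ⟨γ, hγ, -, hγ', -, hrange⟩ := hΩ.boundary
  have hfr : a ∈ frontier Ω := by
    refine ⟨subset_closure ha, fun hi => ?_⟩
    have := areaForm2_pos_of_mem_interior he h hi
    rw [sub_self, areaForm2_zero_right] at this
    exact lt_irrefl _ this
  rw [← hrange] at hfr
  obtain ⟨t, rfl⟩ := hfr
  have hmem : ∀ s, γ s ∈ Ω := fun s => by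
    have : γ s ∈ frontier Ω := hrange ▸ mem_range_self s
    exact hΩ.isCompact.isClosed.frontier_subset this
  have hd : HasDerivAt γ (deriv γ t) t :=
    (hγ.differentiable (by norm_num)).differentiableAt.hasDerivAt
  have hcoord : ∀ i, HasDerivAt (fun s => γ s i) (deriv γ t i) t := fun i =>
    (EuclideanSpace.proj i : Plane →L[ℝ] ℝ).hasFDerivAt.comp_hasDerivAt t hd
  -- A supporting linear form restricted to the boundary curve is minimal at `t`, so it vanishes on
  -- the nonzero tangent vector. Both forms are thus proportional, and the origin in the interior
  -- fixes the sign.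
  have hpar : ∀ e : Plane, (∀ z ∈ Ω, 0 ≤ areaForm2 e (z - γ t)) → areaForm2 e (deriv γ t) = 0 := by
    intro e he
    have h1 : HasDerivAt (fun s => areaForm2 e (γ s - γ t)) (areaForm2 e (deriv γ t)) t := by
      simp only [areaForm2, PiLp.sub_apply]
      exact (((hcoord 1).sub_const _).const_mul _).sub (((hcoord 0).sub_const _).const_mul _)
    have hmin : IsLocalMin (fun s => areaForm2 e (γ s - γ t)) t :=
      Eventually.of_forall fun s => by
        simp only [sub_self, areaForm2_zero_right]
        exact he _ (hmem s)
    exact hmin.hasDerivAt_eq_zero h1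
  have k1 := hpar e h
  have k2 := hpar e' h'
  have hv : deriv γ t ≠ 0 := hγ' t
  set v := deriv γ t
  have hee : areaForm2 e e' = 0 := by
    simp only [areaForm2] at k1 k2 ⊢
    by_contra hcon
    apply hv
    apply plane_ext
    · have : (e 0 * e' 1 - e 1 * e' 0) * v 0 = 0 := by linear_combination e' 0 * k1 - e 0 * k2
      exact (mul_eq_zero.1 this).resolve_left hcon
    · have : (e 0 * e' 1 - e 1 * e' 0) * v 1 = 0 := by linear_combination e' 1 * k1 - e 1 * k2
      exact (mul_eq_zero.1 this).resolve_left hcon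
  have hk : ∃ k : ℝ, e' = k • e := by
    have hn : 0 < ‖e‖ ^ 2 := by have := norm_pos_iff.2 he; positivity
    rw [plane_norm_sq] at hn
    refine ⟨(e 0 * e' 0 + e 1 * e' 1) / (e 0 ^ 2 + e 1 ^ 2), ?_⟩
    simp only [areaForm2] at hee
    apply plane_ext
    · rw [PiLp.smul_apply, smul_eq_mul, div_mul_eq_mul_div, eq_div_iff hn.ne']
      linear_combination (-e 1) * hee
    · rw [PiLp.smul_apply, smul_eq_mul, div_mul_eq_mul_div, eq_div_iff hn.ne']
      linear_combination e 0 * hee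
  obtain ⟨k, hk⟩ := hk
  refine ⟨k, ?_, hk⟩
  have p1 := areaForm2_pos_of_mem_interior he h hΩ.zero_mem
  have p2 := areaForm2_pos_of_mem_interior he' h' hΩ.zero_mem
  rw [hk, areaForm2_smul_left] at p2
  exact pos_of_mul_pos_left p2 p1.le

/-! ### A convex region as the region between two graphs -/

/-- The vector with given coordinates. -/
noncomputable def mkVec (x y : ℝ) : Plane := !₂[x, y]

theorem vec_zero (x y : ℝ) : mkVec x y 0 = x := rfl

theorem vec_one (x y : ℝ) : mkVec x y 1 = y := rfl

theorem eq_vec (z : Plane) : z = mkVec (z 0) (z 1) := plane_ext rfl rfl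

/-- The upper (`σ = 1`) or lower (`σ = -1`) boundary function of a compact convex set. -/
theorem exists_boundary_function {K : Set Plane} (hc : IsCompact K) (hK : Convex ℝ K) {A B σ : ℝ}
    (hAB : A < B) (hproj : (fun z : Plane => z 0) '' K = Icc A B) (hσ : σ * σ = 1) :
    ∃ f : ℝ → ℝ, ContinuousOn f (Icc A B) ∧
      ∀ x ∈ Icc A B, mkVec x (f x) ∈ K ∧ ∀ z ∈ K, z 0 = x → σ * z 1 ≤ σ * f x := by
  have hex : ∀ x, ∃ y, x ∈ Icc A B → mkVec x y ∈ K ∧ ∀ z ∈ K, z 0 = x → σ * z 1 ≤ σ * y := by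
    intro x
    by_cases hx : x ∈ Icc A B
    · rw [← hproj] at hx
      obtain ⟨w, hw, hwx⟩ := hx
      have hcl : IsClosed {z : Plane | z 0 = x} := isClosed_eq (by fun_prop) continuous_const
      obtain ⟨q, ⟨hq, hqx⟩, hmax⟩ := (hc.inter_right hcl).exists_isMaxOn ⟨w, hw, hwx⟩
        (f := fun z : Plane => σ * z 1) (by fun_prop)
      refine ⟨q 1, fun _ => ⟨?_, fun z hz hzx => hmax ⟨hz, hzx⟩⟩⟩
      have hqx' : q 0 = x := hqx
      rw [← hqx', ← eq_vec]; exact hq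
    · exact ⟨0, fun h => absurd h hx⟩
  choose f hf using hex
  refine ⟨f, ?_, hf⟩
  have hcont : ContinuousOn (fun x => σ * f x) (Icc A B) := by
    intro x₀ hx₀
    refine tendsto_order.2 ⟨fun y hy => ?_, fun y hy => ?_⟩
    -- Lower semicontinuity of `σ * f`, at the ends of the interval too: by convexity the chords
    -- from `x₀` to `A` and to `B` lie below it.
    · set k₁ := |σ * f B - σ * f x₀| / (B - x₀) with hk₁
      set k₂ := |σ * f A - σ * f x₀| / (x₀ - A) with hk₂
      have hk₁0 : 0 ≤ k₁ := div_nonneg (abs_nonneg _) (sub_nonneg.2 hx₀.2)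
      have hk₂0 : 0 ≤ k₂ := div_nonneg (abs_nonneg _) (sub_nonneg.2 hx₀.1)
      have hlow : ∀ x ∈ Icc A B, σ * f x₀ - (k₁ + k₂) * |x - x₀| ≤ σ * f x := by
        intro x hx
        have chord : ∀ e ∈ Icc A B, ∀ s ∈ Icc (0 : ℝ) 1, x = x₀ + s * (e - x₀) →
            σ * f x₀ - s * |σ * f e - σ * f x₀| ≤ σ * f x := by
          intro e he s hs hxe
          have hmem := hK.add_smul_sub_mem (hf x₀ hx₀).1 (hf e he).1 hs
          have := (hf x hx).2 _ hmem (by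
            simp only [PiLp.add_apply, PiLp.smul_apply, PiLp.sub_apply, vec_zero, smul_eq_mul]
            exact hxe.symm)
          simp only [PiLp.add_apply, PiLp.smul_apply, PiLp.sub_apply, vec_one, smul_eq_mul] at this
          have h2 := mul_le_mul_of_nonneg_left (neg_abs_le (σ * f e - σ * f x₀)) hs.1
          linarith
        rcases lt_trichotomy x x₀ with hlt | heq | hgt
        · have hpos : 0 < x₀ - A := by linarith [hx.1]
          have := chord A (left_mem_Icc.2 hAB.le) ((x₀ - x) / (x₀ - A))
            ⟨div_nonneg (by linarith) hpos.le, (div_le_one hpos).2 (by linarith [hx.1])⟩ (by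
              field_simp; ring)
          have e : (x₀ - x) / (x₀ - A) * |σ * f A - σ * f x₀| = k₂ * |x - x₀| := by
            rw [abs_of_neg (sub_neg.2 hlt), hk₂]; ring
          rw [e] at this
          linarith [mul_nonneg hk₁0 (abs_nonneg (x - x₀))]
        · subst heq; simp
        · have hpos : 0 < B - x₀ := by linarith [hx.2]
          have := chord B (right_mem_Icc.2 hAB.le) ((x - x₀) / (B - x₀))
            ⟨div_nonneg (by linarith) hpos.le, (div_le_one hpos).2 (by linarith [hx.2])⟩ (by
              field_simp; ring)
          have e : (x - x₀) / (B - x₀) * |σ * f B - σ * f x₀| = k₁ * |x - x₀| := by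
            rw [abs_of_pos (sub_pos.2 hgt), hk₁]; ring
          rw [e] at this
          linarith [mul_nonneg hk₂0 (abs_nonneg (x - x₀))]
      have hev : ∀ᶠ x in 𝓝[Icc A B] x₀, y < σ * f x₀ - (k₁ + k₂) * |x - x₀| := by
        apply (ContinuousAt.eventually_lt (by fun_prop) (by fun_prop) (by simpa)).filter_mono
          nhdsWithin_le_nhds
      filter_upwards [hev, self_mem_nhdsWithin] with x h1 h2
      exact h1.trans_le (hlow x h2)
    -- Upper semicontinuity: the part of `K` with `y ≤ σ * z 1` is compact, so its projection is
    -- closed and misses `x₀`.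
    · have hcl : IsClosed {z : Plane | y ≤ σ * z 1} := isClosed_le continuous_const (by fun_prop)
      have hcomp : IsClosed ((fun z : Plane => z 0) '' (K ∩ {z : Plane | y ≤ σ * z 1})) :=
        ((hc.inter_right hcl).image (by fun_prop)).isClosed
      have hx₀' : x₀ ∈ ((fun z : Plane => z 0) '' (K ∩ {z : Plane | y ≤ σ * z 1}))ᶜ := by
        rintro ⟨z, ⟨hz, hzy⟩, hzx⟩
        have := (hf x₀ hx₀).2 z hz hzx
        exact absurd (le_trans hzy this) (not_le.2 hy)
      filter_upwards [mem_nhdsWithin_of_mem_nhds (hcomp.isOpen_compl.mem_nhds hx₀'),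
        self_mem_nhdsWithin] with x h1 h2
      by_contra hcon
      push Not at hcon
      exact h1 ⟨_, ⟨(hf x h2).1, hcon⟩, rfl⟩
  have : f = fun x => σ * (σ * f x) := by
    funext x; rw [← mul_assoc, hσ, one_mul]
  rw [this]
  exact continuousOn_const.mul hcont

theorem volume_real_eq_integral {K : Set Plane} (hc : IsCompact K) (hK : Convex ℝ K) {A B : ℝ}
    (hAB : A < B) (hproj : (fun z : Plane => z 0) '' K = Icc A B) {f g : ℝ → ℝ}
    (hf : ContinuousOn f (Icc A B)) (hg : ContinuousOn g (Icc A B))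
    (hfK : ∀ x ∈ Icc A B, mkVec x (f x) ∈ K ∧ ∀ z ∈ K, z 0 = x → 1 * z 1 ≤ 1 * f x)
    (hgK : ∀ x ∈ Icc A B, mkVec x (g x) ∈ K ∧ ∀ z ∈ K, z 0 = x → -1 * z 1 ≤ -1 * g x) :
    volume.real K = ∫ x in A..B, (f x - g x) := by
  set K' : Set (ℝ × ℝ) := {p | mkVec p.1 p.2 ∈ K} with hK'
  have hvec : Continuous fun p : ℝ × ℝ => mkVec p.1 p.2 := by unfold mkVec; fun_prop
  have hmeas : MeasurableSet K' := (hc.isClosed.preimage hvec).measurableSet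
  have hvol : volume K = volume K' := by
    have h1 := (PiLp.volume_preserving_toLp (Fin 2)).measure_preimage
      hc.isClosed.measurableSet.nullMeasurableSet
    have h2 := (volume_preserving_finTwoArrow ℝ).measure_preimage hmeas.nullMeasurableSet
    rw [← h1, ← h2]
    congr 1
    ext v
    simp only [mem_preimage, hK', mem_ofPred_eq]
    have : mkVec (MeasurableEquiv.finTwoArrow v).1 (MeasurableEquiv.finTwoArrow v).2 =
      WithLp.toLp 2 v := plane_ext rfl rfl
    rw [this]
  have hslice : ∀ x, volume (Prod.mk x ⁻¹' K') =
      (Icc A B).indicator (fun x => ENNReal.ofReal (f x - g x)) x := by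
    intro x
    by_cases hx : x ∈ Icc A B
    · rw [indicator_of_mem hx, ← Real.volume_Icc]
      congr 1
      ext y
      simp only [mem_preimage, hK', mem_ofPred_eq, mem_Icc]
      constructor
      · intro hy
        have h1 := (hfK x hx).2 _ hy rfl
        have h2 := (hgK x hx).2 _ hy rfl
        rw [vec_one] at h1 h2
        constructor <;> linarith
      · rintro ⟨h1, h2⟩
        rcases h1.eq_or_lt with rfl | h1
        · exact (hgK x hx).1
        · have hpos : 0 < f x - g x := by linarith
          have hmem := hK.add_smul_sub_mem (hgK x hx).1 (hfK x hx).1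
            (t := (y - g x) / (f x - g x)) ⟨div_nonneg (by linarith) hpos.le,
              (div_le_one hpos).2 (by linarith)⟩
          convert hmem using 1
          apply plane_ext
          · simp only [PiLp.add_apply, PiLp.smul_apply, PiLp.sub_apply, vec_zero, sub_self, smul_zero,
              add_zero]
          · simp only [PiLp.add_apply, PiLp.smul_apply, PiLp.sub_apply, vec_one, smul_eq_mul]
            field_simp; ring
    · rw [indicator_of_notMem hx]
      have : Prod.mk x ⁻¹' K' = ∅ := by
        ext y
        simp only [mem_preimage, hK', mem_ofPred_eq, mem_empty_iff_false, iff_false]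
        intro hy
        exact hx (hproj ▸ ⟨_, hy, rfl⟩)
      rw [this, measure_empty]
  have hnn : ∀ x ∈ Icc A B, 0 ≤ f x - g x := fun x hx => by
    have := (hfK x hx).2 _ (hgK x hx).1 rfl
    rw [vec_one] at this
    linarith
  rw [measureReal_def, hvol, Measure.volume_eq_prod, Measure.prod_apply hmeas,
    lintegral_congr hslice, lintegral_indicator measurableSet_Icc,
    intervalIntegral.integral_of_le hAB.le, ← integral_Icc_eq_integral_Ioc,
    integral_eq_lintegral_of_nonneg_ae ((ae_restrict_iff' measurableSet_Icc).2
      (Eventually.of_forall hnn)) ((hf.sub hg).aestronglyMeasurable measurableSet_Icc)]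

/-! ### The inscribed triangles of Sas -/

theorem cos_add_third (t : ℝ) : Real.cos (t + 2 * π / 3) = -Real.cos t / 2 - √3 / 2 * Real.sin t := by
  rw [show t + 2 * π / 3 = t + (π - π / 3) by ring, Real.cos_add, Real.cos_pi_sub, Real.sin_pi_sub,
    Real.cos_pi_div_three, Real.sin_pi_div_three]; ring

theorem sin_add_third (t : ℝ) : Real.sin (t + 2 * π / 3) = -Real.sin t / 2 + √3 / 2 * Real.cos t := by
  rw [show t + 2 * π / 3 = t + (π - π / 3) by ring, Real.sin_add, Real.cos_pi_sub, Real.sin_pi_sub,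
    Real.cos_pi_div_three, Real.sin_pi_div_three]; ring

theorem sqrt_three_mul_self : √3 * √3 = 3 := Real.mul_self_sqrt (by norm_num)

theorem integral_comp_cos {f : ℝ → ℝ} {m ρ a b : ℝ} (hρ : 0 < ρ)
    (hf : ContinuousOn f (Icc (m - ρ) (m + ρ))) :
    ρ * ∫ t in a..b, f (m + ρ * Real.cos t) * Real.sin t =
      -∫ x in (m + ρ * Real.cos a)..(m + ρ * Real.cos b), f x := by
  have := intervalIntegral.integral_comp_mul_deriv' (a := a) (b := b)
    (f := fun t => m + ρ * Real.cos t) (f' := fun t => ρ * -Real.sin t) (g := f)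
    (fun t _ => ((Real.hasDerivAt_cos t).const_mul ρ).const_add m) (by fun_prop)
    (hf.mono (by
      rintro _ ⟨t, -, rfl⟩
      have h1 := Real.neg_one_le_cos t
      have h2 := Real.cos_le_one t
      constructor <;> nlinarith))
  rw [← this, ← intervalIntegral.integral_const_mul, ← intervalIntegral.integral_neg]
  congr 1
  funext t
  simp only [Function.comp]; ring

/-- A closed curve around the boundary of `K`, whose abscissa is a cosine. The triangles inscribed
in it at equal distances of the parameter have mean area proportional to the area of `K`. -/
theorem exists_sas_curve {K : Set Plane} (hc : IsCompact K) (hsc : StrictConvex ℝ K)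
    (hi : (interior K).Nonempty) :
    ∃ (m ρ : ℝ) (R : ℝ → Plane), 0 < ρ ∧ (∀ t, R t ∈ K) ∧ (∀ t, R t 0 = m + ρ * Real.cos t) ∧
      (∀ z ∈ K, |z 0 - m| ≤ ρ) ∧
      (∀ a ∈ K, a ∉ interior K → ∃ t ∈ Icc 0 (2 * π), R t = a) ∧
      Continuous (fun t => triArea2 (R t) (R (t + 2 * π / 3)) (R (t + 2 * π / 3 + 2 * π / 3))) ∧
      ∫ t in (0 : ℝ)..(2 * π), triArea2 (R t) (R (t + 2 * π / 3)) (R (t + 2 * π / 3 + 2 * π / 3)) =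
        3 * √3 * volume.real K := by
  have hK := hsc.convex
  have hpi := Real.pi_pos
  obtain ⟨w, hw⟩ := hi
  have hne : K.Nonempty := ⟨w, interior_subset hw⟩
  obtain ⟨a, ha, hamin⟩ := hc.exists_isMinOn hne (f := fun z : Plane => z 0) (by fun_prop)
  obtain ⟨b, hb, hbmax⟩ := hc.exists_isMaxOn hne (f := fun z : Plane => z 0) (by fun_prop)
  set A := a 0 with hA
  set B := b 0 with hB
  have hmin : ∀ z ∈ K, A ≤ z 0 := fun z hz => hamin hz
  have hmax : ∀ z ∈ K, z 0 ≤ B := fun z hz => hbmax hz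
  have hint : ∀ z ∈ interior K, A < z 0 ∧ z 0 < B := by
    intro z hz
    have e1 : ∀ x : Plane, areaForm2 (mkVec 0 (-1)) x = x 0 := fun x => by
      simp [areaForm2, vec_zero, vec_one]
    have e2 : ∀ x : Plane, areaForm2 (mkVec 0 1) x = -x 0 := fun x => by
      simp [areaForm2, vec_zero, vec_one]
    have n1 : mkVec 0 (-1) ≠ 0 := fun h => by
      have := congrArg (fun v : Plane => v 1) h
      simp [mkVec] at this
    have n2 : mkVec 0 1 ≠ 0 := fun h => by
      have := congrArg (fun v : Plane => v 1) h
      simp [mkVec] at this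
    have h1 := areaForm2_pos_of_mem_interior (q := a) n1 (fun x hx => by
      rw [e1, PiLp.sub_apply]; linarith [hmin x hx]) hz
    have h2 := areaForm2_pos_of_mem_interior (q := b) n2 (fun x hx => by
      rw [e2, PiLp.sub_apply]; linarith [hmax x hx]) hz
    rw [e1, PiLp.sub_apply] at h1
    rw [e2, PiLp.sub_apply] at h2
    constructor <;> linarith
  have hAB : A < B := (hint w hw).1.trans (hint w hw).2
  have hproj : (fun z : Plane => z 0) '' K = Icc A B := by
    apply Subset.antisymm
    · rintro _ ⟨z, hz, rfl⟩
      exact ⟨hmin z hz, hmax z hz⟩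
    · have hpre : IsPreconnected ((fun z : Plane => z 0) '' K) :=
        hK.isPreconnected.image _ (by fun_prop)
      exact hpre.Icc_subset ⟨a, ha, rfl⟩ ⟨b, hb, rfl⟩
  obtain ⟨f, hf, hfK⟩ := exists_boundary_function hc hK (σ := 1) hAB hproj (by norm_num)
  obtain ⟨g, hg, hgK⟩ := exists_boundary_function hc hK (σ := -1) hAB hproj (by norm_num)
  have hvol := volume_real_eq_integral hc hK hAB hproj hf hg hfK hgK
  set m := (A + B) / 2 with hm
  set ρ := (B - A) / 2 with hρdef
  have hρ : 0 < ρ := by rw [hρdef]; linarith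
  have eA : m - ρ = A := by rw [hm, hρdef]; ring
  have eB : m + ρ = B := by rw [hm, hρdef]; ring
  set X : ℝ → ℝ := fun t => m + ρ * Real.cos t with hX
  have hXmem : ∀ t, X t ∈ Icc A B := fun t => by
    have h1 := Real.neg_one_le_cos t
    have h2 := Real.cos_le_one t
    rw [← eA, ← eB]
    constructor <;> simp only [hX] <;> nlinarith
  have hXc : Continuous X := by fun_prop
  have hfX : Continuous fun t => f (X t) := hf.comp_continuous hXc hXmem
  have hgX : Continuous fun t => g (X t) := hg.comp_continuous hXc hXmem
  set Y : ℝ → ℝ := fun t => if 0 ≤ Real.sin t then f (X t) else g (X t) with hY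
  -- `W` equals `Y t * sin t`; written with `max` and `min` it is continuous without comparing `f`
  -- and `g` at the zeros of the sine.
  set W : ℝ → ℝ := fun t => f (X t) * max (Real.sin t) 0 + g (X t) * min (Real.sin t) 0 with hW
  have hWc : Continuous W := by
    simp only [hW]
    exact (hfX.mul (Real.continuous_sin.max continuous_const)).add
      (hgX.mul (Real.continuous_sin.min continuous_const))
  have hWY : ∀ t, Y t * Real.sin t = W t := fun t => by
    simp only [hY, hW]
    split_ifs with h
    · rw [max_eq_left h, min_eq_right h]; ring
    · push Not at h
      rw [max_eq_right h.le, min_eq_left h.le]; ring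
  set R : ℝ → Plane := fun t => mkVec (X t) (Y t) with hR
  -- The doubled area is the sum of the ordinates, each times the difference of the other two
  -- abscissas; for abscissas `m + ρ cos` at thirds of a turn this difference is `√3 ρ sin`.
  have harea : ∀ t, triArea2 (R t) (R (t + 2 * π / 3)) (R (t + 2 * π / 3 + 2 * π / 3)) =
      √3 * ρ * (W t + W (t + 2 * π / 3) + W (t + 2 * π / 3 + 2 * π / 3)) := by
    intro t
    rw [← hWY, ← hWY, ← hWY]
    simp only [triArea2, areaForm2, PiLp.sub_apply, hR, vec_zero, vec_one, hX]
    rw [cos_add_third (t + 2 * π / 3), sin_add_third (t + 2 * π / 3), cos_add_third t,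
      sin_add_third t]
    have h3 := sqrt_three_mul_self
    generalize √3 = s at *
    linear_combination ρ * (-Y t * Real.cos t / 4 - Y (t + 2 * π / 3) * Real.cos t / 4 +
      Y (t + 2 * π / 3 + 2 * π / 3) * (Real.cos t / 2 + s * Real.sin t / 4)) * h3
  have hWper : Function.Periodic W (2 * π) := fun t => by
    simp only [hW, hX, Real.cos_add_two_pi, Real.sin_add_two_pi]
  have hWint : ρ * ∫ t in (0 : ℝ)..(2 * π), W t = volume.real K := by
    have i1 := integral_comp_cos (a := 0) (b := π) hρ (by rwa [eA, eB] : ContinuousOn f _)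
    have i2 := integral_comp_cos (a := π) (b := 2 * π) hρ (by rwa [eA, eB] : ContinuousOn g _)
    rw [Real.cos_zero, Real.cos_pi, mul_one, mul_neg_one, ← sub_eq_add_neg, eA, eB,
      intervalIntegral.integral_symm A B, neg_neg] at i1
    rw [Real.cos_two_pi, Real.cos_pi, mul_one, mul_neg_one, ← sub_eq_add_neg, eA, eB] at i2
    have j1 : ∫ t in (0 : ℝ)..π, W t = ∫ t in (0 : ℝ)..π, f (m + ρ * Real.cos t) * Real.sin t := by
      apply intervalIntegral.integral_congr
      intro t ht
      rw [uIcc_of_le hpi.le] at ht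
      have h := Real.sin_nonneg_of_mem_Icc ht
      simp only [hW]
      rw [max_eq_left h, min_eq_right h]; ring
    have j2 : ∫ t in π..(2 * π), W t = ∫ t in π..(2 * π), g (m + ρ * Real.cos t) * Real.sin t := by
      apply intervalIntegral.integral_congr
      intro t ht
      rw [uIcc_of_le (by linarith)] at ht
      have h : Real.sin t ≤ 0 := by
        rw [← Real.sin_sub_two_pi]
        exact Real.sin_nonpos_of_nonpos_of_neg_pi_le (by linarith [ht.2]) (by linarith [ht.1])
      simp only [hW]
      rw [max_eq_right h, min_eq_left h]; ring
    rw [← intervalIntegral.integral_add_adjacent_intervals (hWc.intervalIntegrable 0 π)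
      (hWc.intervalIntegrable π (2 * π)), j1, j2, mul_add, i1, i2, hvol,
      intervalIntegral.integral_sub]
    · ring
    · exact hf.intervalIntegrable_of_Icc hAB.le
    · exact hg.intervalIntegrable_of_Icc hAB.le
  have hshift : ∀ s, ∫ t in (0 : ℝ)..(2 * π), W (t + s) = ∫ t in (0 : ℝ)..(2 * π), W t := fun s => by
    rw [intervalIntegral.integral_comp_add_right, zero_add, add_comm,
      hWper.intervalIntegral_add_eq s 0, zero_add]
  refine ⟨m, ρ, R, hρ, fun t => ?_, fun t => rfl, fun z hz => ?_, fun z hz hzi => ?_, ?_, ?_⟩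
  · simp only [hR, hY]
    split_ifs
    · exact (hfK _ (hXmem t)).1
    · exact (hgK _ (hXmem t)).1
  · rw [abs_le]
    constructor <;> linarith [hmin z hz, hmax z hz]
  · set x := z 0 with hx
    have hxm : x ∈ Icc A B := ⟨hmin z hz, hmax z hz⟩
    have h1 := (hfK x hxm).2 z hz rfl
    have h2 := (hgK x hxm).2 z hz rfl
    have hseg : z 1 = f x ∨ z 1 = g x := by
      by_contra hcon
      push Not at hcon
      have l1 : z 1 < f x := lt_of_le_of_ne (by linarith) hcon.1
      have l2 : g x < z 1 := lt_of_le_of_ne (by linarith) hcon.2.symm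
      apply hzi
      have hne : mkVec x (f x) ≠ mkVec x (g x) := fun h => by
        have := congrArg (fun v : Plane => v 1) h
        simp only [vec_one] at this
        linarith
      have hpos : 0 < f x - g x := by linarith
      have := hsc (hfK x hxm).1 (hgK x hxm).1 hne (a := (z 1 - g x) / (f x - g x))
        (b := (f x - z 1) / (f x - g x)) (div_pos (by linarith) hpos) (div_pos (by linarith) hpos)
        (by field_simp; ring)
      convert this using 1
      apply plane_ext
      · simp only [PiLp.add_apply, PiLp.smul_apply, vec_zero, smul_eq_mul]
        field_simp; ring
      · simp only [PiLp.add_apply, PiLp.smul_apply, vec_one, smul_eq_mul]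
        field_simp; ring
    have c1 : -1 ≤ (x - m) / ρ := by rw [le_div_iff₀ hρ]; linarith [hxm.1]
    have c2 : (x - m) / ρ ≤ 1 := by rw [div_le_iff₀ hρ]; linarith [hxm.2]
    set θ := Real.arccos ((x - m) / ρ) with hθ
    have hcosθ : m + ρ * Real.cos θ = x := by
      rw [hθ, Real.cos_arccos c1 c2]; field_simp; ring
    have hsinθ : 0 ≤ Real.sin θ := by rw [hθ, Real.sin_arccos]; exact Real.sqrt_nonneg _
    have hθ0 : 0 ≤ θ := Real.arccos_nonneg _
    have hθπ : θ ≤ π := Real.arccos_le_pi _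
    have upper : z 1 = f x → ∃ t ∈ Icc 0 (2 * π), R t = z := fun h => by
      refine ⟨θ, ⟨hθ0, by linarith⟩, plane_ext hcosθ ?_⟩
      simp only [hR, hY, vec_one, hX]
      rw [if_pos hsinθ, hcosθ, h]
    rcases hseg with h | h
    · exact upper h
    · have hX' : X (2 * π - θ) = x := by simp only [hX]; rw [Real.cos_two_pi_sub, hcosθ]
      rcases hsinθ.eq_or_lt with h0 | h0
      -- Here `x` is an end of the projection. If `f x` and `g x` differed, their midpoint would be
      -- interior by strict convexity, but interior points project strictly between `A` and `B`.
      · have hfg : f x = g x := by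
          by_contra hne'
          have hne : mkVec x (f x) ≠ mkVec x (g x) := fun h => hne' (by
            simpa only [vec_one] using congrArg (fun v : Plane => v 1) h)
          have hmid := hint _ (hsc (hfK x hxm).1 (hgK x hxm).1 hne (a := 1 / 2) (b := 1 / 2)
            (by norm_num) (by norm_num) (by norm_num))
          simp only [PiLp.add_apply, PiLp.smul_apply, vec_zero, smul_eq_mul] at hmid
          have hcos : Real.cos θ = 1 ∨ Real.cos θ = -1 := by
            have := Real.sin_sq_add_cos_sq θ
            rw [← h0] at this
            rw [zero_pow two_ne_zero, zero_add] at this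
            exact sq_eq_one_iff.1 this
          rcases hcos with h5 | h5 <;> rw [h5] at hcosθ <;> linarith [hmid.1, hmid.2]
        exact upper (h.trans hfg.symm)
      · refine ⟨2 * π - θ, ⟨by linarith, by linarith⟩, plane_ext hX' ?_⟩
        have hneg : ¬ 0 ≤ Real.sin (2 * π - θ) := by rw [Real.sin_two_pi_sub]; linarith
        simp only [hR, hY, vec_one]
        rw [if_neg hneg, hX', h]
  · simp only [harea]
    fun_prop
  · simp only [harea]
    rw [intervalIntegral.integral_const_mul, intervalIntegral.integral_add,
      intervalIntegral.integral_add, hshift]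
    · have e : ∀ t : ℝ, t + 2 * π / 3 + 2 * π / 3 = t + (2 * π / 3 + 2 * π / 3) := fun t => by ring
      simp only [e]
      rw [hshift, ← hWint]; ring
    all_goals
      apply Continuous.intervalIntegrable
      fun_prop

/-! ### Linear maps of the plane -/

/-- The linear map that sends the standard basis to `u`, `v`. -/
def planeMap (u v : Plane) : Plane →ₗ[ℝ] Plane where
  toFun z := z 0 • u + z 1 • v
  map_add' z w := by simp only [PiLp.add_apply]; module
  map_smul' c z := by simp only [PiLp.smul_apply, smul_eq_mul, RingHom.id_apply]; module

theorem planeMap_apply (u v z : Plane) : planeMap u v z = z 0 • u + z 1 • v := rfl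

theorem eq_planeMap (L : Plane →ₗ[ℝ] Plane) : L = planeMap (L (mkVec 1 0)) (L (mkVec 0 1)) := by
  ext1 z
  rw [planeMap_apply, ← map_smul, ← map_smul, ← map_add]
  congr 1
  apply plane_ext <;> simp [vec_zero, vec_one]

theorem det_planeMap (u v : Plane) : LinearMap.det (planeMap u v) = areaForm2 u v := by
  rw [← LinearMap.det_toMatrix (EuclideanSpace.basisFun (Fin 2) ℝ).toBasis, Matrix.det_fin_two]
  simp only [LinearMap.toMatrix_apply, OrthonormalBasis.coe_toBasis,
    OrthonormalBasis.coe_toBasis_repr_apply, EuclideanSpace.basisFun_apply,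
    EuclideanSpace.basisFun_repr, planeMap_apply, areaForm2]
  simp
  ring

theorem areaForm2_planeMap (u v z w : Plane) :
    areaForm2 (planeMap u v z) (planeMap u v w) = areaForm2 u v * areaForm2 z w := by
  simp only [planeMap_apply, areaForm2, PiLp.add_apply, PiLp.smul_apply, smul_eq_mul]; ring

theorem triArea2_planeMap (u v a b c : Plane) :
    triArea2 (planeMap u v a) (planeMap u v b) (planeMap u v c) = areaForm2 u v * triArea2 a b c := by
  rw [triArea2, ← map_sub, ← map_sub, areaForm2_planeMap, triArea2]

theorem triArea2_add_right (a b c w : Plane) :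
    triArea2 (a + w) (b + w) (c + w) = triArea2 a b c := by
  simp only [triArea2, add_sub_add_right_eq_sub]

theorem volume_planeMap_image (u v : Plane) (s : Set Plane) :
    volume.real (planeMap u v '' s) = |areaForm2 u v| * volume.real s := by
  rw [measureReal_def, Measure.addHaar_image_linearMap, det_planeMap, ENNReal.toReal_mul,
    ENNReal.toReal_ofReal (abs_nonneg _), measureReal_def]

/-- The invertible linear map that sends the standard basis to `u`, `v`. -/
noncomputable def planeEquiv (u v : Plane) (h : areaForm2 u v ≠ 0) : Plane ≃L[ℝ] Plane :=
  ((planeMap u v).equivOfDetNeZero (by rwa [det_planeMap])).toContinuousLinearEquiv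

theorem coe_planeEquiv (u v : Plane) (h : areaForm2 u v ≠ 0) (z : Plane) :
    planeEquiv u v h z = planeMap u v z := rfl

/-! ### Sas's inequality -/

/-- The mean of the areas of the triangles inscribed in the Sas curve is at most the maximal area.
-/
theorem IsMaximalTriangle.sas {Ω : Set Plane} (hc : IsCompact Ω) (hsc : StrictConvex ℝ Ω)
    (hi : (interior Ω).Nonempty) {a b c : Plane} (h : IsMaximalTriangle Ω a b c) :
    3 * √3 * volume.real Ω ≤ 2 * π * triArea2 a b c := by
  obtain ⟨m, ρ, R, -, hR, -, -, -, hcont, hint⟩ := exists_sas_curve hc hsc hi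
  rw [← hint]
  have h1 : ∀ t ∈ Icc 0 (2 * π), triArea2 (R t) (R (t + 2 * π / 3)) (R (t + 2 * π / 3 + 2 * π / 3)) ≤
      triArea2 a b c := fun t _ => h.le _ (hR _) _ (hR _) _ (hR _)
  have := intervalIntegral.integral_mono_on Real.two_pi_pos.le
    (hcont.intervalIntegrable (μ := volume) _ _) intervalIntegrable_const h1
  rwa [intervalIntegral.integral_const, sub_zero, smul_eq_mul] at this

theorem rotation_det (θ : ℝ) :
    areaForm2 (mkVec (Real.cos θ) (-Real.sin θ)) (mkVec (Real.sin θ) (Real.cos θ)) = 1 := by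
  simp only [areaForm2, vec_zero, vec_one]
  linear_combination Real.sin_sq_add_cos_sq θ

/-- In the case of equality, a maximal triangle has the projections of an equilateral triangle
inscribed in an ellipse that has the same projections as the region. -/
theorem IsMaximalTriangle.projection_of_sas_eq {Ω : Set Plane} (hΩ : IsBilliardTable Ω)
    {a b c : Plane} (h : IsMaximalTriangle Ω a b c)
    (heq : 3 * √3 * volume.real Ω = 2 * π * triArea2 a b c) (θ : ℝ) :
    ∃ m ρ t : ℝ, 0 < ρ ∧
      (∀ z ∈ Ω, Real.cos θ * z 0 + Real.sin θ * z 1 ≤ m + ρ) ∧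
      (∃ z ∈ Ω, Real.cos θ * z 0 + Real.sin θ * z 1 = m + ρ) ∧
      Real.cos θ * a 0 + Real.sin θ * a 1 = m + ρ * Real.cos t ∧
      Real.cos θ * b 0 + Real.sin θ * b 1 = m + ρ * Real.cos (t + 2 * π / 3) ∧
      Real.cos θ * c 0 + Real.sin θ * c 1 = m + ρ * Real.cos (t + 2 * π / 3 + 2 * π / 3) := by
  have hsc := hΩ.strictConvex
  have hτ := h.area_pos hΩ.zero_mem
  have hbc := ne_of_triArea2_pos hτ
  have hcr := h.isCriticalTriangle
  set u := mkVec (Real.cos θ) (-Real.sin θ) with hu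
  set v := mkVec (Real.sin θ) (Real.cos θ) with hv
  have hdet : areaForm2 u v = 1 := rotation_det θ
  -- The rotation that turns the direction `θ` into the first axis, so that the Sas curve is taken
  -- with respect to `θ`.
  set L := planeEquiv u v (by rw [hdet]; exact one_ne_zero) with hL
  have hLz : ∀ z, L z 0 = Real.cos θ * z 0 + Real.sin θ * z 1 := fun z => by
    rw [hL, coe_planeEquiv, planeMap_apply]
    simp only [PiLp.add_apply, PiLp.smul_apply, hu, hv, vec_zero, smul_eq_mul]; ring
  have hLtri : ∀ x y z, triArea2 (L x) (L y) (L z) = triArea2 x y z := fun x y z => by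
    have := triArea2_planeMap u v x y z
    rwa [hdet, one_mul] at this
  have hint : interior (L '' Ω) = L '' interior Ω := (L.toHomeomorph.image_interior Ω).symm
  have hvol : volume.real (L '' Ω) = volume.real Ω := by
    have := volume_planeMap_image u v Ω
    rwa [hdet, abs_one, one_mul] at this
  obtain ⟨m, ρ, R, hρ, hR, hRx, hstrip, hcover, hcont, hintg⟩ := exists_sas_curve
    (hΩ.isCompact.image L.continuous)
    (hsc.linear_image (L : Plane →L[ℝ] Plane).toLinearMap L.toHomeomorph.isOpenMap)
    (by rw [hint]; exact ⟨L 0, mem_image_of_mem _ hΩ.zero_mem⟩)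
  change ∀ t, R t ∈ L '' Ω at hR
  change ∀ z ∈ L '' Ω, |z 0 - m| ≤ ρ at hstrip
  change ∀ z ∈ L '' Ω, z ∉ interior (L '' Ω) → _ at hcover
  change _ = 3 * √3 * volume.real (L '' Ω) at hintg
  choose z hz hzR using hR
  set T : ℝ → ℝ := fun t => triArea2 (R t) (R (t + 2 * π / 3)) (R (t + 2 * π / 3 + 2 * π / 3)) with hT
  have hTz : ∀ t, T t = triArea2 (z t) (z (t + 2 * π / 3)) (z (t + 2 * π / 3 + 2 * π / 3)) :=
    fun t => by rw [← hLtri (z t), hzR, hzR, hzR]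
  have hTle : ∀ t, T t ≤ triArea2 a b c := fun t => by
    rw [hTz]; exact h.le _ (hz _) _ (hz _) _ (hz _)
  -- `T` is continuous, never exceeds the maximal area, and has it as its mean.
  have hTeq : ∀ t ∈ Icc 0 (2 * π), T t = triArea2 a b c := by
    by_contra hcon
    push Not at hcon
    obtain ⟨t, ht, hne⟩ := hcon
    have := intervalIntegral.integral_pos (f := fun t => triArea2 a b c - T t) Real.two_pi_pos
      (continuous_const.sub hcont).continuousOn (fun t _ => sub_nonneg.2 (hTle t))
      ⟨t, ht, sub_pos.2 (lt_of_le_of_ne (hTle t) hne)⟩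
    rw [intervalIntegral.integral_sub (continuous_const.intervalIntegrable _ _)
      (hcont.intervalIntegrable _ _), hintg, hvol, heq, intervalIntegral.integral_const, sub_zero,
      smul_eq_mul, sub_self] at this
    exact lt_irrefl _ this
  have hanot : L a ∉ interior (L '' Ω) := by
    rw [hint]
    rintro ⟨a', ha', haa⟩
    rw [L.injective haa] at ha'
    have := areaForm2_pos_of_mem_interior (sub_ne_zero.2 hbc) hcr.support₁ ha'
    rw [sub_self, areaForm2_zero_right] at this
    exact lt_irrefl _ this
  -- The Sas triangle with vertex `a` is also maximal. As `a` has only one supporting line, its side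
  -- opposite to `a` is parallel to `b - c`, so it is the triangle `a b c`.
  obtain ⟨t, ht, hta⟩ := hcover (L a) (mem_image_of_mem _ h.mem₁) hanot
  have hza : z t = a := L.injective ((hzR t).trans hta)
  have hTt := hTeq t ht
  rw [hTz, hza] at hTt
  have hmax' : IsMaximalTriangle Ω a (z (t + 2 * π / 3)) (z (t + 2 * π / 3 + 2 * π / 3)) :=
    ⟨h.mem₁, hz _, hz _, fun x hx y hy w hw => by rw [hTt]; exact h.le x hx y hy w hw⟩
  have hne' := ne_of_triArea2_pos (hmax'.area_pos hΩ.zero_mem)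
  obtain ⟨l, hl, hpar⟩ := hΩ.support_parallel h.mem₁ (sub_ne_zero.2 hbc) (sub_ne_zero.2 hne')
    hcr.support₁ hmax'.isCriticalTriangle.support₁
  obtain ⟨hb, hc⟩ := hcr.eq_of_parallel hsc hmax'.isCriticalTriangle hbc hl hpar
  have hcoord : ∀ s, Real.cos θ * z s 0 + Real.sin θ * z s 1 = m + ρ * Real.cos s := fun s => by
    rw [← hLz, hzR, hRx]
  refine ⟨m, ρ, t, hρ, fun x hx => ?_, ⟨z 0, hz 0, by rw [hcoord, Real.cos_zero, mul_one]⟩, ?_, ?_, ?_⟩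
  · have := (abs_le.1 (hstrip (L x) (mem_image_of_mem _ hx))).2
    rw [hLz] at this
    linarith
  · rw [← hcoord, hza]
  · rw [← hcoord, hb]
  · rw [← hcoord, hc]

/-! ### Support functions and ellipses -/

/-- A point outside `K₂` would be strictly separated from it by a linear form, which up to a
positive factor is the product with a unit vector. -/
theorem subset_of_support_le {K₁ K₂ : Set Plane} (hc : IsClosed K₂) (hK : Convex ℝ K₂)
    (h : ∀ θ : ℝ, ∀ z ∈ K₁, ∃ w ∈ K₂,
      Real.cos θ * z 0 + Real.sin θ * z 1 ≤ Real.cos θ * w 0 + Real.sin θ * w 1) : K₁ ⊆ K₂ := by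
  intro z hz
  by_contra hzn
  obtain ⟨f, s, hf1, hf2⟩ := geometric_hahn_banach_closed_point hK hc hzn
  have hfv : ∀ v : Plane, f v = f (mkVec 1 0) * v 0 + f (mkVec 0 1) * v 1 := by
    intro v
    have : v = v 0 • mkVec 1 0 + v 1 • mkVec 0 1 := by
      apply plane_ext <;> simp [vec_zero, vec_one]
    conv_lhs => rw [this]
    rw [map_add, map_smul, map_smul, smul_eq_mul, smul_eq_mul]; ring
  by_cases h0 : mkVec (f (mkVec 1 0)) (f (mkVec 0 1)) = 0
  · obtain ⟨w, hw, -⟩ := h 0 z hz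
    have e0 : f (mkVec 1 0) = 0 := congrArg (fun v : Plane => v 0) h0
    have e1 : f (mkVec 0 1) = 0 := congrArg (fun v : Plane => v 1) h0
    have h1 := hf1 w hw
    rw [hfv, e0, e1] at h1 hf2
    linarith
  · obtain ⟨l, θ, hl, hθ⟩ := exists_eq_smul_unitDir h0
    obtain ⟨w, hw, hle⟩ := h θ z hz
    have e0 : f (mkVec 1 0) = l * Real.cos θ := congrArg (fun v : Plane => v 0) hθ
    have e1 : f (mkVec 0 1) = l * Real.sin θ := congrArg (fun v : Plane => v 1) hθ
    have h1 := hf1 w hw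
    rw [hfv, e0, e1] at h1 hf2
    nlinarith

theorem mem_unitDisk_iff {z : Plane} : z ∈ unitDisk ↔ z 0 ^ 2 + z 1 ^ 2 ≤ 1 := by
  rw [unitDisk, mem_closedBall_zero_iff, ← plane_norm_sq, sq_le_one_iff₀ (norm_nonneg z)]

/-- The affine map with linear part `planeEquiv u v` that sends the origin to `w`. -/
noncomputable def planeAffine (u v w : Plane) (h : areaForm2 u v ≠ 0) : Plane ≃ᵃ[ℝ] Plane :=
  (planeEquiv u v h).toLinearEquiv.toAffineEquiv.trans (AffineEquiv.constVAdd ℝ Plane w)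

theorem planeAffine_apply (u v w : Plane) (h : areaForm2 u v ≠ 0) (z : Plane) :
    planeAffine u v w h z = w + (z 0 • u + z 1 • v) := rfl

/-- In each direction the centroid `G` projects to `m`, and `u`, `v` project to `ρ cos t`, `-ρ sin
t`. So the support function of `Ω` about `G` is the root of the sum of the squared projections of
`u` and `v`, which is that of the ellipse with conjugate semi-diameters `u`, `v`. -/
theorem IsMaximalTriangle.isEllipse_of_sas_eq {Ω : Set Plane} (hΩ : IsBilliardTable Ω)
    {a b c : Plane} (h : IsMaximalTriangle Ω a b c)
    (heq : 3 * √3 * volume.real Ω = 2 * π * triArea2 a b c) : IsEllipse Ω := by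
  have hτ := h.area_pos hΩ.zero_mem
  have h3 := sqrt_three_mul_self
  have h3pos : 0 < √3 := Real.sqrt_pos.2 (by norm_num)
  set G : Plane := (1 / 3 : ℝ) • (a + b + c) with hG
  set u : Plane := a - G with hu
  set v : Plane := (√3)⁻¹ • (b - c) with hv
  have huv : areaForm2 u v ≠ 0 := by
    have : areaForm2 u v = (√3)⁻¹ * (2 / 3) * triArea2 a b c := by
      simp only [hu, hv, hG, triArea2, areaForm2, PiLp.sub_apply, PiLp.smul_apply, PiLp.add_apply,
        smul_eq_mul]
      ring
    rw [this]; positivity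
  have hproj := h.projection_of_sas_eq hΩ heq
  refine ⟨planeAffine u v G huv, ?_⟩
  have key : ∀ θ : ℝ, ∃ ρ t : ℝ, 0 < ρ ∧
      (∀ z ∈ Ω, Real.cos θ * z 0 + Real.sin θ * z 1 ≤ Real.cos θ * G 0 + Real.sin θ * G 1 + ρ) ∧
      (∃ z ∈ Ω, Real.cos θ * z 0 + Real.sin θ * z 1 = Real.cos θ * G 0 + Real.sin θ * G 1 + ρ) ∧
      Real.cos θ * u 0 + Real.sin θ * u 1 = ρ * Real.cos t ∧
      Real.cos θ * v 0 + Real.sin θ * v 1 = -(ρ * Real.sin t) := by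
    intro θ
    obtain ⟨m, ρ, t, hρ, h1, h2, ea, eb, ec⟩ := hproj θ
    rw [cos_add_third (t + 2 * π / 3), cos_add_third, sin_add_third] at ec
    rw [cos_add_third] at eb
    have eG : Real.cos θ * G 0 + Real.sin θ * G 1 = m := by
      simp only [hG, PiLp.smul_apply, PiLp.add_apply, smul_eq_mul]
      linear_combination (1 / 3 : ℝ) * (ea + eb + ec) - (1 / 12 : ℝ) * ρ * Real.cos t * h3
    refine ⟨ρ, t, hρ, by rwa [eG], by rwa [eG], ?_, ?_⟩
    · simp only [hu, PiLp.sub_apply]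
      linear_combination ea - eG
    · have hinv : (√3)⁻¹ * √3 = 1 := inv_mul_cancel₀ h3pos.ne'
      simp only [hv, PiLp.smul_apply, PiLp.sub_apply, smul_eq_mul]
      linear_combination (√3)⁻¹ * (eb - ec) + (√3)⁻¹ * (1 / 4 : ℝ) * ρ * Real.cos t * h3 -
        ρ * Real.sin t * hinv
  have hE : ∀ x y : ℝ, x ^ 2 + y ^ 2 ≤ 1 → G + (x • u + y • v) ∈ planeAffine u v G huv '' unitDisk :=
    fun x y hxy => ⟨mkVec x y, mem_unitDisk_iff.2 hxy, rfl⟩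
  have hcont : Continuous (planeAffine u v G huv) := by
    change Continuous fun z : Plane => G + (z 0 • u + z 1 • v)
    fun_prop
  apply Subset.antisymm
  · refine subset_of_support_le ((isCompact_closedBall 0 1).image hcont).isClosed ?_ fun θ z hz => ?_
    · exact (convex_closedBall (0 : Plane) 1).affine_image (planeAffine u v G huv).toAffineMap
    · obtain ⟨ρ, t, hρ, h1, -, eu, ev⟩ := key θ
      refine ⟨_, hE (Real.cos t) (-Real.sin t) (by rw [neg_sq, Real.cos_sq_add_sin_sq]), ?_⟩
      refine (h1 z hz).trans (le_of_eq ?_)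
      simp only [PiLp.add_apply, PiLp.smul_apply, smul_eq_mul]
      linear_combination -Real.cos t * eu + Real.sin t * ev - ρ * Real.sin_sq_add_cos_sq t
  · refine subset_of_support_le hΩ.isCompact.isClosed hΩ.strictConvex.convex ?_
    rintro θ _ ⟨z, hz, rfl⟩
    obtain ⟨ρ, t, hρ, -, ⟨w, hw, hwe⟩, eu, ev⟩ := key θ
    refine ⟨w, hw, ?_⟩
    rw [hwe, planeAffine_apply]
    rw [mem_unitDisk_iff] at hz
    have e : Real.cos θ * (G + (z 0 • u + z 1 • v)) 0 + Real.sin θ * (G + (z 0 • u + z 1 • v)) 1 =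
        Real.cos θ * G 0 + Real.sin θ * G 1 + ρ * (z 0 * Real.cos t - z 1 * Real.sin t) := by
      simp only [PiLp.add_apply, PiLp.smul_apply, smul_eq_mul]
      linear_combination z 0 * eu + z 1 * ev
    rw [e]
    have hcs : z 0 * Real.cos t - z 1 * Real.sin t ≤ 1 := by
      nlinarith [sq_nonneg (z 0 - Real.cos t), sq_nonneg (z 1 + Real.sin t),
        Real.sin_sq_add_cos_sq t]
    nlinarith

/-- The maximal inscribed triangles of an ellipse. -/
theorem IsMaximalTriangle.sas_eq_of_isEllipse {Ω : Set Plane} (hΩ : IsEllipse Ω)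
    {a b c : Plane} (h : IsMaximalTriangle Ω a b c)
    {a' b' c' : Plane} (h' : IsMaximalTriangle unitDisk a' b' c')
    (hD : triArea2 a' b' c' = 3 / 2 * √3) :
    3 * √3 * volume.real Ω = 2 * π * triArea2 a b c := by
  obtain ⟨A, rfl⟩ := hΩ
  set u := A.linear (mkVec 1 0) with hu
  set v := A.linear (mkVec 0 1) with hv
  have hlin : (A.linear : Plane →ₗ[ℝ] Plane) = planeMap u v := eq_planeMap _
  have hA : ∀ z, A z = planeMap u v z + A 0 := fun z => by
    have := A.map_vadd 0 z
    rw [vadd_eq_add, add_zero, vadd_eq_add] at this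
    rw [this, ← hlin]; rfl
  have himg : A '' unitDisk = (fun z => z + A 0) '' (planeMap u v '' unitDisk) := by
    rw [image_image]; exact image_congr fun z _ => hA z
  have hvol : volume.real (A '' unitDisk) = |areaForm2 u v| * π := by
    rw [himg, image_add_right, measureReal_def, measure_preimage_add_right, ← measureReal_def,
      volume_planeMap_image, measureReal_def, unitDisk, EuclideanSpace.volume_closedBall_fin_two]
    simp [Real.pi_pos.le]
  have hAtri : ∀ x y z, triArea2 (A x) (A y) (A z) = areaForm2 u v * triArea2 x y z := fun x y z => by
    rw [hA x, hA y, hA z, triArea2_add_right, triArea2_planeMap]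
  have htri : triArea2 a b c = |areaForm2 u v| * (3 / 2 * √3) := by
    obtain ⟨x, hx, rfl⟩ := h.mem₁
    obtain ⟨y, hy, rfl⟩ := h.mem₂
    obtain ⟨z, hz, rfl⟩ := h.mem₃
    have hle := h.le
    rw [hAtri, ← hD] at *
    rcases le_total 0 (areaForm2 u v) with hd | hd
    · rw [abs_of_nonneg hd]
      refine le_antisymm (mul_le_mul_of_nonneg_left (h'.le x hx y hy z hz) hd) ?_
      rw [← hAtri a']
      exact hle _ (mem_image_of_mem _ h'.mem₁) _ (mem_image_of_mem _ h'.mem₂) _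
        (mem_image_of_mem _ h'.mem₃)
    -- The affine map reverses orientation, so two vertices are exchanged before comparing.
    · rw [abs_of_nonpos hd]
      have h1 := h'.le x hx z hz y hy
      have h2 := hle _ (mem_image_of_mem _ h'.mem₁) _ (mem_image_of_mem _ h'.mem₃) _
        (mem_image_of_mem _ h'.mem₂)
      rw [triArea2_swap] at h1
      rw [hAtri, triArea2_swap] at h2
      nlinarith
  rw [hvol, htri]
  ring

/-! ### Convex regions enveloped by a family of lines -/

/-- A closed curve `q` with tangent directions `v`, whose tangent direction turns once
counterclockwise around the origin. -/
structure IsOvalFrame (q v w : ℝ → Plane) (l : ℝ → ℝ) : Prop where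
  contDiff : ContDiff ℝ 2 q
  periodic : Function.Periodic q (2 * π)
  hasDerivAt : ∀ t, HasDerivAt q (l t • v t) t
  speed_pos : ∀ t, 0 < l t
  hasDerivAt_dir : ∀ t, HasDerivAt v (w t) t
  antiperiodic : ∀ t, v (t + π) = -v t
  turn : ∀ t s, t < s → s < t + π → 0 < areaForm2 (v t) (v s)
  curvature_pos : ∀ t, 0 < areaForm2 (v t) (w t)
  zero_inside : ∀ t, 0 < areaForm2 (q t) (v t)

/-- The region on the left-hand side of the lines through `q t` of direction `v t`. -/
def envelopedRegion (q v : ℝ → Plane) : Set Plane := {z | ∀ t, 0 ≤ areaForm2 (v t) (z - q t)}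

theorem HasDerivAt.areaForm2 {f g : ℝ → Plane} {f' g' : Plane} {t : ℝ} (hf : HasDerivAt f f' t)
    (hg : HasDerivAt g g' t) :
    HasDerivAt (fun s => areaForm2 (f s) (g s)) (areaForm2 f' (g t) + areaForm2 (f t) g') t := by
  have hc : ∀ {h : ℝ → Plane} {h' : Plane}, HasDerivAt h h' t → ∀ i,
      HasDerivAt (fun s => h s i) (h' i) t := fun hh i =>
    ((EuclideanSpace.proj (𝕜 := ℝ) i).hasFDerivAt.comp_hasDerivAt t hh)
  unfold _root_.areaForm2
  exact (((hc hf 0).mul (hc hg 1)).sub ((hc hf 1).mul (hc hg 0))).congr_deriv (by ring)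

theorem eq_zero_of_areaForm2_eq_zero {v w z : Plane} (h : areaForm2 v w ≠ 0)
    (h1 : areaForm2 v z = 0) (h2 : areaForm2 w z = 0) : z = 0 := by
  have e : areaForm2 v w • z = areaForm2 v z • w - areaForm2 w z • v := by
    apply plane_ext <;>
      simp only [areaForm2, PiLp.smul_apply, PiLp.sub_apply, smul_eq_mul] <;> ring
  rw [h1, h2, zero_smul, zero_smul, sub_zero] at e
  exact (smul_eq_zero.1 e).resolve_left h

theorem isClosed_envelopedRegion (q v : ℝ → Plane) : IsClosed (envelopedRegion q v) := by
  simp only [envelopedRegion, ofPred_forall]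
  exact isClosed_iInter fun t =>
    isClosed_le continuous_const (continuous_const.areaForm2 (continuous_id.sub continuous_const))

namespace IsOvalFrame

theorem continuous_curve {q v w : ℝ → Plane} {l : ℝ → ℝ} (h : IsOvalFrame q v w l)
    : Continuous q := h.contDiff.continuous

theorem continuous_dir {q v w : ℝ → Plane} {l : ℝ → ℝ} (h : IsOvalFrame q v w l) : Continuous v :=
  continuous_iff_continuousAt.2 fun t => (h.hasDerivAt_dir t).continuousAt

theorem periodic_dir {q v w : ℝ → Plane} {l : ℝ → ℝ} (h : IsOvalFrame q v w l)
    : Function.Periodic v (2 * π) := fun t => by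
  rw [two_mul, ← add_assoc, h.antiperiodic, h.antiperiodic, neg_neg]

theorem dir_ne_zero {q v w : ℝ → Plane} {l : ℝ → ℝ} (h : IsOvalFrame q v w l)
    (t : ℝ) : v t ≠ 0 := by
  intro h0
  have := h.curvature_pos t
  rw [h0, areaForm2_zero_left] at this
  exact lt_irrefl _ this

/-- The signed distance of `q s` from the tangent line at `t` increases for half a period and then
decreases, and it vanishes at both ends of the period. -/
theorem areaForm2_pos {q v w : ℝ → Plane} {l : ℝ → ℝ} (h : IsOvalFrame q v w l)
    {t s : ℝ} (hts : t < s) (hst : s < t + 2 * π) :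
    0 < areaForm2 (v t) (q s - q t) := by
  have hd : ∀ s, HasDerivAt (fun s => areaForm2 (v t) (q s - q t))
      (l s * areaForm2 (v t) (v s)) s := fun s => by
    refine ((hasDerivAt_const s (v t)).areaForm2 ((h.hasDerivAt s).sub_const (q t))).congr_deriv ?_
    rw [areaForm2_zero_left, zero_add, areaForm2_smul_right]
  have hc : Continuous fun s => areaForm2 (v t) (q s - q t) :=
    continuous_iff_continuousAt.2 fun s => (hd s).continuousAt
  have h0 : areaForm2 (v t) (q t - q t) = 0 := by rw [sub_self, areaForm2_zero_right]
  have hpi := Real.pi_pos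
  rcases le_total s (t + π) with hs | hs
  · have hm : StrictMonoOn (fun s => areaForm2 (v t) (q s - q t)) (Icc t (t + π)) := by
      refine strictMonoOn_of_deriv_pos (convex_Icc _ _) hc.continuousOn fun x hx => ?_
      rw [interior_Icc] at hx
      rw [(hd x).deriv]
      exact mul_pos (h.speed_pos x) (h.turn t x hx.1 hx.2)
    have := hm (left_mem_Icc.2 (by linarith)) ⟨hts.le, hs⟩ hts
    simpa only [h0] using this
  · have hm : StrictAntiOn (fun s => areaForm2 (v t) (q s - q t)) (Icc (t + π) (t + 2 * π)) := by
      refine strictAntiOn_of_deriv_neg (convex_Icc _ _) hc.continuousOn fun x hx => ?_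
      rw [interior_Icc] at hx
      rw [(hd x).deriv]
      have h1 := h.turn t (x - π) (by linarith [hx.1]) (by linarith [hx.2])
      have h2 := h.antiperiodic (x - π)
      rw [sub_add_cancel] at h2
      rw [h2, areaForm2_swap, areaForm2_neg_left, ← areaForm2_swap]
      exact mul_neg_of_pos_of_neg (h.speed_pos x) (neg_neg_of_pos h1)
    have := hm ⟨hs, hst.le⟩ (right_mem_Icc.2 (by linarith)) hst
    simpa only [h.periodic t, h0] using this

theorem curve_mem {q v w : ℝ → Plane} {l : ℝ → ℝ} (h : IsOvalFrame q v w l)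
    (s : ℝ) : q s ∈ envelopedRegion q v := by
  intro t
  obtain ⟨s', hs', he⟩ := h.periodic.exists_mem_Ico Real.two_pi_pos s t
  rw [he]
  rcases hs'.1.eq_or_lt with h1 | h1
  · rw [← h1, sub_self, areaForm2_zero_right]
  · exact (h.areaForm2_pos h1 hs'.2).le

/-- As a function of the parameter, the form of `z` against the moving tangent line has a minimum at
`t`. Since `q` moves along `v`, the derivative is the form of `w t` with `z - q t`; thus `z - q t`
is annihilated by two independent vectors. -/
theorem eq_curve {q v w : ℝ → Plane} {l : ℝ → ℝ} (h : IsOvalFrame q v w l)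
    {z : Plane} (hz : z ∈ envelopedRegion q v) {t : ℝ}
    (ht : areaForm2 (v t) (z - q t) = 0) : z = q t := by
  have hd := (h.hasDerivAt_dir t).areaForm2 ((h.hasDerivAt t).const_sub z)
  have hmin : IsLocalMin (fun s => areaForm2 (v s) (z - q s)) t :=
    Eventually.of_forall fun s => by simpa only [ht] using hz s
  have h0 := hmin.hasDerivAt_eq_zero hd
  have e : areaForm2 (v t) (-(l t • v t)) = 0 := by
    rw [areaForm2_swap, areaForm2_neg_left, areaForm2_smul_left, areaForm2_self]; simp
  rw [e, add_zero] at h0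
  exact sub_eq_zero.1 (eq_zero_of_areaForm2_eq_zero (h.curvature_pos t).ne' ht h0)

theorem mem_interior {q v w : ℝ → Plane} {l : ℝ → ℝ} (h : IsOvalFrame q v w l)
    {z : Plane} (hz : ∀ t, 0 < areaForm2 (v t) (z - q t)) :
    z ∈ interior (envelopedRegion q v) := by
  have hcont : Continuous fun x : Plane × ℝ => areaForm2 (v x.2) (x.1 - q x.2) :=
    (h.continuous_dir.comp continuous_snd).areaForm2
      (continuous_fst.sub (h.continuous_curve.comp continuous_snd))
  have := (isCompact_Icc (a := 0) (b := 2 * π)).eventually_forall_of_forall_eventually (x₀ := z)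
    (P := fun z t => 0 < areaForm2 (v t) (z - q t))
    fun t _ => hcont.continuousAt.eventually (lt_mem_nhds (hz t))
  rw [mem_interior_iff_mem_nhds]
  filter_upwards [this] with x hx t
  have hper : Function.Periodic (fun t => areaForm2 (v t) (x - q t)) (2 * π) := fun t => by
    simp only [h.periodic t, h.periodic_dir t]
  obtain ⟨s, hs, he⟩ := hper.exists_mem_Ico₀ Real.two_pi_pos t
  change 0 ≤ areaForm2 (v t) (x - q t)
  rw [he]
  exact (hx s ⟨hs.1, hs.2.le⟩).le

theorem strictConvex {q v w : ℝ → Plane} {l : ℝ → ℝ} (h : IsOvalFrame q v w l)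
    : StrictConvex ℝ (envelopedRegion q v) := by
  intro x hx y hy hxy a b ha hb hab
  refine h.mem_interior fun t => ?_
  have e : a • x + b • y - q t = a • (x - q t) + b • (y - q t) := by
    have : q t = a • q t + b • q t := by rw [← add_smul, hab, one_smul]
    conv_lhs => rw [this]
    module
  rw [e, areaForm2_add_right, areaForm2_smul_right, areaForm2_smul_right]
  have h1 : 0 ≤ areaForm2 (v t) (x - q t) := hx t
  have h2 : 0 ≤ areaForm2 (v t) (y - q t) := hy t
  rcases h1.eq_or_lt with h1 | h1
  · rcases h2.eq_or_lt with h2 | h2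
    · exact absurd ((h.eq_curve hx h1.symm).trans (h.eq_curve hy h2.symm).symm) hxy
    · positivity
  · positivity

/-- The lines at `t` and `t + π` are parallel and oppositely directed, so they bound a strip; the
strips for `0` and `π / 2` have independent directions. -/
theorem isBounded {q v w : ℝ → Plane} {l : ℝ → ℝ} (h : IsOvalFrame q v w l)
    : Bornology.IsBounded (envelopedRegion q v) := by
  have key : ∀ t, ∃ C, ∀ z ∈ envelopedRegion q v, |areaForm2 (v t) z| ≤ C := fun t => by
    refine ⟨|areaForm2 (v t) (q t)| + |areaForm2 (v t) (q (t + π))|, fun z hz => ?_⟩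
    have h1 := hz t
    have h2 := hz (t + π)
    rw [h.antiperiodic, areaForm2_neg_left] at h2
    rw [areaForm2_sub_right] at h1 h2
    rw [abs_le]
    constructor
    · linarith [neg_abs_le (areaForm2 (v t) (q t)), abs_nonneg (areaForm2 (v t) (q (t + π)))]
    · linarith [le_abs_self (areaForm2 (v t) (q (t + π))), abs_nonneg (areaForm2 (v t) (q t))]
  obtain ⟨C, hC⟩ := key 0
  obtain ⟨D, hD⟩ := key (π / 2)
  have hpos := h.turn 0 (π / 2) (by positivity) (by linarith [Real.pi_pos])
  rw [isBounded_iff_forall_norm_le]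
  refine ⟨(C * ‖v (π / 2)‖ + D * ‖v 0‖) / areaForm2 (v 0) (v (π / 2)), fun z hz => ?_⟩
  rw [le_div_iff₀ hpos]
  have e : areaForm2 (v 0) (v (π / 2)) • z =
      areaForm2 (v 0) z • v (π / 2) - areaForm2 (v (π / 2)) z • v 0 := by
    apply plane_ext <;>
      simp only [areaForm2, PiLp.smul_apply, PiLp.sub_apply, smul_eq_mul] <;> ring
  calc ‖z‖ * areaForm2 (v 0) (v (π / 2)) = ‖areaForm2 (v 0) (v (π / 2)) • z‖ := by
        rw [norm_smul, Real.norm_of_nonneg hpos.le, mul_comm]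
    _ ≤ ‖areaForm2 (v 0) z • v (π / 2)‖ + ‖areaForm2 (v (π / 2)) z • v 0‖ := by
        rw [e]; exact norm_sub_le _ _
    _ ≤ C * ‖v (π / 2)‖ + D * ‖v 0‖ := by
        rw [norm_smul, norm_smul]
        exact add_le_add (mul_le_mul_of_nonneg_right (hC z hz) (norm_nonneg _))
          (mul_le_mul_of_nonneg_right (hD z hz) (norm_nonneg _))

theorem frontier_eq {q v w : ℝ → Plane} {l : ℝ → ℝ} (h : IsOvalFrame q v w l)
    : frontier (envelopedRegion q v) = range q := by
  rw [(isClosed_envelopedRegion q v).frontier_eq]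
  apply Subset.antisymm
  · rintro z ⟨hz, hzi⟩
    by_contra hr
    refine hzi (h.mem_interior fun t => lt_of_le_of_ne (hz t) fun h0 => hr ?_)
    exact ⟨t, (h.eq_curve hz h0.symm).symm⟩
  · rintro _ ⟨t, rfl⟩
    refine ⟨h.curve_mem t, fun hi => ?_⟩
    have := areaForm2_pos_of_mem_interior (h.dir_ne_zero t)
      (fun z (hz : z ∈ envelopedRegion q v) => hz t) hi
    rw [sub_self, areaForm2_zero_right] at this
    exact lt_irrefl _ this

theorem eq_of_curve_eq {q v w : ℝ → Plane} {l : ℝ → ℝ} (h : IsOvalFrame q v w l)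
    {s t : ℝ} (hq : q s = q t) (h1 : s < t + 2 * π) (h2 : t < s + 2 * π) :
    s = t := by
  rcases lt_trichotomy s t with hlt | he | hlt
  · have := h.areaForm2_pos hlt h2
    rw [hq, sub_self, areaForm2_zero_right] at this
    exact absurd this (lt_irrefl _)
  · exact he
  · have := h.areaForm2_pos hlt h1
    rw [hq, sub_self, areaForm2_zero_right] at this
    exact absurd this (lt_irrefl _)

theorem isBilliardTable {q v w : ℝ → Plane} {l : ℝ → ℝ} (h : IsOvalFrame q v w l)
    : IsBilliardTable (envelopedRegion q v) where
  isCompact := Metric.isCompact_of_isClosed_isBounded (isClosed_envelopedRegion q v) h.isBounded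
  strictConvex := h.strictConvex
  zero_mem := h.mem_interior fun t => by
    rw [zero_sub, areaForm2_swap, areaForm2_neg_left, neg_neg]; exact h.zero_inside t
  boundary := ⟨q, h.contDiff, h.periodic,
    fun t => by
      rw [(h.hasDerivAt t).deriv]
      exact smul_ne_zero (h.speed_pos t).ne' (h.dir_ne_zero t),
    fun s hs t ht hst => h.eq_of_curve_eq hst (by linarith [hs.2, ht.1]) (by linarith [hs.1, ht.2]),
    h.frontier_eq.symm⟩

/-- If the chords between points of the boundary curve whose parameters differ by a third of the
period are parallel to the tangent lines in between, then the outer billiard map has an invariant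
curve of 3-periodic points. -/
theorem hasInvariantCurveOfPeriod {q v w : ℝ → Plane} {l : ℝ → ℝ} (h : IsOvalFrame q v w l)
    (hchord : ∀ t, q (t + 2 * π / 3) - q (t + 4 * π / 3) = √3 • v t) :
    HasInvariantCurveOfPeriod (envelopedRegion q v) 3 := by
  have h3 : 0 < √3 := Real.sqrt_pos.2 (by norm_num)
  -- The orbit triangle has `q t`, `q (t + 2π/3)`, `q (t + 4π/3)` as midpoints of its sides, so half
  -- of its side along `v t` is the chord `√3 • v t`.
  set p : ℝ → Plane := fun t => q t - √3 • v t with hp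
  have hpper : Function.Periodic p (2 * π) := fun t => by
    simp only [hp, h.periodic t, h.periodic_dir t]
  have hpcont : Continuous p := h.continuous_curve.sub (h.continuous_dir.const_smul (√3))
  have hout : ∀ t, p t ∉ envelopedRegion q v := fun t ht => by
    have h0 : areaForm2 (v t) (p t - q t) = 0 := by
      rw [hp]
      simp only [sub_sub_cancel_left]
      rw [areaForm2_swap, areaForm2_neg_left, areaForm2_smul_left, areaForm2_self]; simp
    have := h.eq_curve ht h0
    rw [hp] at this
    exact smul_ne_zero h3.ne' (h.dir_ne_zero t) (sub_eq_self.1 this)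
  have htan : ∀ t, IsTangencyPoint (envelopedRegion q v) (p t) (q t) := fun t => by
    refine ⟨h.curve_mem t, fun z hz => ?_⟩
    have e1 : q t - p t = √3 • v t := by simp [hp]
    have e2 : z - p t = (z - q t) + √3 • v t := by simp only [hp]; module
    rw [e1, e2, areaForm2_smul_left, areaForm2_add_right, areaForm2_smul_right, areaForm2_self,
      mul_zero, add_zero]
    exact mul_nonneg h3.le (hz t)
  have hB : ∀ t, outerBilliard (envelopedRegion q v) (p t) = p (t + 2 * π / 3) := fun t => by
    rw [outerBilliard_eq h.strictConvex (hout t) (htan t)]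
    have e1 := hchord t
    have e2 := hchord (t + 2 * π / 3)
    rw [show t + 2 * π / 3 + 2 * π / 3 = t + 4 * π / 3 by ring,
      show t + 2 * π / 3 + 4 * π / 3 = t + 2 * π by ring, h.periodic t] at e2
    simp only [hp, ← e1, ← e2]
    module
  have hp3 : ∀ t, p (t + 2 * π / 3 + 2 * π / 3 + 2 * π / 3) = p t := fun t => by
    rw [show t + 2 * π / 3 + 2 * π / 3 + 2 * π / 3 = t + 2 * π by ring, hpper t]
  set c : Circle → Plane := fun z => hpper.lift (AddCircle.homeomorphCircle'.symm z) with hcdef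
  have hrange : range c = range p := by
    ext x
    constructor
    · rintro ⟨z, rfl⟩
      obtain ⟨t, ht⟩ := QuotientAddGroup.mk_surjective (AddCircle.homeomorphCircle'.symm z)
      exact ⟨t, by rw [hcdef]; simp only [← ht]; rfl⟩
    · rintro ⟨t, rfl⟩
      refine ⟨AddCircle.homeomorphCircle' (t : AddCircle (2 * π)), ?_⟩
      simp only [hcdef, Homeomorph.symm_apply_apply]; rfl
  refine ⟨c, ?_, ?_, ?_, ?_, ?_⟩
  · have hlift : Continuous hpper.lift := continuous_coinduced_dom.2 hpcont
    exact hlift.comp (AddCircle.homeomorphCircle'.symm).continuous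
  · intro x y hxy
    have hsurj : ∀ z : AddCircle (2 * π), ∃ s ∈ Ico 0 (0 + 2 * π), (s : AddCircle (2 * π)) = z :=
      fun z => by
        have : Fact (0 < 2 * π) := ⟨Real.two_pi_pos⟩
        have hz : z ∈ univ := mem_univ z
        rwa [← AddCircle.coe_image_Ico_eq (2 * π) 0] at hz
    apply AddCircle.homeomorphCircle'.symm.injective
    obtain ⟨s, hs, hsx⟩ := hsurj (AddCircle.homeomorphCircle'.symm x)
    obtain ⟨t, ht, hty⟩ := hsurj (AddCircle.homeomorphCircle'.symm y)
    have hst : p s = p t := by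
      simp only [hcdef, ← hsx, ← hty] at hxy
      exact hxy
    have hq := IsTangencyPoint.unique h.strictConvex (hout s) (htan s) (hst ▸ htan t)
    rw [← hsx, ← hty, h.eq_of_curve_eq hq.symm (by linarith [hs.2, ht.1]) (by linarith [hs.1, ht.2])]
  · rw [hrange]; rintro _ ⟨t, rfl⟩; exact hout t
  · rw [hrange]
    apply Subset.antisymm
    · rintro _ ⟨_, ⟨t, rfl⟩, rfl⟩; exact ⟨_, (hB t).symm⟩
    · rintro _ ⟨t, rfl⟩
      exact ⟨_, ⟨t + 2 * π / 3 + 2 * π / 3, rfl⟩, by rw [hB, hp3]⟩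
  · rw [hrange]
    rintro _ ⟨t, rfl⟩
    change outerBilliard _ (outerBilliard _ (outerBilliard _ (p t))) = p t
    rw [hB, hB, hB, hp3]

theorem isCriticalTriangle {q v w : ℝ → Plane} {l : ℝ → ℝ} (h : IsOvalFrame q v w l)
    (hchord : ∀ t, q (t + 2 * π / 3) - q (t + 4 * π / 3) = √3 • v t) :
    IsCriticalTriangle (envelopedRegion q v) (q 0) (q (2 * π / 3)) (q (4 * π / 3)) := by
  have key : ∀ t z, z ∈ envelopedRegion q v →
      0 ≤ areaForm2 (q (t + 2 * π / 3) - q (t + 4 * π / 3)) (z - q t) := fun t z hz => by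
    rw [hchord, areaForm2_smul_left]
    exact mul_nonneg (Real.sqrt_nonneg 3) (hz t)
  refine ⟨h.curve_mem _, h.curve_mem _, h.curve_mem _, fun z hz => ?_, fun z hz => ?_,
    fun z hz => ?_⟩
  · have := key 0 z hz
    rwa [zero_add, zero_add] at this
  · have := key (2 * π / 3) z hz
    rwa [show 2 * π / 3 + 2 * π / 3 = 4 * π / 3 by ring,
      show 2 * π / 3 + 4 * π / 3 = 0 + 2 * π by ring, h.periodic 0] at this
  · have := key (4 * π / 3) z hz
    rwa [show 4 * π / 3 + 2 * π / 3 = 0 + 2 * π by ring,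
      show 4 * π / 3 + 4 * π / 3 = 2 * π / 3 + 2 * π by ring, h.periodic 0, h.periodic] at this

end IsOvalFrame

/-! ### A family of regions with fourfold symmetry -/

theorem unitDir_eq_smul_add (t : ℝ) : unitDir t = Real.cos t • mkVec 1 0 + Real.sin t • mkVec 0 1 := by
  apply plane_ext <;> simp [vec_zero, vec_one, unitDir_zero_apply, unitDir_one_apply]

theorem hasDerivAt_unitDir (t : ℝ) : HasDerivAt unitDir (unitDir (t + π / 2)) t := by
  have h := ((Real.hasDerivAt_cos t).smul_const (mkVec 1 0)).add
    ((Real.hasDerivAt_sin t).smul_const (mkVec 0 1))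
  refine (h.congr_deriv ?_).congr_of_eventuallyEq
    (Eventually.of_forall fun s => unitDir_eq_smul_add s)
  rw [unitDir_eq_smul_add, Real.cos_add_pi_div_two, Real.sin_add_pi_div_two]

theorem HasDerivAt.unitDir {f : ℝ → ℝ} {f' t : ℝ} (hf : HasDerivAt f f' t) :
    HasDerivAt (fun s => unitDir (f s)) (f' • unitDir (f t + π / 2)) t :=
  (hasDerivAt_unitDir (f t)).scomp t hf

theorem contDiff_unitDir : ContDiff ℝ 2 unitDir := by
  rw [show unitDir = _ from funext unitDir_eq_smul_add]
  fun_prop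

theorem unitDir_add_int_mul_two_pi (t : ℝ) (k : ℤ) : unitDir (t + k * (2 * π)) = unitDir t :=
  plane_ext (Real.cos_add_int_mul_two_pi t k) (Real.sin_add_int_mul_two_pi t k)

theorem unitDir_add_pi (t : ℝ) : unitDir (t + π) = -unitDir t :=
  plane_ext (Real.cos_add_pi t) (Real.sin_add_pi t)

theorem areaForm2_unitDir_add_pi_div_two (s t : ℝ) :
    areaForm2 (unitDir s) (unitDir (t + π / 2)) = Real.cos (t - s) := by
  rw [areaForm2_unitDir, show t + π / 2 - s = t - s + π / 2 by ring, Real.sin_add_pi_div_two]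

theorem cos_smul_unitDir (s t : ℝ) :
    Real.cos s • unitDir t = (1 / 2 : ℝ) • (unitDir (t + s) + unitDir (t - s)) := by
  apply plane_ext <;>
    simp only [PiLp.smul_apply, PiLp.add_apply, unitDir_zero_apply, unitDir_one_apply, smul_eq_mul,
      Real.cos_add, Real.cos_sub, Real.sin_add, Real.sin_sub] <;> ring

theorem unitDir_add_third_sub (t : ℝ) :
    unitDir (t + 2 * π / 3) - unitDir (t + 4 * π / 3) = √3 • unitDir (t + π / 2) := by
  have h3 := sqrt_three_mul_self
  rw [show t + 4 * π / 3 = t + 2 * π / 3 + 2 * π / 3 by ring]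
  apply plane_ext <;>
    simp only [PiLp.smul_apply, PiLp.sub_apply, unitDir_zero_apply, unitDir_one_apply, smul_eq_mul,
      Real.cos_add_pi_div_two, Real.sin_add_pi_div_two]
  · rw [cos_add_third (t + 2 * π / 3), sin_add_third, cos_add_third]
    linear_combination (1 / 4 : ℝ) * Real.cos t * h3
  · rw [sin_add_third (t + 2 * π / 3), sin_add_third, cos_add_third]
    linear_combination (1 / 4 : ℝ) * Real.sin t * h3

theorem abs_sin_nat_mul_le (k : ℕ) (x : ℝ) : |Real.sin (k * x)| ≤ k * |Real.sin x| := by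
  induction k with
  | zero => simp
  | succ k ih =>
    rw [Nat.cast_succ, add_mul, one_mul, Real.sin_add, add_mul, one_mul]
    refine (abs_add_le _ _).trans ?_
    rw [abs_mul, abs_mul]
    have h1 := mul_le_mul_of_nonneg_left (Real.abs_cos_le_one x) (abs_nonneg (Real.sin (k * x)))
    have h2 := mul_le_mul_of_nonneg_right (Real.abs_cos_le_one (k * x)) (abs_nonneg (Real.sin x))
    linarith

/-- A closed curve with the symmetry of a square. -/
noncomputable def ovalCurve (ε n t : ℝ) : Plane :=
  unitDir t + ε • unitDir (5 * t) - (n / 3) • unitDir (-3 * t) - (n * ε / 9) • unitDir (9 * t)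

/-- The direction of the tangent lines of `ovalCurve`. -/
noncomputable def ovalDir (ε t : ℝ) : Plane := unitDir (t + π / 2) - ε • unitDir (5 * t + π / 2)

theorem abs_mul_cos_le {e : ℝ} (he : 0 ≤ e) (x : ℝ) : |e * Real.cos x| ≤ e := by
  rw [abs_mul, abs_of_nonneg he]
  exact mul_le_of_le_one_right he (Real.abs_cos_le_one x)

theorem areaForm2_ovalDir (ε t s : ℝ) : areaForm2 (ovalDir ε t) (ovalDir ε s) =
    Real.sin (s - t) - 2 * ε * (Real.sin (3 * (s - t)) * Real.cos (2 * (s + t))) +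
      ε ^ 2 * Real.sin (5 * (s - t)) := by
  have h : Real.sin (5 * s - t) + Real.sin (s - 5 * t) =
      2 * (Real.sin (3 * (s - t)) * Real.cos (2 * (s + t))) := by
    rw [show 5 * s - t = 3 * (s - t) + 2 * (s + t) by ring,
      show s - 5 * t = 3 * (s - t) - 2 * (s + t) by ring, Real.sin_add, Real.sin_sub]
    ring
  simp only [ovalDir, areaForm2_sub_left, areaForm2_sub_right, areaForm2_smul_left,
    areaForm2_smul_right, areaForm2_unitDir, add_sub_add_right_eq_sub, ← mul_sub]
  linear_combination -ε * h

/-- In complex notation the direction is `i (e^{it} - ε e^{5it})` and the speed `1 + nε + n e^{4it}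
+ n e^{-4it}`. Their product has modes 1, 5, -3, 9. It has no constant term, so it integrates to a
closed curve; the coefficient of mode 5 agrees with the one in `ovalCurve` exactly when `n (1 - ε²)
= 6ε`. -/
theorem isOvalFrame {ε n : ℝ} (h0 : 0 ≤ ε) (h1 : ε ≤ 1 / 20) (hn0 : 0 ≤ n) (hn1 : n ≤ 1 / 3)
    (hn : n * (1 - ε ^ 2) = 6 * ε) :
    IsOvalFrame (ovalCurve ε n) (ovalDir ε) (fun t => -unitDir t + (5 * ε) • unitDir (5 * t))
      (fun t => 1 + n * ε + 2 * (n * Real.cos (4 * t))) where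
  contDiff := by
    have h : ∀ k : ℝ, ContDiff ℝ 2 fun t => unitDir (k * t) := fun k =>
      contDiff_unitDir.comp (contDiff_const.mul contDiff_id)
    exact ((contDiff_unitDir.add ((h 5).const_smul ε)).sub ((h (-3)).const_smul (n / 3))).sub
      ((h 9).const_smul (n * ε / 9))
  periodic t := by
    have e1 := unitDir_add_int_mul_two_pi (5 * t) 5
    have e2 := unitDir_add_int_mul_two_pi (-3 * t) (-3)
    have e3 := unitDir_add_int_mul_two_pi (9 * t) 9
    push_cast at e1 e2 e3
    simp only [ovalCurve, unitDir_add_two_pi, mul_add, e1, e2, e3]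
  hasDerivAt t := by
    have hk : ∀ k : ℝ, HasDerivAt (fun s => unitDir (k * s)) (k • unitDir (k * t + π / 2)) t :=
      fun k => ((hasDerivAt_id t).const_mul k).unitDir.congr_deriv (by simp)
    have h := (((hasDerivAt_unitDir t).add ((hk 5).const_smul ε)).sub
      ((hk (-3)).const_smul (n / 3))).sub ((hk 9).const_smul (n * ε / 9))
    refine h.congr_deriv ?_
    have e1 := cos_smul_unitDir (4 * t) (t + π / 2)
    have e2 := cos_smul_unitDir (4 * t) (5 * t + π / 2)
    rw [show t + π / 2 + 4 * t = 5 * t + π / 2 by ring,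
      show t + π / 2 - 4 * t = -3 * t + π / 2 by ring] at e1
    rw [show 5 * t + π / 2 + 4 * t = 9 * t + π / 2 by ring,
      show 5 * t + π / 2 - 4 * t = t + π / 2 by ring] at e2
    rw [ovalDir]
    linear_combination (norm := module) (-(2 * n)) • e1 + (2 * n * ε) • e2 - hn • unitDir (5 * t + π / 2)
  speed_pos t := by
    have := abs_le.1 (abs_mul_cos_le hn0 (4 * t))
    have : 0 ≤ n * ε := by positivity
    linarith
  hasDerivAt_dir t := by
    have h := ((hasDerivAt_id t).add_const (π / 2)).unitDir.sub
      ((((hasDerivAt_id t).const_mul 5).add_const (π / 2)).unitDir.const_smul ε)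
    refine h.congr_deriv ?_
    simp only [id_eq, mul_one, one_smul]
    rw [add_assoc, add_halves, add_assoc (5 * t), add_halves, unitDir_add_pi, unitDir_add_pi]
    module
  antiperiodic t := by
    have e := unitDir_add_int_mul_two_pi (5 * t + π / 2 + π) 2
    push_cast at e
    rw [ovalDir, ovalDir, show t + π + π / 2 = t + π / 2 + π by ring,
      show 5 * (t + π) + π / 2 = 5 * t + π / 2 + π + 2 * (2 * π) by ring, e, unitDir_add_pi,
      unitDir_add_pi]
    module
  turn t s hts hst := by
    rw [areaForm2_ovalDir]
    have hpos : 0 < Real.sin (s - t) := Real.sin_pos_of_pos_of_lt_pi (by linarith) (by linarith)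
    have a3 := abs_sin_nat_mul_le 3 (s - t)
    have a5 := abs_sin_nat_mul_le 5 (s - t)
    rw [abs_of_pos hpos] at a3 a5
    push_cast at a3 a5
    have a3' : |Real.sin (3 * (s - t)) * Real.cos (2 * (s + t))| ≤ 3 * Real.sin (s - t) := by
      rw [abs_mul]
      exact (mul_le_of_le_one_right (abs_nonneg _) (Real.abs_cos_le_one _)).trans a3
    have b3 := mul_le_mul_of_nonneg_left (abs_le.1 a3').2 (by linarith : 0 ≤ 2 * ε)
    have b5 := mul_le_mul_of_nonneg_left (abs_le.1 a5).1 (sq_nonneg ε)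
    -- The bounds by 3 and 5 times `sin (s - t)` reduce the claim to the positivity of this factor.
    have c : 0 < (1 - 6 * ε - 5 * ε ^ 2) * Real.sin (s - t) := mul_pos (by nlinarith) hpos
    linarith
  curvature_pos t := by
    have e : ∀ x y : ℝ, areaForm2 (unitDir (x + π / 2)) (unitDir y) = -Real.cos (x - y) :=
      fun x y => by rw [areaForm2_swap, areaForm2_unitDir_add_pi_div_two]
    have hneg : ∀ u v : Plane, areaForm2 u (-v) = -areaForm2 u v := fun u v => by
      rw [areaForm2_swap, areaForm2_neg_left, ← areaForm2_swap]
    simp only [ovalDir, areaForm2_sub_left, areaForm2_add_right, areaForm2_smul_left,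
      areaForm2_smul_right, hneg, e, sub_self, Real.cos_zero]
    rw [show Real.cos (t - 5 * t) = Real.cos (5 * t - t) by rw [← Real.cos_neg, neg_sub]]
    have := abs_le.1 (abs_mul_cos_le h0 (5 * t - t))
    nlinarith
  zero_inside t := by
    simp only [ovalCurve, ovalDir, areaForm2_sub_left, areaForm2_add_left, areaForm2_smul_left,
      areaForm2_sub_right, areaForm2_smul_right, areaForm2_unitDir_add_pi_div_two, sub_self,
      Real.cos_zero]
    have k : ∀ {e : ℝ} (x : ℝ), 0 ≤ e → -e ≤ e * Real.cos x ∧ e * Real.cos x ≤ e := fun x he =>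
      abs_le.1 (abs_mul_cos_le he x)
    have hne : n * ε ≤ 1 / 60 := by nlinarith
    have hne0 : 0 ≤ n * ε := by positivity
    have hnee : n * ε * ε ≤ 1 / 1200 := by nlinarith
    have hnee0 : 0 ≤ n * ε * ε := by positivity
    have hee : ε * ε ≤ 1 / 400 := by nlinarith
    have := k (5 * t - t) h0
    have := k (t - 5 * t) h0
    have := k (t - -3 * t) hn0
    have := k (5 * t - -3 * t) hne0
    have := k (t - 9 * t) hne0
    have := k (5 * t - 9 * t) hnee0
    linarith

/-- Taking this chord multiplies the mode `k` by `i√3`, `-i√3` or `0` according as `k` is 1, 2 or 0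
modulo 3. The modes 1 and 5 give the two terms of the direction; the modes -3 and 9 drop out and are
free to make the tangent parallel to it. -/
theorem ovalCurve_chord (ε n t : ℝ) :
    ovalCurve ε n (t + 2 * π / 3) - ovalCurve ε n (t + 4 * π / 3) = √3 • ovalDir ε t := by
  have a1 := unitDir_add_int_mul_two_pi (5 * t + 4 * π / 3) 1
  have a2 := unitDir_add_int_mul_two_pi (5 * t + 2 * π / 3) 3
  have b1 := unitDir_add_int_mul_two_pi (-3 * t) (-1)
  have b2 := unitDir_add_int_mul_two_pi (-3 * t) (-2)
  have c1 := unitDir_add_int_mul_two_pi (9 * t) 3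
  have c2 := unitDir_add_int_mul_two_pi (9 * t) 6
  push_cast at a1 a2 b1 b2 c1 c2
  have e1 := unitDir_add_third_sub t
  have e5 := unitDir_add_third_sub (5 * t)
  rw [ovalCurve, ovalCurve, ovalDir,
    show 5 * (t + 2 * π / 3) = 5 * t + 4 * π / 3 + 1 * (2 * π) by ring,
    show 5 * (t + 4 * π / 3) = 5 * t + 2 * π / 3 + 3 * (2 * π) by ring,
    show -3 * (t + 2 * π / 3) = -3 * t + -1 * (2 * π) by ring,
    show -3 * (t + 4 * π / 3) = -3 * t + -2 * (2 * π) by ring,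
    show 9 * (t + 2 * π / 3) = 9 * t + 3 * (2 * π) by ring,
    show 9 * (t + 4 * π / 3) = 9 * t + 6 * (2 * π) by ring, a1, a2, b1, b2, c1, c2]
  linear_combination (norm := module) e1 - ε • e5

/-- The region bounded by `ovalCurve`. -/
def ovalRegion (ε n : ℝ) : Set Plane := envelopedRegion (ovalCurve ε n) (ovalDir ε)

/-- The disk belongs to the family, so that it is a table with an invariant curve of period 3 by the
same lemmas as the other regions. -/
theorem ovalRegion_zero : ovalRegion 0 0 = unitDisk := by
  have hc : ∀ t, ovalCurve 0 0 t = unitDir t := fun t => by simp [ovalCurve]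
  have hv : ∀ t, ovalDir 0 t = unitDir (t + π / 2) := fun t => by simp [ovalDir]
  have key : ∀ z t, areaForm2 (ovalDir 0 t) (z - ovalCurve 0 0 t) =
      1 - (Real.cos t * z 0 + Real.sin t * z 1) := fun z t => by
    rw [hc, hv, areaForm2_sub_right, areaForm2_unitDir, show t - (t + π / 2) = -(π / 2) by ring,
      Real.sin_neg, Real.sin_pi_div_two]
    simp only [areaForm2, unitDir_zero_apply, unitDir_one_apply, Real.cos_add_pi_div_two,
      Real.sin_add_pi_div_two]
    ring
  ext z
  rw [mem_unitDisk_iff]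
  change (∀ t, _) ↔ _
  simp only [key, sub_nonneg]
  constructor
  · intro h
    by_cases hz : z = 0
    · rw [hz]; simp
    · obtain ⟨l, t, hl, hzt⟩ := exists_eq_smul_unitDir hz
      have h0 : z 0 = l * Real.cos t := congrArg (fun v : Plane => v 0) hzt
      have h1 : z 1 = l * Real.sin t := congrArg (fun v : Plane => v 1) hzt
      have := h t
      have hs := Real.sin_sq_add_cos_sq t
      have e : Real.cos t * z 0 + Real.sin t * z 1 = l := by
        rw [h0, h1]; linear_combination l * hs
      rw [e] at this
      have e2 : z 0 ^ 2 + z 1 ^ 2 = l ^ 2 := by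
        rw [h0, h1]; linear_combination l ^ 2 * hs
      rw [e2]
      exact pow_le_one₀ hl.le this
  · intro h t
    nlinarith [sq_nonneg (z 0 - Real.cos t), sq_nonneg (z 1 - Real.sin t),
      Real.sin_sq_add_cos_sq t]

theorem isOvalFrame_zero : IsOvalFrame (ovalCurve 0 0) (ovalDir 0)
    (fun t => -unitDir t + (5 * 0 : ℝ) • unitDir (5 * t))
    (fun t => 1 + 0 * 0 + 2 * (0 * Real.cos (4 * t))) :=
  isOvalFrame le_rfl (by norm_num) le_rfl (by norm_num) (by norm_num)

theorem isBilliardTable_unitDisk : IsBilliardTable unitDisk :=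
  ovalRegion_zero ▸ isOvalFrame_zero.isBilliardTable

theorem hasInvariantCurveOfPeriod_unitDisk : HasInvariantCurveOfPeriod unitDisk 3 :=
  ovalRegion_zero ▸ isOvalFrame_zero.hasInvariantCurveOfPeriod (ovalCurve_chord 0 0)

theorem exists_isCriticalTriangle_unitDisk :
    ∃ a b c, IsCriticalTriangle unitDisk a b c ∧ b ≠ c ∧ triArea2 a b c = 3 / 2 * √3 := by
  have h := isOvalFrame_zero.isCriticalTriangle (ovalCurve_chord 0 0)
  have hc : ∀ t, ovalCurve 0 0 t = unitDir t := fun t => by simp [ovalCurve]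
  have hd := unitDir_add_third_sub 0
  rw [zero_add, zero_add, zero_add] at hd
  have h3 : √3 ≠ 0 := (Real.sqrt_pos.2 (by norm_num)).ne'
  change IsCriticalTriangle (ovalRegion 0 0) _ _ _ at h
  rw [ovalRegion_zero, hc, hc, hc] at h
  refine ⟨_, _, _, h, ?_, ?_⟩
  · rw [← sub_ne_zero, hd]
    exact smul_ne_zero h3 (unitDir_ne_zero _)
  · rw [triArea2, show 4 * π / 3 = 0 + 2 * π / 3 + 2 * π / 3 by ring,
      show 2 * π / 3 = 0 + 2 * π / 3 by ring]
    simp only [areaForm2, PiLp.sub_apply, unitDir_zero_apply, unitDir_one_apply]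
    rw [show 0 + (0 + 2 * π / 3) + (0 + 2 * π / 3) = 0 + 2 * π / 3 + 2 * π / 3 by ring,
      cos_add_third (0 + 2 * π / 3), sin_add_third (0 + 2 * π / 3), cos_add_third 0,
      sin_add_third 0, Real.sin_zero, Real.cos_zero]
    linear_combination (√3 / 8) * sqrt_three_mul_self

/-! ### The regions are not ellipses -/

theorem affineEquiv_apply (A : Plane ≃ᵃ[ℝ] Plane) (z : Plane) :
    A z = planeMap (A.linear (mkVec 1 0)) (A.linear (mkVec 0 1)) z + A 0 := by
  have := A.map_vadd 0 z
  rw [vadd_eq_add, add_zero, vadd_eq_add] at this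
  rw [this]
  exact congrArg (· + A 0) (LinearMap.congr_fun (eq_planeMap A.linear.toLinearMap) z)

theorem IsEllipse.exists_quadratic {Ω : Set Plane} (h : IsEllipse Ω) :
    ∃ u v w : Plane, u ≠ 0 ∧ ∀ z ∈ frontier Ω, ‖planeMap u v z + w‖ ^ 2 = 1 := by
  obtain ⟨A, rfl⟩ := h
  refine ⟨A.symm.linear (mkVec 1 0), A.symm.linear (mkVec 0 1), A.symm 0, ?_, fun z hz => ?_⟩
  · intro h0
    have := (map_eq_zero_iff A.symm.linear A.symm.linear.injective).1 h0
    have := congrArg (fun v : Plane => v 0) this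
    exact one_ne_zero this
  · rw [← affineEquiv_apply]
    have e : frontier (A '' unitDisk) = A '' frontier unitDisk :=
      (A.toContinuousAffineEquiv.toHomeomorph.image_frontier unitDisk).symm
    rw [e, unitDisk, frontier_closedBall _ one_ne_zero] at hz
    obtain ⟨x, hx, rfl⟩ := hz
    rw [AffineEquiv.symm_apply_apply, mem_sphere_zero_iff_norm.1 hx, one_pow]

/-- An ellipse with the symmetry of a square is a circle. -/
theorem IsEllipse.norm_eq_of_symm {Ω : Set Plane} (h : IsEllipse Ω)
    (hs : ∀ z ∈ frontier Ω, mkVec (-z 1) (z 0) ∈ frontier Ω) {z z' : Plane}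
    (hz : z ∈ frontier Ω) (hz' : z' ∈ frontier Ω) : ‖z‖ ^ 2 = ‖z'‖ ^ 2 := by
  obtain ⟨u, v, w, hu, hq⟩ := h.exists_quadratic
  have key : ∀ z ∈ frontier Ω,
      (‖u‖ ^ 2 + ‖v‖ ^ 2) * ‖z‖ ^ 2 = 2 * (1 - ‖w‖ ^ 2) := by
    intro z hz
    have h1 := hs z hz
    have h2 := hs _ h1
    have h3 := hs _ h2
    have q0 := hq _ hz
    have q1 := hq _ h1
    have q2 := hq _ h2
    have q3 := hq _ h3
    simp only [plane_norm_sq, planeMap_apply, vec_zero, vec_one, PiLp.add_apply, PiLp.smul_apply,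
      smul_eq_mul] at q0 q1 q2 q3 ⊢
    -- Summing over the four quarter turns cancels the terms linear in `z` and the mixed product of
    -- its coordinates.
    linear_combination (1 / 2 : ℝ) * (q0 + q1 + q2 + q3)
  have hpos : 0 < ‖u‖ ^ 2 + ‖v‖ ^ 2 := by
    have := norm_pos_iff.2 hu
    positivity
  exact mul_left_cancel₀ hpos.ne' ((key z hz).trans (key z' hz').symm)

theorem unitDir_add_pi_div_two (t : ℝ) : unitDir (t + π / 2) = mkVec (-unitDir t 1) (unitDir t 0) :=
  plane_ext (Real.cos_add_pi_div_two t) (Real.sin_add_pi_div_two t)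

theorem ovalCurve_add_pi_div_two (ε n t : ℝ) :
    ovalCurve ε n (t + π / 2) = mkVec (-ovalCurve ε n t 1) (ovalCurve ε n t 0) := by
  have e1 := unitDir_add_int_mul_two_pi (5 * t + π / 2) 1
  have e2 := unitDir_add_int_mul_two_pi (-3 * t + π / 2) (-1)
  have e3 := unitDir_add_int_mul_two_pi (9 * t + π / 2) 2
  push_cast at e1 e2 e3
  simp only [ovalCurve]
  rw [show 5 * (t + π / 2) = 5 * t + π / 2 + 1 * (2 * π) by ring,
    show -3 * (t + π / 2) = -3 * t + π / 2 + -1 * (2 * π) by ring,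
    show 9 * (t + π / 2) = 9 * t + π / 2 + 2 * (2 * π) by ring, e1, e2, e3]
  simp only [unitDir_add_pi_div_two]
  apply plane_ext <;>
    simp only [PiLp.add_apply, PiLp.sub_apply, PiLp.smul_apply, vec_zero, vec_one, smul_eq_mul]
  ring

/-- The squared distances from the origin at the parameters `0` and `π / 4` differ by a nonzero
multiple of `(n - 3ε) (9 - nε)`. -/
theorem not_isEllipse_ovalRegion {ε n : ℝ} (h : IsOvalFrame (ovalCurve ε n) (ovalDir ε)
      (fun t => -unitDir t + (5 * ε) • unitDir (5 * t))
      (fun t => 1 + n * ε + 2 * (n * Real.cos (4 * t))))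
    (hne : 3 * ε < n) (hn : n * ε < 9) : ¬ IsEllipse (ovalRegion ε n) := by
  intro he
  have hf : frontier (ovalRegion ε n) = range (ovalCurve ε n) := h.frontier_eq
  have hmem : ∀ t, ovalCurve ε n t ∈ frontier (ovalRegion ε n) := fun t => by
    rw [hf]; exact mem_range_self t
  have := he.norm_eq_of_symm (fun z hz => by
    rw [hf] at hz ⊢
    obtain ⟨t, rfl⟩ := hz
    exact ⟨_, ovalCurve_add_pi_div_two ε n t⟩) (hmem 0) (hmem (π / 4))
  have e0 : ovalCurve ε n 0 = (1 + ε - n / 3 - n * ε / 9) • unitDir 0 := by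
    simp only [ovalCurve, mul_zero]
    module
  have e1 : ovalCurve ε n (π / 4) = (1 - ε + n / 3 - n * ε / 9) • unitDir (π / 4) := by
    have a2 := unitDir_add_int_mul_two_pi (π / 4 + π) (-1)
    have a3 := unitDir_add_int_mul_two_pi (π / 4) 1
    push_cast at a2 a3
    rw [ovalCurve, show 5 * (π / 4) = π / 4 + π by ring,
      show -3 * (π / 4) = π / 4 + π + -1 * (2 * π) by ring,
      show 9 * (π / 4) = π / 4 + 1 * (2 * π) by ring, a2, a3, unitDir_add_pi]
    module
  rw [e0, e1, norm_smul, norm_smul, norm_unitDir, norm_unitDir, mul_one, mul_one,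
    Real.norm_eq_abs, Real.norm_eq_abs, sq_abs, sq_abs] at this
  have : (n - 3 * ε) * (9 - n * ε) = 0 := by linear_combination (-27 / 4 : ℝ) * this
  exact (mul_pos (sub_pos.2 hne) (sub_pos.2 hn)).ne' this

theorem exists_table_not_isEllipse : ∃ Ω : Set Plane, IsBilliardTable Ω ∧
    HasInvariantCurveOfPeriod Ω 3 ∧ ¬ IsEllipse Ω := by
  -- For `ε = 1/20` the closing condition `n (1 - ε²) = 6ε` has the solution `n = 40/133`.
  have h : IsOvalFrame (ovalCurve (1 / 20) (40 / 133)) _ _ _ :=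
    isOvalFrame (by norm_num) (by norm_num) (by norm_num) (by norm_num) (by norm_num)
  exact ⟨ovalRegion (1 / 20) (40 / 133), h.isBilliardTable,
    h.hasInvariantCurveOfPeriod (ovalCurve_chord _ _),
    not_isEllipse_ovalRegion h (by norm_num) (by norm_num)⟩

/-! ### The minimal average action at rotation number one third -/

theorem IsMinimalAverageAction.unique {S : ℝ → ℝ → ℝ} {ω b b' : ℝ}
    (h : IsMinimalAverageAction S ω b) (h' : IsMinimalAverageAction S ω b') : b = b' := by
  obtain ⟨x, hx, hω⟩ := h.1
  exact tendsto_nhds_unique (h.2 x hx hω) (h'.2 x hx hω)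

theorem IsMinimalAverageAction.matherBeta_eq {S : ℝ → ℝ → ℝ} {ω b : ℝ}
    (h : IsMinimalAverageAction S ω b) : matherBeta S ω = b := by
  have hex : ∃ b, IsMinimalAverageAction S ω b := ⟨b, h⟩
  rw [matherBeta, dif_pos hex]
  exact hex.choose_spec.unique h

/-- The value of the `β`-function is two thirds of the (doubled) area of a critical triangle. -/
theorem isMinimalAverageAction_betaOut {Ω : Set Plane} (hΩ : IsBilliardTable Ω)
    (hcurve : HasInvariantCurveOfPeriod Ω 3) :
    IsMinimalAverageAction (outerGen Ω) (1 / 3) (betaOut Ω (1 / 3)) ∧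
      ∀ a b c, IsCriticalTriangle Ω a b c → b ≠ c → triArea2 a b c = 3 / 2 * betaOut Ω (1 / 3) := by
  obtain ⟨β, h1, h2⟩ := exists_minimalAverageAction hΩ hcurve
  have e : betaOut Ω (1 / 3) = β := h1.matherBeta_eq
  rw [e]
  exact ⟨h1, h2⟩

theorem exists_isMaximalTriangle_betaOut {Ω : Set Plane} (hΩ : IsBilliardTable Ω)
    (hcurve : HasInvariantCurveOfPeriod Ω 3) :
    ∃ a b c, IsMaximalTriangle Ω a b c ∧ triArea2 a b c = 3 / 2 * betaOut Ω (1 / 3) := by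
  obtain ⟨a, b, c, h⟩ := exists_isMaximalTriangle hΩ.isCompact ⟨0, interior_subset hΩ.zero_mem⟩
  exact ⟨a, b, c, h, (isMinimalAverageAction_betaOut hΩ hcurve).2 a b c h.isCriticalTriangle
    (ne_of_triArea2_pos (h.area_pos hΩ.zero_mem))⟩

/-- All critical triangles of the disk have the same area, so the value is read off an inscribed
equilateral triangle. -/
theorem betaOut_unitDisk : betaOut unitDisk (1 / 3) = √3 := by
  obtain ⟨a, b, c, h, hbc, e⟩ := exists_isCriticalTriangle_unitDisk
  have := (isMinimalAverageAction_betaOut isBilliardTable_unitDisk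
    hasInvariantCurveOfPeriod_unitDisk).2 a b c h hbc
  linarith

theorem le_betaOut {Ω : Set Plane} (hΩ : IsBilliardTable Ω)
    (hcurve : HasInvariantCurveOfPeriod Ω 3) :
    betaOut Ω (1 / 3) ≥ volume.real Ω / π * betaOut unitDisk (1 / 3) := by
  obtain ⟨a, b, c, h, e⟩ := exists_isMaximalTriangle_betaOut hΩ hcurve
  have := h.sas hΩ.isCompact hΩ.strictConvex ⟨0, hΩ.zero_mem⟩
  rw [e] at this
  rw [betaOut_unitDisk, ge_iff_le, div_mul_eq_mul_div, div_le_iff₀ Real.pi_pos]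
  linarith

theorem betaOut_eq_iff {Ω : Set Plane} (hΩ : IsBilliardTable Ω)
    (hcurve : HasInvariantCurveOfPeriod Ω 3) :
    betaOut Ω (1 / 3) = volume.real Ω / π * betaOut unitDisk (1 / 3) ↔ IsEllipse Ω := by
  obtain ⟨a, b, c, h, e⟩ := exists_isMaximalTriangle_betaOut hΩ hcurve
  have hiff : betaOut Ω (1 / 3) = volume.real Ω / π * betaOut unitDisk (1 / 3) ↔
      3 * √3 * volume.real Ω = 2 * π * triArea2 a b c := by
    rw [betaOut_unitDisk, div_mul_eq_mul_div, eq_div_iff Real.pi_pos.ne', e]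
    constructor <;> intro h <;> linarith
  rw [hiff]
  refine ⟨h.isEllipse_of_sas_eq hΩ, fun hE => ?_⟩
  -- That a maximal triangle of the disk has doubled area `3/2 * √3` also follows from the value of
  -- `β`, without optimizing over inscribed triangles.
  obtain ⟨a', b', c', h', e'⟩ := exists_isMaximalTriangle_betaOut isBilliardTable_unitDisk
    hasInvariantCurveOfPeriod_unitDisk
  rw [betaOut_unitDisk] at e'
  exact h.sas_eq_of_isEllipse hE h' e'

theorem mainTheorem6 :
    IsMinimalAverageAction (outerGen unitDisk) (1 / 3) (betaOut unitDisk (1 / 3)) ∧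
    (∀ Ω : Set Plane, IsBilliardTable Ω → HasInvariantCurveOfPeriod Ω 3 →
      IsMinimalAverageAction (outerGen Ω) (1 / 3) (betaOut Ω (1 / 3)) ∧
      betaOut Ω (1 / 3) ≥ volume.real Ω / π * betaOut unitDisk (1 / 3) ∧
      (betaOut Ω (1 / 3) = volume.real Ω / π * betaOut unitDisk (1 / 3) ↔ IsEllipse Ω)) ∧
    (∃ Ω : Set Plane, IsBilliardTable Ω ∧ HasInvariantCurveOfPeriod Ω 3 ∧ ¬ IsEllipse Ω ∧
      betaOut Ω (1 / 3) > volume.real Ω / π * betaOut unitDisk (1 / 3)) := by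
  refine ⟨(isMinimalAverageAction_betaOut isBilliardTable_unitDisk
    hasInvariantCurveOfPeriod_unitDisk).1, fun Ω hΩ hc =>
      ⟨(isMinimalAverageAction_betaOut hΩ hc).1, le_betaOut hΩ hc, betaOut_eq_iff hΩ hc⟩, ?_⟩
  obtain ⟨Ω, hΩ, hc, hE⟩ := exists_table_not_isEllipse
  exact ⟨Ω, hΩ, hc, hE, lt_of_le_of_ne (le_betaOut hΩ hc)
    fun h => hE ((betaOut_eq_iff hΩ hc).1 h.symm)⟩
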